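/- Let $(R,\mathfrak m)$ be a Cohen–Macaulay (in particular Noetherian) local ring and let $I=(f_1,\dots,f_n)\subset R$ be an ideal minimally generated by $n$ elements, of height $g=\mathrm{ht}(I)\ge 1$. Let $B=R[y_1,\dots,y_n]$ be the standard graded polynomial ring (elements of $R$ in degree $0$), and regard $\mathrm{Sym}(I)$ as a $B$-module via $y_j\mapsto f_j\in \mathrm{Sym}_1(I)=I$. Let $K_\bullet$ be the Koszul complex of $f_1,\dots,f_n$ (so $K_i=\wedge^iR^n$), let $Z_i\subset K_i$ be its cycles, and let $\partial_{\mathbf f}$, $\partial_{\mathbf y}$ be the differentials of the Koszul complexes $K(f_1,\dots,f_n;B)$, $K(y_1,\dots,y_n;B)$ on $\wedge^\bullet R^n\otimes_RB$ (these anticommute). Let $$\mathcal Z_\bullet:\ 0\to Z_{n-1}\otimes_RB(-n+1)\to\cdots\to Z_i\otimes_R B(-i)\to\cdots\to Z_1\otimes_RB(-1)\to Z_0\otimes_RB$$ be the approximation complex, with differential induced by $\partial_{\mathbf y}$. Let $\mathfrak T_\bullet$ be the total complex of the double complex with terms $\mathfrak D_{p,q}=\wedge^{n-g+2+p+q}R^n\otimes_RB(-n+g-1-p)$,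 $p,q\ge0$, and differentials $\partial_{\mathbf y}:\mathfrak D_{p,q}\to\mathfrak D_{p-1,q}$, $\partial_{\mathbf f}:\mathfrak D_{p,q}\to\mathfrak D_{p,q-1}$; thus $\mathfrak T_j=\bigoplus_{p=0}^{j}\wedge^{n-g+2+j}R^n\otimes_RB(-n+g-1-p)$, and $\mathfrak T_j=0$ for $j<0$ or $j>g-2$. Suppose that $\mathcal Z_\bullet$ is acyclic (its homology vanishes in all positive degrees), and let $$F_\bullet:\ \cdots\to F_2\to R^n\xrightarrow{(f_1,\dots,f_n)}R\to0$$ be a free $R$-resolution of $R/I$ (with $F_0=R$, $F_1=R^n$). A graded free $B$-resolution of $\mathrm{Sym}(I)$ means one with differentials homogeneous of degree $0$ and with the natural map $B\to\mathrm{Sym}(I)$ as augmentation. (i) If $I$ is an almost complete intersection ($n=g+1$), then $\mathrm{Sym}(I)$ has a graded free $B$-resolution $\mathfrak F_\bullet$ with $\mathfrak F_0=B$, $\mathfrak F_1=F_2\otimes_RB(-1)$, and $$\mathfrak F_i=\mathfrak T_{i-2}\oplus\big(F_{i+1}\otimes_RB(-1)\big)\qquad (i\ge2).$$ (ii) If $I$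 is a perfect ideal of deviation two ($n=g+2$ and $\mathrm{pd}_R(R/I)=\mathrm{grade}(I)$) and $F_\bullet:0\to F_g\to\cdots\to F_2\to R^n\to R\to0$ is a minimal free resolution, then $\mathrm{Sym}(I)$ has a graded free $B$-resolution $\mathfrak F_\bullet$ with $\mathfrak F_0=B$, $\mathfrak F_1=F_2\otimes_RB(-1)$, and $$\mathfrak F_i=\mathfrak T_{i-3}\oplus\big(F_{i+1}\otimes_RB(-1)\big)\oplus\big((K_{i+1}\oplus F^*_{g-i+2})\otimes_RB(-2)\big)\qquad(i\ge2),$$ where $F_j^*=\mathrm{Hom}_R(F_j,R)$ and $F_j^*=0$ for $j<0$. In both cases $\mathfrak F_\bullet$ is built from the given complexes, in the following sense. The map $\mathfrak F_1\to\mathfrak F_0$ is the composite $F_2\otimes_R B(-1)\to R^n\otimes_R B(-1)\to B$ whose second map sends the $j$-th basis vector to $y_j$. In the order $F_\bullet$, $\mathfrak T_\bullet$ of the summands in (i), respectively $F_\bullet$, $K_\bullet$, $F^*_\bullet$, $\mathfrak T_\bullet$ in (ii), the remaining differentials are block triangular: each one maps a summand into the sum of the corresponding summand and the ones preceding it. Their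 diagonal blocks are the differentials of $F_\bullet\otimes_RB$, $K_\bullet\otimes_RB$, $F_\bullet^*\otimes_RB$ and $\mathfrak T_\bullet$. -/

import Mathlib

open TensorProduct

universe u

/-! ### Cohen-Macaulay local rings, grade, perfect ideals -/

/-- The grade of an ideal: the supremum of the lengths of the `R`-regular sequences inside it. -/
noncomputable def idealGrade {R : Type u} [CommRing R] (I : Ideal R) : ℕ∞ :=
  ⨆ rs : {rs : List R // RingTheory.Sequence.IsRegular R rs ∧ ∀ r ∈ rs, r ∈ I},
    (rs.1.length : ℕ∞)

/-- A Noetherian local ring is Cohen-Macaulay if its depth equals its Krull dimension. -/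
def IsCohenMacaulayLocal (R : Type u) [CommRing R] [IsLocalRing R] : Prop :=
  IsNoetherianRing R ∧
    ((idealGrade (IsLocalRing.maximalIdeal R) : ℕ∞) : WithBot ℕ∞) = ringKrullDim R

/-- The ideal `I` is perfect: the projective dimension of `R ⧸ I` equals the grade of `I`. -/
def IsPerfectIdeal {R : Type u} [CommRing R] (I : Ideal R) : Prop :=
  CategoryTheory.projectiveDimension (ModuleCat.of R (R ⧸ I)) = ((idealGrade I : ℕ∞) : WithBot ℕ∞)

/-! ### Koszul complexes on the exterior powers of `R ^ n` -/

section Koszul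

variable {R : Type u} [CommRing R] {n : ℕ}

theorem contractLeft_mem_exteriorPower (θ : Module.Dual R (Fin n → R)) (i : ℕ)
    (x : ExteriorAlgebra R (Fin n → R)) (hx : x ∈ ⋀[R]^(i + 1) (Fin n → R)) :
    CliffordAlgebra.contractLeft θ x ∈ ⋀[R]^i (Fin n → R) := by
  induction i generalizing x with
  | zero =>
    rw [zero_add, ExteriorAlgebra.exteriorPower, pow_one] at hx
    obtain ⟨v, rfl⟩ := hx
    rw [ExteriorAlgebra.exteriorPower, pow_zero, Submodule.mem_one]
    exact ⟨θ v, (CliffordAlgebra.contractLeft_ι (0 : QuadraticForm R (Fin n → R)) θ v).symm⟩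
  | succ i ih =>
    rw [ExteriorAlgebra.exteriorPower, pow_succ'] at hx
    induction hx using Submodule.mul_induction_on' with
    | mem_mul_mem a ha b hb =>
      obtain ⟨v, rfl⟩ := ha
      have h := CliffordAlgebra.contractLeft_ι_mul (Q := (0 : QuadraticForm R (Fin n → R))) θ v b
      refine (congrArg (fun z => z ∈ ⋀[R]^(i + 1) (Fin n → R)) h).mpr ?_
      refine Submodule.sub_mem _ (Submodule.smul_mem _ _ hb) ?_
      rw [ExteriorAlgebra.exteriorPower, pow_succ']
      exact Submodule.mul_mem_mul ⟨v, rfl⟩ (ih b hb)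
    | add a _ b _ ha hb =>
      rw [map_add]
      exact Submodule.add_mem _ ha hb

/-- Contraction with a linear form `θ`, as a map `⋀ⁱ⁺¹ Rⁿ → ⋀ⁱ Rⁿ`:
`v₀ ∧ ⋯ ∧ vᵢ ↦ ∑ₖ (-1)ᵏ θ(vₖ) v₀ ∧ ⋯ (omit vₖ) ⋯ ∧ vᵢ`. -/
noncomputable def contr (θ : Module.Dual R (Fin n → R)) (i : ℕ) :
    (⋀[R]^(i + 1) (Fin n → R)) →ₗ[R] (⋀[R]^i (Fin n → R)) :=
  (CliffordAlgebra.contractLeft (Q := (0 : QuadraticForm R (Fin n → R))) θ).restrict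
    (fun x hx => contractLeft_mem_exteriorPower θ i x hx)

/-- The linear form `(v₁, …, vₙ) ↦ ∑ⱼ fⱼ vⱼ` on `Rⁿ`. -/
noncomputable def seqForm (f : Fin n → R) : Module.Dual R (Fin n → R) :=
  ∑ j, f j • LinearMap.proj j

/-- The Koszul differential `∂_f : Kᵢ₊₁ → Kᵢ` of the sequence `f₁, …, fₙ`, with `Kᵢ = ⋀ⁱ Rⁿ`. -/
noncomputable def koszulD (f : Fin n → R) (i : ℕ) :
    (⋀[R]^(i + 1) (Fin n → R)) →ₗ[R] (⋀[R]^i (Fin n → R)) :=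
  contr (seqForm f) i

/-- The module `Zᵢ` of Koszul cycles, inside `Kᵢ`; contraction kills `K₀ = R`, so `Z₀ = K₀`. -/
noncomputable def koszulZ (f : Fin n → R) (i : ℕ) : Submodule R (⋀[R]^i (Fin n → R)) :=
  LinearMap.ker ((CliffordAlgebra.contractLeft (Q := (0 : QuadraticForm R (Fin n → R)))
    (seqForm f)).domRestrict (⋀[R]^i (Fin n → R)))

theorem contr_mem_koszulZ (f : Fin n → R) (θ : Module.Dual R (Fin n → R)) (i : ℕ)
    (x : ⋀[R]^(i + 1) (Fin n → R)) (hx : x ∈ koszulZ f (i + 1)) :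
    contr θ i x ∈ koszulZ f i := by
  have h : CliffordAlgebra.contractLeft (Q := (0 : QuadraticForm R (Fin n → R)))
      (seqForm f) x.1 = 0 := hx
  change CliffordAlgebra.contractLeft (Q := (0 : QuadraticForm R (Fin n → R))) (seqForm f)
    (CliffordAlgebra.contractLeft (Q := (0 : QuadraticForm R (Fin n → R))) θ x.1) = 0
  rw [CliffordAlgebra.contractLeft_comm, h, map_zero, neg_zero]

/-- The polynomial ring `B = R[y₁, …, yₙ]`. -/
abbrev PolyB (R : Type u) [CommRing R] (n : ℕ) : Type u := MvPolynomial (Fin n) R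

/-- The differential `∂_f : B ⊗ Kᵢ₊₁ → B ⊗ Kᵢ` of the Koszul complex `K(f₁, …, fₙ; B)`. -/
noncomputable def koszulDf (f : Fin n → R) (i : ℕ) :
    (PolyB R n ⊗[R] (⋀[R]^(i + 1) (Fin n → R))) →ₗ[PolyB R n]
      (PolyB R n ⊗[R] (⋀[R]^i (Fin n → R))) :=
  (koszulD f i).baseChange (PolyB R n)

variable (R n) in
/-- The differential `∂_y : B ⊗ Kᵢ₊₁ → B ⊗ Kᵢ` of the Koszul complex `K(y₁, …, yₙ; B)`,
as the sum over `j` of `yⱼ` times the contraction with the `j`-th coordinate form. -/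
noncomputable def koszulDy (i : ℕ) :
    (PolyB R n ⊗[R] (⋀[R]^(i + 1) (Fin n → R))) →ₗ[PolyB R n]
      (PolyB R n ⊗[R] (⋀[R]^i (Fin n → R))) :=
  ∑ j, (MvPolynomial.X j : PolyB R n) • (contr (LinearMap.proj j) i).baseChange (PolyB R n)

/-- The differential `Zᵢ₊₁ ⊗ B(-i-1) → Zᵢ ⊗ B(-i)` of the approximation complex: the restriction
of `∂_y` to the Koszul cycles of `f`. -/
noncomputable def approxD (f : Fin n → R) (i : ℕ) :
    (PolyB R n ⊗[R] (koszulZ f (i + 1))) →ₗ[PolyB R n] (PolyB R n ⊗[R] (koszulZ f i)) :=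
  ∑ j, (MvPolynomial.X j : PolyB R n) •
    ((contr (LinearMap.proj j) i).restrict
      (fun x hx => contr_mem_koszulZ f (LinearMap.proj j) i x hx)).baseChange (PolyB R n)

/-- The approximation complex `Z_•` is acyclic: its homology vanishes in all positive degrees. -/
def ApproxAcyclic (f : Fin n → R) : Prop :=
  ∀ i : ℕ, Function.Exact (approxD f (i + 1)) (approxD f i)

end Koszul

/-! ### Graded modules over `B` -/

/-- A `B`-module together with a family of homogeneous pieces. Only the explicit graded modules
built below (`B`, `M ⊗ B(-a)` and finite direct sums of these) are ever used. -/
structure GrMod (R : Type u) [CommRing R] (n : ℕ) where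
  carrier : Type u
  [addCommGroup : AddCommGroup carrier]
  [module : Module (PolyB R n) carrier]
  /-- The homogeneous elements of degree `k`. -/
  deg : ℕ → AddSubgroup carrier

attribute [instance] GrMod.addCommGroup GrMod.module

namespace GrMod

variable {R : Type u} [CommRing R] {n : ℕ}

variable (R n) in
/-- The standard graded ring `B` itself. -/
noncomputable abbrev base : GrMod R n where
  carrier := PolyB R n
  deg k := (MvPolynomial.homogeneousSubmodule (Fin n) R k).toAddSubgroup

variable (n) in
/-- The graded `B`-module `M ⊗_R B(-a)`: its elements of degree `k` are the sums of elements
`p ⊗ m` with `p` a form of degree `k - a`. -/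
noncomputable abbrev twist (M : Type u) [AddCommGroup M] [Module R M] (a : ℕ) : GrMod R n where
  carrier := PolyB R n ⊗[R] M
  deg k := AddSubgroup.closure
    {x | ∃ (j : ℕ) (p : PolyB R n) (m : M), p.IsHomogeneous j ∧ j + a = k ∧ x = p ⊗ₜ[R] m}

/-- The direct sum of two graded modules. -/
noncomputable abbrev prod (X Y : GrMod R n) : GrMod R n where
  carrier := X.carrier × Y.carrier
  deg k := (X.deg k).prod (Y.deg k)

/-- The direct sum of finitely many graded modules. -/
noncomputable abbrev pi {j : ℕ} (X : Fin j → GrMod R n) : GrMod R n where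
  carrier := (p : Fin j) → (X p).carrier
  deg k := AddSubgroup.pi Set.univ (fun p => (X p).deg k)

end GrMod

/-- `δ` and the augmentation `ε` make the graded modules `X₀, X₁, …` a graded free `B`-resolution
of `M`. -/
structure IsGradedFreeResolution {R : Type u} [CommRing R] {n : ℕ} {M : Type u} [AddCommGroup M]
    [Module (PolyB R n) M] (X : ℕ → GrMod R n)
    (δ : (i : ℕ) → (X (i + 1)).carrier →ₗ[PolyB R n] (X i).carrier)
    (ε : (X 0).carrier →ₗ[PolyB R n] M) : Prop where
  free : ∀ i, Module.Free (PolyB R n) (X i).carrier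
  homogeneous : ∀ i k, ∀ x ∈ (X (i + 1)).deg k, δ i x ∈ (X i).deg k
  exact : ∀ i, Function.Exact (δ (i + 1)) (δ i)
  exact_zero : Function.Exact (δ 0) ε
  surjective : Function.Surjective ε

/-! ### The symmetric algebra as a `B`-module -/

section Sym

variable {R : Type u} [CommRing R] {n : ℕ}

/-- The symmetric algebra of the ideal `I = (f₁, …, fₙ)`. -/
abbrev SymRing (f : Fin n → R) : Type u :=
  SymmetricAlgebra R (Ideal.span (Set.range f))

/-- The natural map `B → Sym(I)`, `yⱼ ↦ fⱼ ∈ Sym₁(I) = I`. -/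
noncomputable def toSym (f : Fin n → R) : PolyB R n →ₐ[R] SymRing f :=
  MvPolynomial.aeval (fun j => SymmetricAlgebra.ι R (Ideal.span (Set.range f))
    ⟨f j, Ideal.subset_span (Set.mem_range_self j)⟩)

/-- `Sym(I)`, regarded as a `B`-module through the natural map. -/
def SymMod (f : Fin n → R) : Type u := SymRing f

noncomputable instance (f : Fin n → R) : AddCommGroup (SymMod f) :=
  inferInstanceAs (AddCommGroup (SymRing f))

noncomputable instance (f : Fin n → R) : Module (PolyB R n) (SymMod f) :=
  Module.compHom (SymRing f) (toSym f).toRingHom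

/-- The natural map `B → Sym(I)` as a map of `B`-modules. -/
noncomputable def symAug (f : Fin n → R) : PolyB R n →ₗ[PolyB R n] SymMod f where
  toFun b := toSym f b
  map_add' a b := map_add (toSym f) a b
  map_smul' a b := map_mul (toSym f) a b

end Sym

/-! ### Free resolutions of `R ⧸ I` starting with the given generators -/

/-- A free resolution `⋯ → F₂ → Rⁿ → R → 0` of `R ⧸ (f₁, …, fₙ)` whose map `Rⁿ → R` is
`(f₁, …, fₙ)`. -/
structure QuotRes {R : Type u} [CommRing R] {n : ℕ} (f : Fin n → R) where
  F : ℕ → Type u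
  [addCommGroup : ∀ i, AddCommGroup (F i)]
  [module : ∀ i, Module R (F i)]
  free : ∀ i, Module.Free R (F i)
  d : (i : ℕ) → F (i + 1) →ₗ[R] F i
  exact : ∀ i, Function.Exact (d (i + 1)) (d i)
  e₀ : F 0 ≃ₗ[R] R
  e₁ : F 1 ≃ₗ[R] (Fin n → R)
  e₀_d : ∀ x, e₀ (d 0 x) = ∑ j, e₁ x j * f j

attribute [instance] QuotRes.addCommGroup QuotRes.module

/-- Minimality over a local ring: each differential becomes zero modulo the maximal ideal. -/
def QuotRes.IsMinimal {R : Type u} [CommRing R] [IsLocalRing R] {n : ℕ} {f : Fin n → R}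
    (F : QuotRes f) : Prop :=
  (∀ i, Module.Finite R (F.F i)) ∧
    ∀ i, LinearMap.range (F.d i) ≤ IsLocalRing.maximalIdeal R • (⊤ : Submodule R (F.F i))

/-! ### The complex `T_•` -/

section Tot

variable {R : Type u} [CommRing R] {n : ℕ}

variable (R n) in
/-- The term `T_{j-1}` (so that `T_{-1} = 0` is the term for `j = 0`) of the total complex of the
double complex `D_{p,q} = ⋀^(e+2+p+q) Rⁿ ⊗ B(-(e+1+p))`, `p, q ≥ 0`, where `e = n - g` is the
deviation: the direct sum of the `⋀^(e+1+j) Rⁿ ⊗ B(-(e+1+p))` with `0 ≤ p ≤ j - 1`.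
It vanishes for `j ≥ g` because then `e + 1 + j > n`. -/
noncomputable abbrev totMod (e j : ℕ) : GrMod R n :=
  GrMod.pi (fun p : Fin j => GrMod.twist n (⋀[R]^(e + 1 + j) (Fin n → R)) (e + 1 + p))

/-- The differential `T_j → T_{j-1}` of the total complex: the component in position `(p, q)` is
`∂_f` of the component in position `(p, q+1)` plus `∂_y` of the one in position `(p+1, q)`
(`∂_f` and `∂_y` anticommute, so no further sign is needed). -/
noncomputable def totD (f : Fin n → R) (e j : ℕ) :
    (totMod R n e (j + 1)).carrier →ₗ[PolyB R n] (totMod R n e j).carrier :=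
  LinearMap.pi (fun p : Fin j =>
    koszulDf f (e + 1 + j) ∘ₗ LinearMap.proj p.castSucc +
      koszulDy R n (e + 1 + j) ∘ₗ LinearMap.proj p.succ)

end Tot

/-! ### The two families of resolutions -/

namespace QuotRes

variable {R : Type u} [CommRing R] {n : ℕ} {f : Fin n → R} (F : QuotRes f)

/-- `F_i ⊗_R B(-1)`. -/
noncomputable abbrev termF (i : ℕ) : GrMod R n := GrMod.twist n (F.F i) 1

/-- The map `F_2 ⊗ B(-1) → Rⁿ ⊗ B(-1) → B` where the `j`-th basis vector of `Rⁿ` goes to `yⱼ`. -/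
noncomputable def firstMap : (F.termF 2).carrier →ₗ[PolyB R n] PolyB R n :=
  LinearMap.liftBaseChange (PolyB R n)
    (Fintype.linearCombination R (fun j => (MvPolynomial.X j : PolyB R n)) ∘ₗ
      F.e₁.toLinearMap ∘ₗ F.d 1)

/-- `F*_{g-j}`, which is zero if `j > g` (the index set has one element or none). -/
abbrev coF (g j : ℕ) : Type u := (m : {m : ℕ // m + j = g}) → Module.Dual R (F.F m.1)

/-- The transposed differential `F*_{g-j-1} → F*_{g-j}`. -/
def coD (g j : ℕ) : F.coF g (j + 1) →ₗ[R] F.coF g j :=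
  LinearMap.pi (fun m => match m with
    | ⟨0, _⟩ => 0
    | ⟨m + 1, h⟩ => (Module.Dual.transpose (R := R) (F.d m)) ∘ₗ
        LinearMap.proj (⟨m, by omega⟩ : {m : ℕ // m + (j + 1) = g}))

/-- Almost complete intersections:
`B`, `F_2 ⊗ B(-1)`, and `T_{i-2} ⊕ F_{i+1} ⊗ B(-1)` for `i ≥ 2`. -/
noncomputable def resOne : ℕ → GrMod R n
  | 0 => GrMod.base R n
  | 1 => F.termF 2
  | i + 2 => (totMod R n 1 (i + 1)).prod (F.termF (i + 3))

/-- The inclusion of the summand `F_{i+2} ⊗ B(-1)` of the term with index `i + 1`. -/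
noncomputable def inclOne : (i : ℕ) →
    (F.termF (i + 2)).carrier →ₗ[PolyB R n] (F.resOne (i + 1)).carrier
  | 0 => LinearMap.id
  | _ + 1 => LinearMap.inr (PolyB R n) _ _

/-- The projection of the term with index `i + 2` onto its summand `T_i`. -/
noncomputable def projOne (i : ℕ) :
    (F.resOne (i + 2)).carrier →ₗ[PolyB R n] (totMod R n 1 (i + 1)).carrier :=
  LinearMap.fst (PolyB R n) (totMod R n 1 (i + 1)).carrier (F.termF (i + 3)).carrier

/-- The differentials of `F_•` and of `T_•` are the diagonal blocks of `δ`, and `F_•` (shifted and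
tensored with `B(-1)`) spans a subcomplex. -/
structure IsConeOne
    (δ : (i : ℕ) → (F.resOne (i + 1)).carrier →ₗ[PolyB R n] (F.resOne i).carrier) : Prop where
  first : ∀ x, δ 0 x = F.firstMap x
  sub : ∀ i x, δ (i + 1) (F.inclOne (i + 1) x) =
    F.inclOne i ((F.d (i + 2)).baseChange (PolyB R n) x)
  quot : ∀ i x, F.projOne i (δ (i + 2) x) = totD f 1 (i + 1) (F.projOne (i + 1) x)

/-- Perfect ideals of deviation two: `B`, `F_2 ⊗ B(-1)`, and
`T_{i-3} ⊕ F_{i+1} ⊗ B(-1) ⊕ K_{i+1} ⊗ B(-2) ⊕ F*_{g-i+2} ⊗ B(-2)` for `i ≥ 2`. -/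
noncomputable def resTwo (g : ℕ) : ℕ → GrMod R n
  | 0 => GrMod.base R n
  | 1 => F.termF 2
  | i + 2 => (totMod R n 2 i).prod ((F.termF (i + 3)).prod
      ((GrMod.twist n (⋀[R]^(i + 3) (Fin n → R)) 2).prod (GrMod.twist n (F.coF g i) 2)))

/-- The inclusion of the summand `F_{i+2} ⊗ B(-1)` of the term with index `i + 1`. -/
noncomputable def inclTwo (g : ℕ) : (i : ℕ) →
    (F.termF (i + 2)).carrier →ₗ[PolyB R n] (F.resTwo g (i + 1)).carrier
  | 0 => LinearMap.id
  | _ + 1 => LinearMap.inr (PolyB R n) _ _ ∘ₗ LinearMap.inl (PolyB R n) _ _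

/-- The inclusion of the summand `K_{i+3} ⊗ B(-2)` of the term with index `i + 2`. -/
noncomputable def inclTwoK (g i : ℕ) :
    (PolyB R n ⊗[R] (⋀[R]^(i + 3) (Fin n → R))) →ₗ[PolyB R n] (F.resTwo g (i + 2)).carrier :=
  LinearMap.inr (PolyB R n) (totMod R n 2 i).carrier _ ∘ₗ
    LinearMap.inr (PolyB R n) (F.termF (i + 3)).carrier _ ∘ₗ
    LinearMap.inl (PolyB R n) _ (PolyB R n ⊗[R] F.coF g i)

/-- The inclusion of the summand `F*_{g-i} ⊗ B(-2)` of the term with index `i + 2`. -/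
noncomputable def inclTwoDual (g i : ℕ) :
    (PolyB R n ⊗[R] F.coF g i) →ₗ[PolyB R n] (F.resTwo g (i + 2)).carrier :=
  LinearMap.inr (PolyB R n) (totMod R n 2 i).carrier _ ∘ₗ
    LinearMap.inr (PolyB R n) (F.termF (i + 3)).carrier _ ∘ₗ
    LinearMap.inr (PolyB R n) (PolyB R n ⊗[R] (⋀[R]^(i + 3) (Fin n → R))) _

/-- The projection of the term with index `i + 2` onto its summand `T_{i-1}`. -/
noncomputable def projTwo (g i : ℕ) :
    (F.resTwo g (i + 2)).carrier →ₗ[PolyB R n] (totMod R n 2 i).carrier :=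
  LinearMap.fst (PolyB R n) (totMod R n 2 i).carrier _

/-- With respect to the order `F_•`, `K_•`, `F_•^*`, `T_•` of the summands, `δ` is block triangular
and its diagonal blocks are the differentials of these complexes. -/
structure IsConeTwo (g : ℕ)
    (δ : (i : ℕ) → (F.resTwo g (i + 1)).carrier →ₗ[PolyB R n] (F.resTwo g i).carrier) :
    Prop where
  first : ∀ x, δ 0 x = F.firstMap x
  sub : ∀ i x, δ (i + 1) (F.inclTwo g (i + 1) x) =
    F.inclTwo g i ((F.d (i + 2)).baseChange (PolyB R n) x)
  subK : ∀ i x, ∃ y, δ (i + 2) (F.inclTwoK g (i + 1) x) =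
    F.inclTwo g (i + 1) y + F.inclTwoK g i (koszulDf f (i + 3) x)
  subDual : ∀ i x, ∃ y z, δ (i + 2) (F.inclTwoDual g (i + 1) x) =
    F.inclTwo g (i + 1) y + F.inclTwoK g i z +
      F.inclTwoDual g i ((F.coD g i).baseChange (PolyB R n) x)
  quot : ∀ i x, F.projTwo g i (δ (i + 2) x) = totD f 2 i (F.projTwo g (i + 1) x)

end QuotRes

/-! ### Identities between the differentials `∂_f` and `∂_y` -/

section KoszulIdentities

variable {R : Type u} [CommRing R] {n : ℕ}

/-! Since `Sym(I)` is `B` modulo the linear forms given by the syzygies of `f`, it is the cokernel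
of `∂_y : Z₁ ⊗ B(-1) → B`, and `Z₁` is resolved by `F₂ ← F₃ ← ⋯`. It therefore suffices to resolve
the cycles of `∂_y` on `Z₁ ⊗ B(-1)` by a complex `E_•` of graded free modules, to lift its
augmentation to a map `E_• → F_{•+2} ⊗ B(-1)`, and to take the cone (`QuotRes.exists_cone`).
Acyclicity of `Z_•` identifies these cycles with `∂_y(Z₂ ⊗ B)`.

In deviation one the Koszul homology vanishes in degrees at least `2`, so `Z₂ = ∂_f K₃` and the
cycles are `∂_y ∂_f (K₃ ⊗ B)`. A zigzag argument, using exactness of `∂_f` and acyclicity of `Z_•`,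
shows that `T_•`, augmented by `∂_y ∂_f`, resolves them (`totMap_exact`, `mem_range_totMap_one`).

In deviation two `Z₂` need not consist of boundaries. A comparison map `K_• → F_•` dualizes, through
`K_j* = K_{n-j}`, to a map `F*_{g-•} → K_{•+2}`, and the cone of the latter resolves `Z₂`
(`dualConeD_exact`, `dualConeD_exact_aug`, `dualConeAug_exact`). The cycles of `∂_y` on `Z₂ ⊗ B` are
`∂_y(Z₃ ⊗ B) = ∂_y ∂_f (K₄ ⊗ B)`, covered by `T_•` as before, so a cone of `T_•` into that
resolution of `Z₂ ⊗ B` serves as `E_•`.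

The grade enters through one principle, `homExactAt_of_isWeaklyRegular`: if `Hom(C, M)` is exact
below degree `s` for all `M`, and the squares of the members of a weakly `M`-regular sequence of
length `g` act on `C` null-homotopically, then `Hom(C, M)` is exact below `s + g`. With `C = K_•`
and `s = 0` it gives the vanishing of Koszul homology above `n - g`. With `C` the cone of `K_• →
F_•` and `s = 2` it gives exactness of the dual cone, with no need to identify the Koszul homology
with a canonical module. The regular sequence of length `g = ht I` inside `I` comes from the
Cohen–Macaulay property. -/

theorem contr_contr (θ : Module.Dual R (Fin n → R)) (i : ℕ) (x : ⋀[R]^(i + 2) (Fin n → R)) :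
    contr θ i (contr θ (i + 1) x) = 0 :=
  Subtype.ext (CliffordAlgebra.contractLeft_contractLeft (Q := (0 : QuadraticForm R (Fin n → R)))
    (d := θ) x.1)

theorem contr_comm (θ η : Module.Dual R (Fin n → R)) (i : ℕ) (x : ⋀[R]^(i + 2) (Fin n → R)) :
    contr θ i (contr η (i + 1) x) = - contr η i (contr θ (i + 1) x) :=
  Subtype.ext (CliffordAlgebra.contractLeft_comm (Q := (0 : QuadraticForm R (Fin n → R)))
    (d := θ) (d' := η) x.1)

theorem contr_comp_contr (θ : Module.Dual R (Fin n → R)) (i : ℕ) :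
    contr θ i ∘ₗ contr θ (i + 1) = 0 :=
  LinearMap.ext (contr_contr θ i)

theorem contr_comp_comm (θ η : Module.Dual R (Fin n → R)) (i : ℕ) :
    contr θ i ∘ₗ contr η (i + 1) = - (contr η i ∘ₗ contr θ (i + 1)) :=
  LinearMap.ext (contr_comm θ η i)

theorem koszulD_koszulD (f : Fin n → R) (i : ℕ) (x : ⋀[R]^(i + 2) (Fin n → R)) :
    koszulD f i (koszulD f (i + 1) x) = 0 :=
  contr_contr _ _ _

theorem baseChange_contr_comm (θ η : Module.Dual R (Fin n → R)) (i : ℕ)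
    (x : PolyB R n ⊗[R] (⋀[R]^(i + 2) (Fin n → R))) :
    (contr θ i).baseChange (PolyB R n) ((contr η (i + 1)).baseChange (PolyB R n) x) =
      - (contr η i).baseChange (PolyB R n) ((contr θ (i + 1)).baseChange (PolyB R n) x) := by
  rw [← LinearMap.comp_apply, ← LinearMap.comp_apply, ← LinearMap.baseChange_comp,
    ← LinearMap.baseChange_comp, contr_comp_comm, LinearMap.baseChange_neg, LinearMap.neg_apply]

theorem baseChange_contr_contr (θ : Module.Dual R (Fin n → R)) (i : ℕ)
    (x : PolyB R n ⊗[R] (⋀[R]^(i + 2) (Fin n → R))) :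
    (contr θ i).baseChange (PolyB R n) ((contr θ (i + 1)).baseChange (PolyB R n) x) = 0 := by
  rw [← LinearMap.comp_apply, ← LinearMap.baseChange_comp, contr_comp_contr,
    LinearMap.baseChange_zero, LinearMap.zero_apply]

theorem koszulDf_koszulDf (f : Fin n → R) (i : ℕ)
    (x : PolyB R n ⊗[R] (⋀[R]^(i + 2) (Fin n → R))) :
    koszulDf f i (koszulDf f (i + 1) x) = 0 :=
  baseChange_contr_contr _ _ _

theorem koszulDy_apply (i : ℕ) (x : PolyB R n ⊗[R] (⋀[R]^(i + 1) (Fin n → R))) :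
    koszulDy R n i x = ∑ j, (MvPolynomial.X j : PolyB R n) •
      (contr (LinearMap.proj j) i).baseChange (PolyB R n) x := by
  simp [koszulDy, LinearMap.sum_apply]

theorem koszulDf_koszulDy (f : Fin n → R) (i : ℕ)
    (x : PolyB R n ⊗[R] (⋀[R]^(i + 2) (Fin n → R))) :
    koszulDf f i (koszulDy R n (i + 1) x) = - koszulDy R n i (koszulDf f (i + 1) x) := by
  rw [koszulDy_apply, koszulDy_apply, map_sum, ← Finset.sum_neg_distrib]
  refine Finset.sum_congr rfl fun j _ => ?_
  rw [map_smul, koszulDf, koszulDf, koszulD, koszulD, baseChange_contr_comm]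
  exact smul_neg _ _

theorem koszulDy_koszulDy (i : ℕ) (x : PolyB R n ⊗[R] (⋀[R]^(i + 2) (Fin n → R))) :
    koszulDy R n i (koszulDy R n (i + 1) x) = 0 := by
  rw [koszulDy_apply, koszulDy_apply]
  simp only [map_sum, map_smul, Finset.smul_sum]
  rw [← Finset.sum_product']
  -- The terms for `(j, k)` and `(k, j)` cancel because contractions anticommute; a diagonal term is
  -- a contraction applied twice.
  refine Finset.sum_involution (fun p _ => p.swap) ?_ ?_ (fun _ _ => Finset.mem_univ _)
    (fun _ _ => rfl)
  · rintro ⟨j, k⟩ -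
    simp only [Prod.swap]
    rw [baseChange_contr_comm, smul_comm]
    exact (congrArg (· + _) ((congrArg _ (smul_neg _ _)).trans (smul_neg _ _))).trans
      (neg_add_cancel _)
  · rintro ⟨j, k⟩ - h hjk
    obtain rfl : k = j := congrArg Prod.fst hjk
    refine h ?_
    rw [baseChange_contr_contr]
    exact (congrArg _ (smul_zero _)).trans (smul_zero _)

/-! ### Cycles after base change -/

theorem baseChange_exact {M N P : Type*} [AddCommGroup M] [Module R M] [AddCommGroup N]
    [Module R N] [AddCommGroup P] [Module R P] {u : M →ₗ[R] N} {v : N →ₗ[R] P}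
    (h : Function.Exact u v) :
    Function.Exact (u.baseChange (PolyB R n)) (v.baseChange (PolyB R n)) :=
  Module.Flat.lTensor_exact (PolyB R n) h

/-- Flatness of `B` makes `B ⊗ Zᵢ` a submodule of `B ⊗ Kᵢ`. This compatibility allows all further
work to take place inside `B ⊗ Kᵢ`. -/
theorem approxD_subtype (f : Fin n → R) (i : ℕ) (z : PolyB R n ⊗[R] koszulZ f (i + 1)) :
    (koszulZ f i).subtype.baseChange (PolyB R n) (approxD f i z) =
      koszulDy R n i ((koszulZ f (i + 1)).subtype.baseChange (PolyB R n) z) := by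
  have h : (koszulZ f i).subtype.baseChange (PolyB R n) ∘ₗ approxD f i =
      koszulDy R n i ∘ₗ (koszulZ f (i + 1)).subtype.baseChange (PolyB R n) := by
    refine TensorProduct.AlgebraTensorModule.ext fun p x => ?_
    simp [approxD, koszulDy]
  exact LinearMap.congr_fun h z

theorem baseChange_eq_zero_iff {M N : Type*} [AddCommGroup M] [Module R M] [AddCommGroup N]
    [Module R N] {Z : Submodule R M} {d : M →ₗ[R] N} (h : ∀ x, x ∈ Z ↔ d x = 0)
    (z : PolyB R n ⊗[R] M) :
    d.baseChange (PolyB R n) z = 0 ↔ z ∈ Set.range (Z.subtype.baseChange (PolyB R n)) := by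
  refine baseChange_exact (u := Z.subtype) (fun x => ?_) z
  rw [show Set.range Z.subtype = (Z : Set M) from Subtype.range_coe]
  exact (h x).symm

theorem koszulDf_eq_zero_iff (f : Fin n → R) (i : ℕ)
    (z : PolyB R n ⊗[R] (⋀[R]^(i + 1) (Fin n → R))) :
    koszulDf f i z = 0 ↔
      z ∈ Set.range ((koszulZ f (i + 1)).subtype.baseChange (PolyB R n)) :=
  baseChange_eq_zero_iff (d := koszulD f i) 
    (fun _ => ⟨fun h => Subtype.ext h, fun h => congrArg Subtype.val h⟩) z

/-- Acyclicity of the approximation complex, in terms of cycles inside `B ⊗ Kᵢ`. -/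
theorem ApproxAcyclic.exists_cycle {f : Fin n → R} (hZ : ApproxAcyclic f) (i : ℕ)
    (z : PolyB R n ⊗[R] (⋀[R]^(i + 1) (Fin n → R))) (hf : koszulDf f i z = 0)
    (hy : koszulDy R n i z = 0) :
    ∃ w, koszulDf f (i + 1) w = 0 ∧ koszulDy R n (i + 1) w = z := by
  obtain ⟨z, rfl⟩ := (koszulDf_eq_zero_iff f i z).1 hf
  rw [← approxD_subtype] at hy
  have hinj : Function.Injective ((koszulZ f i).subtype.baseChange (PolyB R n)) :=
    Module.Flat.lTensor_preserves_injective_linearMap _ (koszulZ f i).injective_subtype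
  obtain ⟨w, rfl⟩ := (hZ i z).1 (hinj (by rw [hy, map_zero]))
  exact ⟨_, (koszulDf_eq_zero_iff f (i + 1) _).2 ⟨w, rfl⟩, (approxD_subtype f (i + 1) w).symm⟩

end KoszulIdentities

/-! ### The total complex of a double complex with equal antidiagonals -/

section TotalComplex

variable {A : Type*} [CommRing A] {N : ℕ → Type*} [∀ j, AddCommGroup (N j)]
  [∀ j, Module A (N j)] (a b : ∀ j, N (j + 1) →ₗ[A] N j)

/-- The differential `(t_p) ↦ (a t_p + b t_{p+1})` of the total complex. -/
def totMap (j : ℕ) : (Fin (j + 1) → N (j + 1)) →ₗ[A] (Fin j → N j) :=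
  LinearMap.pi fun p => a j ∘ₗ LinearMap.proj p.castSucc + b j ∘ₗ LinearMap.proj p.succ

variable {a b}

theorem totMap_apply (j : ℕ) (t : Fin (j + 1) → N (j + 1)) (p : Fin j) :
    totMap a b j t p = a j (t p.castSucc) + b j (t p.succ) := rfl

theorem totMap_totMap (haa : ∀ j x, a j (a (j + 1) x) = 0) (hbb : ∀ j x, b j (b (j + 1) x) = 0)
    (hab : ∀ j x, a j (b (j + 1) x) = - b j (a (j + 1) x)) (j : ℕ)
    (t : Fin (j + 2) → N (j + 2)) : totMap a b j (totMap a b (j + 1) t) = 0 := by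
  funext p
  simp only [totMap_apply, map_add, haa, hbb, hab, Fin.succ_castSucc, Pi.zero_apply]
  abel

/-- A zigzag from the top component downwards. Once `s (k + 1)` is known, `t k - b (s (k + 1))` is
an `a`-cycle, and `hA` supplies `s k`. Only the start needs `hS`, the abstract form of acyclicity of
the approximation complex. Families indexed by `ℕ` avoid arithmetic in `Fin`. -/
theorem exists_totMap_nat (haa : ∀ j x, a j (a (j + 1) x) = 0)
    (hbb : ∀ j x, b j (b (j + 1) x) = 0)
    (hab : ∀ j x, a j (b (j + 1) x) = - b j (a (j + 1) x))
    (hA : ∀ j z, a j z = 0 → ∃ w, a (j + 1) w = z)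
    (hS : ∀ j z, a j z = 0 → b j z = 0 → ∃ w, a (j + 1) w = 0 ∧ b (j + 1) w = z)
    (j : ℕ) (t : ℕ → N (j + 2)) (ht : ∀ p < j + 1, a (j + 1) (t p) + b (j + 1) (t (p + 1)) = 0) :
    ∃ s : ℕ → N (j + 3), ∀ p, p ≤ j + 1 → a (j + 2) (s p) + b (j + 2) (s (p + 1)) = t p := by
  suffices H : ∀ k ≤ j + 1, ∃ s : ℕ → N (j + 3),
      ∀ p, k ≤ p → p ≤ j + 1 → a (j + 2) (s p) + b (j + 2) (s (p + 1)) = t p by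
    obtain ⟨s, hs⟩ := H 0 (Nat.zero_le _)
    exact ⟨s, fun p => hs p (Nat.zero_le _)⟩
  intro k hk
  induction hk using Nat.decreasingInduction with
  | self =>
    -- Applying `a` to the last cycle condition shows that `a t_{j+1}` is killed by `b` as well as
    -- by `a`, as `hS` requires.
    have h1 : b j (a (j + 1) (t (j + 1))) = 0 := by
      have h2 := congrArg (a j) (ht j (Nat.lt_succ_self _))
      rw [map_add, haa, zero_add, map_zero, hab, neg_eq_zero] at h2
      exact h2
    obtain ⟨w, hw, hw'⟩ := hS j _ (haa j _) h1
    obtain ⟨s, rfl⟩ := hA (j + 1) w hw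
    obtain ⟨s', hs'⟩ := hA (j + 1) (t (j + 1) + b (j + 2) s) (by
      rw [map_add, hab, hw', add_neg_cancel])
    -- The two last components are `s'` and `-s`: by construction `a s' = t_{j+1} + b s`, and `b
    -- (-s)` removes the extra term.
    refine ⟨fun p => if p = j + 1 then s' else - s, fun p hp hp' => ?_⟩
    obtain rfl := le_antisymm hp' hp
    simp [hs']
  | of_succ k hk ih =>
    obtain ⟨s, hs⟩ := ih
    obtain ⟨w, hw⟩ := hA (j + 1) (t k - b (j + 2) (s (k + 1))) (by
      have h1 := ht k hk
      rw [← hs (k + 1) le_rfl hk, map_add, hbb, add_zero, ← neg_neg (b (j + 1) _), ← hab] at h1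
      rw [map_sub, sub_eq_add_neg]
      exact h1)
    refine ⟨Function.update s k w, fun p hp hp' => ?_⟩
    rcases hp.eq_or_lt with rfl | hlt
    · simp [hw]
    · rw [Function.update_of_ne hlt.ne', Function.update_of_ne (by omega)]
      exact hs p hlt hp'

theorem totMap_exact (haa : ∀ j x, a j (a (j + 1) x) = 0)
    (hbb : ∀ j x, b j (b (j + 1) x) = 0)
    (hab : ∀ j x, a j (b (j + 1) x) = - b j (a (j + 1) x))
    (hA : ∀ j z, a j z = 0 → ∃ w, a (j + 1) w = z)
    (hS : ∀ j z, a j z = 0 → b j z = 0 → ∃ w, a (j + 1) w = 0 ∧ b (j + 1) w = z) (j : ℕ) :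
    Function.Exact (totMap a b (j + 2)) (totMap a b (j + 1)) := by
  intro t
  refine ⟨fun ht => ?_, ?_⟩
  · obtain ⟨s, hs⟩ := exists_totMap_nat haa hbb hab hA hS j
      (fun p => if h : p < j + 2 then t ⟨p, h⟩ else 0) (fun p hp => by
        have h := congrFun ht ⟨p, hp⟩
        rw [totMap_apply] at h
        rw [dif_pos (by omega), dif_pos (by omega)]
        exact h)
    refine ⟨fun p => s p, funext fun p => ?_⟩
    have h := hs p (by omega)
    rw [dif_pos p.2] at h
    exact h
  · rintro ⟨s, rfl⟩
    exact totMap_totMap haa hbb hab _ s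

/-- Exactness at the end of the total complex after augmentation by `b a`: `w` plays the role of the
`a`-cycle that `hS` provides in the start of the zigzag. -/
theorem mem_range_totMap_one
    (hab : ∀ j x, a j (b (j + 1) x) = - b j (a (j + 1) x))
    (hA : ∀ j z, a j z = 0 → ∃ w, a (j + 1) w = z) (t : Fin 1 → N 1)
    (w : N 1) (hw : a 0 w = 0) (hw' : b 0 w = a 0 (t 0)) : ∃ s, totMap a b 1 s = t := by
  obtain ⟨s, rfl⟩ := hA 0 w hw
  obtain ⟨s', hs'⟩ := hA 0 (t 0 + b 1 s) (by rw [map_add, hab, hw', add_neg_cancel])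
  refine ⟨![s', - s], funext fun p => ?_⟩
  obtain rfl := Subsingleton.elim p 0
  simp [totMap_apply, hs']

end TotalComplex

/-! ### Lifting homogeneous maps -/

namespace GrMod

variable {R : Type u} [CommRing R] {n : ℕ}

/-- The pieces `X.deg k` make `X` a graded `B`-module. -/
structure IsGraded (X : GrMod R n) : Prop where
  exists_comp : ∀ k, ∃ c : X.carrier →+ X.carrier, (∀ x, c x ∈ X.deg k) ∧
    (∀ x ∈ X.deg k, c x = x) ∧ ∀ l, l ≠ k → ∀ x ∈ X.deg l, c x = 0
  smul_mem : ∀ (j k : ℕ) (p : PolyB R n) (x : X.carrier), p.IsHomogeneous j → x ∈ X.deg k →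
    p • x ∈ X.deg (j + k)
  span : ∀ x, x ∈ AddSubgroup.closure (⋃ k, (X.deg k : Set X.carrier))

/-- Maps that preserve degrees. -/
def IsHomog {X Y : GrMod R n} (φ : X.carrier →ₗ[PolyB R n] Y.carrier) : Prop :=
  ∀ k, ∀ x ∈ X.deg k, φ x ∈ Y.deg k

/-- The degree `k` component of an arbitrary preimage works, because a homogeneous map commutes with
taking components. -/
theorem IsHomog.exists_preimage {X Y : GrMod R n} {φ : X.carrier →ₗ[PolyB R n] Y.carrier}
    (hφ : IsHomog φ) (hX : X.IsGraded) (hY : Y.IsGraded) {k : ℕ} {y : Y.carrier}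
    (hy : y ∈ Y.deg k) (h : ∃ x, φ x = y) : ∃ x ∈ X.deg k, φ x = y := by
  obtain ⟨x, rfl⟩ := h
  obtain ⟨c, hc, hc1, hc2⟩ := hX.exists_comp k
  obtain ⟨d, hd, hd1, hd2⟩ := hY.exists_comp k
  refine ⟨c x, hc x, ?_⟩
  rw [← hd1 _ hy]
  clear hy
  induction hX.span x using AddSubgroup.closure_induction with
  | mem x hx =>
    obtain ⟨l, hl⟩ := Set.mem_iUnion.1 hx
    by_cases hlk : l = k
    · subst hlk
      rw [hc1 x hl, hd1 _ (hφ l x hl)]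
    · rw [hc2 l hlk x hl, hd2 l hlk _ (hφ l x hl), map_zero]
  | zero => simp
  | add x y _ _ hx hy => rw [map_add, map_add, map_add, map_add, hx, hy]
  | neg x _ hx => rw [map_neg, map_neg, map_neg, map_neg, hx]

/-- Homogeneous maps out of `X` lift along homogeneous maps. -/
def IsProjective (X : GrMod R n) : Prop :=
  ∀ (Y Z : GrMod R n), Y.IsGraded → Z.IsGraded →
    ∀ (φ : Y.carrier →ₗ[PolyB R n] Z.carrier) (ψ : X.carrier →ₗ[PolyB R n] Z.carrier),
    IsHomog φ → IsHomog ψ → (∀ x, ∃ y, φ y = ψ x) →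
    ∃ χ : X.carrier →ₗ[PolyB R n] Y.carrier, IsHomog χ ∧ ∀ x, φ (χ x) = ψ x

section Twist

variable (n) (M : Type u) [AddCommGroup M] [Module R M] (a : ℕ)

theorem isHomog_twist_iff {M : Type u} [AddCommGroup M] [Module R M] {a : ℕ} {Y : GrMod R n}
    (φ : (twist n M a).carrier →ₗ[PolyB R n] Y.carrier) :
    IsHomog φ ↔ ∀ (j : ℕ) (p : PolyB R n) (m : M), p.IsHomogeneous j →
      φ (p ⊗ₜ[R] m) ∈ Y.deg (j + a) := by
  refine ⟨fun h j p m hp => h _ _ (AddSubgroup.subset_closure ⟨j, p, m, hp, rfl, rfl⟩), ?_⟩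
  intro h k x hx
  induction hx using AddSubgroup.closure_induction with
  | mem x hx =>
    obtain ⟨j, p, m, hp, rfl, rfl⟩ := hx
    exact h j p m hp
  | zero => rw [map_zero]; exact zero_mem _
  | add x y _ _ hx hy => rw [map_add]; exact add_mem hx hy
  | neg x _ hx => rw [map_neg]; exact neg_mem hx

theorem isGraded_twist : (twist (R := R) n M a).IsGraded where
  exists_comp k := by
    -- The piece of degree `k` consists of forms of degree `k - a`. For `k < a` it is zero, a case
    -- to be separated since natural subtraction truncates.
    by_cases hk : a ≤ k
    · refine ⟨((MvPolynomial.homogeneousComponent (σ := Fin n) (R := R) (k - a)).rTensor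
        M).toAddMonoidHom, ?_, ?_, ?_⟩
      · intro x
        induction x using TensorProduct.induction_on with
        | zero => rw [map_zero]; exact zero_mem _
        | tmul p m =>
          exact AddSubgroup.subset_closure
            ⟨_, _, m, MvPolynomial.homogeneousComponent_isHomogeneous (k - a) p, by omega, rfl⟩
        | add x y hx hy => rw [map_add]; exact add_mem hx hy
      · intro x hx
        induction hx using AddSubgroup.closure_induction with
        | mem x hx =>
          obtain ⟨j, p, m, hp, rfl, rfl⟩ := hx
          simp [MvPolynomial.homogeneousComponent_eq_self hp]
        | zero => rw [map_zero]
        | add x y _ _ hx hy => rw [map_add, hx, hy]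
        | neg x _ hx => rw [map_neg, hx]
      · intro l hl x hx
        induction hx using AddSubgroup.closure_induction with
        | mem x hx =>
          obtain ⟨j, p, m, hp, rfl, rfl⟩ := hx
          have hj : k - a ≠ j := by omega
          simp [MvPolynomial.homogeneousComponent_of_mem hp, hj]
        | zero => rw [map_zero]
        | add x y _ _ hx hy => rw [map_add, hx, hy, add_zero]
        | neg x _ hx => rw [map_neg, hx, neg_zero]
    · refine ⟨0, fun x => zero_mem _, fun x hx => ?_, fun l hl x hx => rfl⟩
      induction hx using AddSubgroup.closure_induction with
      | mem x hx =>
        obtain ⟨j, p, m, hp, h, rfl⟩ := hx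
        omega
      | zero => rfl
      | add x y _ _ hx hy => rw [map_add, hx, hy]
      | neg x _ hx => rw [map_neg, hx]
  smul_mem j k p x hp hx := by
    induction hx using AddSubgroup.closure_induction with
    | mem x hx =>
      obtain ⟨i, q, m, hq, rfl, rfl⟩ := hx
      exact AddSubgroup.subset_closure ⟨j + i, p * q, m, hp.mul hq, by omega, rfl⟩
    | zero => rw [smul_zero]; exact zero_mem _
    | add x y _ _ hx hy => rw [smul_add]; exact add_mem hx hy
    | neg x _ hx => rw [smul_neg]; exact neg_mem hx
  span x := by
    induction x using TensorProduct.induction_on with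
    | zero => exact zero_mem _
    | tmul p m =>
      rw [← MvPolynomial.sum_homogeneousComponent p, TensorProduct.sum_tmul]
      refine sum_mem fun i _ => AddSubgroup.subset_closure (Set.mem_iUnion.2 ⟨i + a, ?_⟩)
      exact AddSubgroup.subset_closure
        ⟨i, _, m, MvPolynomial.homogeneousComponent_isHomogeneous i p, rfl, rfl⟩
    | add x y hx hy => exact add_mem hx hy

/-- The basis elements `1 ⊗ v i` have degree `a`, so their images have preimages of degree `a`;
sending the basis there gives a homogeneous lift. -/
theorem isProjective_twist [Module.Free R M] : (twist (R := R) n M a).IsProjective := by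
  intro Y Z hY hZ φ ψ hφ hψ h
  let v := Module.Free.chooseBasis R M
  let w := Algebra.TensorProduct.basis (PolyB R n) v
  have h1 : ∀ i, ∃ y ∈ Y.deg a, φ y = ψ (w i) := fun i => by
    refine hφ.exists_preimage hY hZ ?_ (h _)
    have h2 := (isHomog_twist_iff n ψ).1 hψ 0 1 (v i) (MvPolynomial.isHomogeneous_one _ _)
    rw [zero_add] at h2
    simpa [w] using h2
  choose y hy hy' using h1
  refine ⟨w.constr (PolyB R n) y, ?_, fun x => ?_⟩
  · refine (isHomog_twist_iff n _).2 fun j p m hp => ?_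
    have hm : p ⊗ₜ[R] m = (v.repr m).sum fun i r => (p * MvPolynomial.C r) • w i := by
      conv_lhs => rw [← v.linearCombination_repr m, Finsupp.linearCombination_apply]
      rw [Finsupp.sum, Finsupp.sum, TensorProduct.tmul_sum]
      refine Finset.sum_congr rfl fun i _ => ?_
      rw [Algebra.TensorProduct.basis_apply, TensorProduct.smul_tmul', smul_eq_mul, mul_one,
        TensorProduct.tmul_smul, TensorProduct.smul_tmul', MvPolynomial.smul_eq_C_mul, mul_comm]
    rw [hm, Finsupp.sum, map_sum]
    refine sum_mem fun i _ => ?_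
    rw [map_smul, Module.Basis.constr_basis]
    have := hp.mul (MvPolynomial.isHomogeneous_C (Fin n) (v.repr m i))
    rw [add_zero] at this
    exact hY.smul_mem j a _ _ this (hy i)
  · have : φ ∘ₗ w.constr (PolyB R n) y = ψ := w.ext fun i => by simp [hy']
    exact LinearMap.congr_fun this x

end Twist

section Prod

variable {X Y : GrMod R n}

theorem IsGraded.prod (hX : X.IsGraded) (hY : Y.IsGraded) : (X.prod Y).IsGraded where
  exists_comp k := by
    obtain ⟨c, hc, hc1, hc2⟩ := hX.exists_comp k
    obtain ⟨d, hd, hd1, hd2⟩ := hY.exists_comp k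
    exact ⟨c.prodMap d, fun x => ⟨hc _, hd _⟩,
      fun x hx => Prod.ext (hc1 _ hx.1) (hd1 _ hx.2),
      fun l hl x hx => Prod.ext (hc2 l hl _ hx.1) (hd2 l hl _ hx.2)⟩
  smul_mem j k p x hp hx := ⟨hX.smul_mem j k p _ hp hx.1, hY.smul_mem j k p _ hp hx.2⟩
  span := by
    rintro ⟨x, y⟩
    have h1 : AddSubgroup.map (AddMonoidHom.inl X.carrier Y.carrier)
        (AddSubgroup.closure (⋃ k, (X.deg k : Set X.carrier))) ≤
        AddSubgroup.closure (⋃ k, ((X.prod Y).deg k : Set (X.carrier × Y.carrier))) := by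
      rw [AddMonoidHom.map_closure, AddSubgroup.closure_le]
      rintro _ ⟨x, hx, rfl⟩
      obtain ⟨l, hl⟩ := Set.mem_iUnion.1 hx
      exact AddSubgroup.subset_closure (Set.mem_iUnion.2 ⟨l, hl, zero_mem _⟩)
    have h2 : AddSubgroup.map (AddMonoidHom.inr X.carrier Y.carrier)
        (AddSubgroup.closure (⋃ k, (Y.deg k : Set Y.carrier))) ≤
        AddSubgroup.closure (⋃ k, ((X.prod Y).deg k : Set (X.carrier × Y.carrier))) := by
      rw [AddMonoidHom.map_closure, AddSubgroup.closure_le]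
      rintro _ ⟨x, hx, rfl⟩
      obtain ⟨l, hl⟩ := Set.mem_iUnion.1 hx
      exact AddSubgroup.subset_closure (Set.mem_iUnion.2 ⟨l, zero_mem _, hl⟩)
    have h3 := add_mem (h1 ⟨x, hX.span x, rfl⟩) (h2 ⟨y, hY.span y, rfl⟩)
    simpa using h3

theorem isHomog_inl : IsHomog (X := X) (Y := X.prod Y) (LinearMap.inl _ X.carrier Y.carrier) :=
  fun _ _ hx => ⟨hx, zero_mem _⟩

theorem isHomog_inr : IsHomog (X := Y) (Y := X.prod Y) (LinearMap.inr _ X.carrier Y.carrier) :=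
  fun _ _ hx => ⟨zero_mem _, hx⟩

theorem IsHomog.coprod {Z : GrMod R n} {φ : X.carrier →ₗ[PolyB R n] Z.carrier}
    {ψ : Y.carrier →ₗ[PolyB R n] Z.carrier} (hφ : IsHomog φ) (hψ : IsHomog ψ) :
    IsHomog (X := X.prod Y) (φ.coprod ψ) :=
  fun k x hx => add_mem (hφ k x.1 hx.1) (hψ k x.2 hx.2)

theorem IsHomog.comp {X Y Z : GrMod R n} {φ : Y.carrier →ₗ[PolyB R n] Z.carrier}
    {ψ : X.carrier →ₗ[PolyB R n] Y.carrier} (hφ : IsHomog φ) (hψ : IsHomog ψ) :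
    IsHomog (φ ∘ₗ ψ) :=
  fun k x hx => hφ k _ (hψ k x hx)

theorem IsHomog.neg {φ : X.carrier →ₗ[PolyB R n] Y.carrier} (hφ : IsHomog φ) : IsHomog (-φ) :=
  fun k x hx => neg_mem (hφ k x hx)

theorem IsProjective.prod (hX : X.IsProjective) (hY : Y.IsProjective) :
    (X.prod Y).IsProjective := by
  intro V W hV hW φ ψ hφ hψ h
  obtain ⟨χ, hχ, hχ'⟩ := hX V W hV hW φ (ψ ∘ₗ LinearMap.inl _ _ _) hφ
    (IsHomog.comp (Y := X.prod Y) hψ isHomog_inl) (fun x => h _)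
  obtain ⟨ξ, hξ, hξ'⟩ := hY V W hV hW φ (ψ ∘ₗ LinearMap.inr _ _ _) hφ
    (IsHomog.comp (Y := X.prod Y) hψ isHomog_inr) (fun x => h _)
  refine ⟨χ.coprod ξ, hχ.coprod hξ, fun x => ?_⟩
  rw [LinearMap.coprod_apply, map_add, hχ', hξ', LinearMap.comp_apply, LinearMap.comp_apply,
    ← map_add]
  simp

end Prod

section Pi

variable {j : ℕ} {X : Fin j → GrMod R n}

theorem isHomog_single (p : Fin j) : IsHomog (X := X p) (Y := pi X)
    (LinearMap.single _ (fun p => (X p).carrier) p) := by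
  intro k x hx q _
  by_cases h : q = p
  · subst h
    simpa using hx
  · simp [h]

theorem IsProjective.pi (hX : ∀ p, (X p).IsProjective) : (pi X).IsProjective := by
  intro V W hV hW φ ψ hφ hψ h
  have h1 : ∀ p, ∃ χ : (X p).carrier →ₗ[PolyB R n] V.carrier, IsHomog χ ∧
      ∀ x, φ (χ x) = ψ (Pi.single p x) := fun p =>
    hX p V W hV hW φ (ψ ∘ₗ LinearMap.single _ (fun p => (X p).carrier) p) hφ
      (IsHomog.comp (Y := GrMod.pi X) hψ (isHomog_single p)) (fun x => h _)
  choose χ hχ hχ' using h1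
  refine ⟨LinearMap.lsum (PolyB R n) (fun p => (X p).carrier) (PolyB R n) χ, ?_, ?_⟩
  · intro k x hx
    rw [LinearMap.lsum_apply, LinearMap.sum_apply]
    exact sum_mem fun p _ => hχ p k _ (hx p trivial)
  · intro x
    rw [LinearMap.lsum_apply, LinearMap.sum_apply, map_sum]
    conv_rhs => rw [← Finset.univ_sum_single x, map_sum]
    exact Finset.sum_congr rfl fun p _ => hχ' p _

end Pi

end GrMod

/-! ### Cones -/

section Cone

variable {A : Type*} [CommRing A] {E Y : ℕ → Type*} [∀ i, AddCommGroup (E i)]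
  [∀ i, Module A (E i)] [∀ i, AddCommGroup (Y i)] [∀ i, Module A (Y i)]
  (dE : ∀ i, E (i + 1) →ₗ[A] E i) (dY : ∀ i, Y (i + 1) →ₗ[A] Y i) (c : ∀ i, E i →ₗ[A] Y i)

/-- The differential `(e, y) ↦ (dE e, dY y + c e)` of the cone of a map `c` that anticommutes with
the differentials. -/
def coneMap (i : ℕ) : E (i + 1) × Y (i + 2) →ₗ[A] E i × Y (i + 1) :=
  (dE i ∘ₗ LinearMap.fst A _ _).prod ((c (i + 1)).coprod (dY (i + 1)))

variable {dE dY c}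

theorem coneMap_apply (i : ℕ) (x : E (i + 1) × Y (i + 2)) :
    coneMap dE dY c i x = (dE i x.1, c (i + 1) x.1 + dY (i + 1) x.2) := rfl

/-- A chase: the `E`-component is a boundary `dE e`; after subtraction of `c e` the `Y`-component
becomes a cycle, hence a boundary. The opposite signs in `hc` make the square of the differential
vanish. -/
theorem coneMap_exact (hc : ∀ i x, dY i (c (i + 1) x) = - c i (dE i x))
    (hE : ∀ i, Function.Exact (dE (i + 1)) (dE i)) (hY : ∀ i, Function.Exact (dY (i + 1)) (dY i))
    (i : ℕ) : Function.Exact (coneMap dE dY c (i + 1)) (coneMap dE dY c i) := by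
  rintro ⟨e, y⟩
  rw [coneMap_apply, Prod.mk_eq_zero]
  constructor
  · rintro ⟨he, hy⟩
    obtain ⟨e, rfl⟩ := (hE i e).1 he
    obtain ⟨y', hy'⟩ := (hY (i + 1) (y - c (i + 2) e)).1 (by
      rw [map_sub, hc, sub_neg_eq_add]
      exact (add_comm _ _).trans hy)
    exact ⟨(e, y'), by rw [coneMap_apply, hy', add_sub_cancel]⟩
  · rintro ⟨⟨e', y'⟩, h⟩
    rw [coneMap_apply, Prod.mk.injEq] at h
    obtain ⟨rfl, rfl⟩ := h
    refine ⟨(hE i).apply_apply_eq_zero _, ?_⟩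
    rw [map_add, hc, (hY (i + 1)).apply_apply_eq_zero, add_zero, add_neg_cancel]

/-- Here `h0` takes the place of exactness at `E 0`: it is the exactness there of the augmented
complex `E → coker (dY 0)`. -/
theorem coneMap_exact_one (hc : ∀ i x, dY i (c (i + 1) x) = - c i (dE i x))
    (hY : ∀ i, Function.Exact (dY (i + 1)) (dY i))
    (h0 : ∀ e y, c 0 e = dY 0 y → ∃ e', dE 0 e' = e) :
    Function.Exact (coneMap dE dY c 0) ((c 0).coprod (dY 0)) := by
  rintro ⟨e, y⟩
  rw [LinearMap.coprod_apply]
  constructor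
  · intro h
    obtain ⟨e, rfl⟩ := h0 e (-y) (by rw [map_neg, ← add_eq_zero_iff_eq_neg]; exact h)
    obtain ⟨y', hy'⟩ := (hY 0 (y - c 1 e)).1 (by
      rw [map_sub, hc, sub_neg_eq_add]
      exact (add_comm _ _).trans h)
    exact ⟨(e, y'), by rw [coneMap_apply, hy', add_sub_cancel]⟩
  · rintro ⟨⟨e', y'⟩, h⟩
    rw [coneMap_apply, Prod.mk.injEq] at h
    obtain ⟨rfl, rfl⟩ := h
    rw [map_add, hc, (hY 0).apply_apply_eq_zero, add_zero, add_neg_cancel]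

end Cone

/-- Dependent choice. It drives every construction degree by degree below, with `α` a subtype
carrying the invariant that makes the next step possible. -/
theorem exists_seq_of_forall_exists {α : ℕ → Type*} (r : ∀ i, α i → α (i + 1) → Prop) (a : α 0)
    (h : ∀ i x, ∃ y, r i x y) : ∃ s : ∀ i, α i, s 0 = a ∧ ∀ i, r i (s i) (s (i + 1)) := by
  choose g hg using h
  exact ⟨fun i => Nat.rec a (fun i x => g i x) i, rfl, fun i => hg i _⟩

namespace GrMod

variable {R : Type u} [CommRing R] {n : ℕ}

/-- A homogeneous map in degree `0` extends to a map between complexes that anticommutes with the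
differentials. -/
theorem exists_anticomm {E Y : ℕ → GrMod R n}
    {dE : ∀ i, (E (i + 1)).carrier →ₗ[PolyB R n] (E i).carrier}
    {dY : ∀ i, (Y (i + 1)).carrier →ₗ[PolyB R n] (Y i).carrier}
    (hdE : ∀ i, IsHomog (dE i)) (hdY : ∀ i, IsHomog (dY i)) (hE : ∀ i, (E i).IsProjective)
    (hY : ∀ i, (Y i).IsGraded) (hdd : ∀ i x, dE i (dE (i + 1) x) = 0)
    (hex : ∀ i, Function.Exact (dY (i + 1)) (dY i))
    (c₀ : (E 0).carrier →ₗ[PolyB R n] (Y 0).carrier) (hc₀ : IsHomog c₀)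
    (h₀ : ∀ x, ∃ y, dY 0 y = c₀ (dE 0 x)) :
    ∃ c : ∀ i, (E i).carrier →ₗ[PolyB R n] (Y i).carrier, c 0 = c₀ ∧ (∀ i, IsHomog (c i)) ∧
      ∀ i x, dY i (c (i + 1) x) = - c i (dE i x) := by
  -- The invariant carried along is that `c ∘ dE` lands in the image of `dY`, which is what the next
  -- lift needs.
  obtain ⟨s, hs0, hs⟩ := exists_seq_of_forall_exists
    (α := fun i => {c : (E i).carrier →ₗ[PolyB R n] (Y i).carrier //
      IsHomog c ∧ ∀ x, ∃ y, dY i y = c (dE i x)})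
    (fun i c c' => ∀ x, dY i (c'.1 x) = - c.1 (dE i x)) ⟨c₀, hc₀, h₀⟩ (by
      rintro i ⟨c, hc, h⟩
      obtain ⟨c', hc', h'⟩ := hE (i + 1) (Y (i + 1)) (Y i) (hY _) (hY _) (dY i)
        (-(c ∘ₗ dE i)) (hdY i) (hc.comp (hdE i)).neg (fun x => by
          obtain ⟨y, hy⟩ := h x
          exact ⟨-y, by rw [map_neg, hy]; rfl⟩)
      refine ⟨⟨c', hc', fun x => (hex i _).1 ?_⟩, h'⟩
      rw [h', LinearMap.neg_apply, LinearMap.comp_apply, hdd, map_zero, neg_zero])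
  exact ⟨fun i => (s i).1, congrArg Subtype.val hs0, fun i => (s i).2.1, hs⟩

theorem isHomog_baseChange {M N : Type u} [AddCommGroup M] [Module R M] [AddCommGroup N]
    [Module R N] (L : M →ₗ[R] N) (a : ℕ) :
    IsHomog (X := twist n M a) (Y := twist n N a) (L.baseChange (PolyB R n)) := by
  refine (isHomog_twist_iff n _).2 fun j p m hp => ?_
  rw [LinearMap.baseChange_tmul]
  exact AddSubgroup.subset_closure ⟨j, p, _, hp, rfl, rfl⟩

theorem isHomog_koszulDf (f : Fin n → R) (i a : ℕ) :
    IsHomog (X := twist n (⋀[R]^(i + 1) (Fin n → R)) a) (Y := twist n (⋀[R]^i (Fin n → R)) a)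
      (koszulDf f i) :=
  isHomog_baseChange _ _

theorem isHomog_koszulDy (i a : ℕ) :
    IsHomog (X := twist n (⋀[R]^(i + 1) (Fin n → R)) (a + 1))
      (Y := twist n (⋀[R]^i (Fin n → R)) a) (koszulDy R n i) := by
  refine (isHomog_twist_iff n _).2 fun j p m hp => ?_
  rw [koszulDy_apply]
  refine sum_mem fun k _ => ?_
  rw [LinearMap.baseChange_tmul]
  exact AddSubgroup.subset_closure ⟨1 + j, MvPolynomial.X k * p, _,
    (MvPolynomial.isHomogeneous_X R k).mul hp, by omega, rfl⟩

theorem isHomog_totD (f : Fin n → R) (e j : ℕ) :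
    IsHomog (X := totMod R n e (j + 1)) (Y := totMod R n e j) (totD f e j) :=
  fun k _ ht p _ => add_mem (isHomog_koszulDf f _ _ k _ (ht p.castSucc trivial))
    (isHomog_koszulDy _ _ k _ (ht p.succ trivial))

theorem isProjective_totMod (e j : ℕ) : (totMod R n e j).IsProjective :=
  IsProjective.pi fun _ => isProjective_twist _ _ _

end GrMod

/-! ### Exactness of `T_•` -/

section TotD

variable {R : Type u} [CommRing R] {n : ℕ}

theorem totD_totD (f : Fin n → R) (e j : ℕ) (t : (totMod R n e (j + 2)).carrier) :
    totD f e j (totD f e (j + 1) t) = 0 :=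
  totMap_totMap (A := PolyB R n) (N := fun j => PolyB R n ⊗[R] (⋀[R]^(e + 1 + j) (Fin n → R)))
    (fun _ => koszulDf_koszulDf f _) (fun _ => koszulDy_koszulDy _)
    (fun _ => koszulDf_koszulDy f _) j t

theorem koszulDf_exact {f : Fin n → R} {i : ℕ}
    (h : Function.Exact (koszulD f (i + 1)) (koszulD f i)) :
    Function.Exact (koszulDf f (i + 1)) (koszulDf f i) :=
  baseChange_exact h

theorem totD_exact {f : Fin n → R} (hZ : ApproxAcyclic f) {e : ℕ}
    (hK : ∀ i, e ≤ i → Function.Exact (koszulD f (i + 1)) (koszulD f i)) (j : ℕ) :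
    Function.Exact (totD f e (j + 2)) (totD f e (j + 1)) :=
  totMap_exact (A := PolyB R n) (N := fun j => PolyB R n ⊗[R] (⋀[R]^(e + 1 + j) (Fin n → R)))
    (fun _ => koszulDf_koszulDf f _) (fun _ => koszulDy_koszulDy _)
    (fun _ => koszulDf_koszulDy f _)
    (fun j z => (koszulDf_exact (hK (e + 1 + j) (by omega)) z).1)
    (fun _ z => hZ.exists_cycle _ z) j

theorem mem_range_totD_one {f : Fin n → R} {e : ℕ}
    (hK : ∀ i, e ≤ i → Function.Exact (koszulD f (i + 1)) (koszulD f i))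
    (t : (totMod R n e 1).carrier) (w : PolyB R n ⊗[R] (⋀[R]^(e + 2) (Fin n → R)))
    (hw : koszulDf f (e + 1) w = 0) (hw' : koszulDy R n (e + 1) w = koszulDf f (e + 1) (t 0)) :
    ∃ s, totD f e 1 s = t :=
  mem_range_totMap_one (A := PolyB R n)
    (N := fun j => PolyB R n ⊗[R] (⋀[R]^(e + 1 + j) (Fin n → R)))
    (a := fun j => koszulDf f (e + 1 + j)) (b := fun j => koszulDy R n (e + 1 + j))
    (fun _ => koszulDf_koszulDy f _)
    (fun j z => (koszulDf_exact (hK (e + 1 + j) (by omega)) z).1) t w hw hw'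

end TotD

/-! ### Degrees zero and one: `F₁ = K₁`, and `F₂` covers `Z₁` -/

section LowDegrees

variable {R : Type u} [CommRing R] {n : ℕ}

theorem zeroEquiv_contr_oneEquiv_symm (θ : Module.Dual R (Fin n → R)) (v : Fin n → R) :
    exteriorPower.zeroEquiv R (Fin n → R)
      (contr θ 0 ((exteriorPower.oneEquiv R (Fin n → R)).symm v)) = θ v := by
  rw [← LinearEquiv.eq_symm_apply]
  refine Subtype.ext ?_
  have h1 : ((exteriorPower.oneEquiv R (Fin n → R)).symm v : ExteriorAlgebra R (Fin n → R)) =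
      ExteriorAlgebra.ι R v := by
    rw [exteriorPower.oneEquiv_symm_apply, exteriorPower.ιMulti_apply_coe,
      ExteriorAlgebra.ιMulti_apply]
    simp
  have h2 : ((exteriorPower.zeroEquiv R (Fin n → R)).symm (θ v) :
      ExteriorAlgebra R (Fin n → R)) = algebraMap R _ (θ v) := by
    rw [exteriorPower.zeroEquiv_symm_apply, Submodule.coe_smul, exteriorPower.ιMulti_apply_coe,
      ExteriorAlgebra.ιMulti_apply, Algebra.algebraMap_eq_smul_one]
    simp
  rw [h2]
  change CliffordAlgebra.contractLeft θ
    ((exteriorPower.oneEquiv R (Fin n → R)).symm v : ExteriorAlgebra R (Fin n → R)) = _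
  rw [h1]
  exact CliffordAlgebra.contractLeft_ι (0 : QuadraticForm R (Fin n → R)) θ v

theorem seqForm_apply (f : Fin n → R) (v : Fin n → R) : seqForm f v = ∑ j, v j * f j := by
  simp [seqForm, mul_comm]

namespace QuotRes

variable {f : Fin n → R} (F : QuotRes f)

/-- The identification of `F₁` with `K₁`. -/
noncomputable def toK : F.F 1 ≃ₗ[R] ⋀[R]^1 (Fin n → R) :=
  F.e₁ ≪≫ₗ (exteriorPower.oneEquiv R (Fin n → R)).symm

theorem zeroEquiv_contr_toK (θ : Module.Dual R (Fin n → R)) (x : F.F 1) :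
    exteriorPower.zeroEquiv R (Fin n → R) (contr θ 0 (F.toK x)) = θ (F.e₁ x) :=
  zeroEquiv_contr_oneEquiv_symm θ _

theorem zeroEquiv_koszulD_toK (x : F.F 1) :
    exteriorPower.zeroEquiv R (Fin n → R) (koszulD f 0 (F.toK x)) = F.e₀ (F.d 0 x) := by
  rw [koszulD, zeroEquiv_contr_toK, F.e₀_d, seqForm_apply]

/-- The map `F₂ → F₁ = K₁`, whose image consists of the cycles. -/
noncomputable def toCycles : F.F 2 →ₗ[R] ⋀[R]^1 (Fin n → R) :=
  F.toK.toLinearMap ∘ₗ F.d 1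

theorem exact_toCycles : Function.Exact F.toCycles (koszulD f 0) := by
  intro y
  obtain ⟨x, rfl⟩ := F.toK.surjective y
  rw [← (exteriorPower.zeroEquiv R (Fin n → R)).map_eq_zero_iff, zeroEquiv_koszulD_toK,
    LinearEquiv.map_eq_zero_iff, F.exact 0 x]
  exact ⟨fun ⟨w, h⟩ => ⟨w, congrArg F.toK h⟩, fun ⟨w, h⟩ => ⟨w, F.toK.injective h⟩⟩

theorem exact_d_toCycles : Function.Exact (F.d 2) F.toCycles := by
  intro x
  rw [← F.exact 1 x]
  exact F.toK.map_eq_zero_iff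

/-- The map `F₂ ⊗ B → K₁ ⊗ B`. -/
noncomputable def toCyclesB :
    (F.termF 2).carrier →ₗ[PolyB R n] PolyB R n ⊗[R] (⋀[R]^1 (Fin n → R)) :=
  F.toCycles.baseChange (PolyB R n)

/-- Up to `K₀ = R`, the first map of the resolution is `∂_y` after `F₂ ⊗ B → Z₁ ⊗ B`. Its kernel is
thus governed by the cycles of `∂_y` on `Z₁ ⊗ B`. -/
theorem firstMap_eq (y : (F.termF 2).carrier) :
    F.firstMap y = TensorProduct.rid R (PolyB R n)
      ((exteriorPower.zeroEquiv R (Fin n → R)).toLinearMap.lTensor (PolyB R n)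
        (koszulDy R n 0 (F.toCyclesB y))) := by
  induction y using TensorProduct.induction_on with
  | zero => simp
  | tmul p x =>
    rw [toCyclesB, LinearMap.baseChange_tmul, koszulDy_apply, map_sum, map_sum, firstMap,
      LinearMap.liftBaseChange_tmul, LinearMap.comp_apply, LinearMap.comp_apply,
      Fintype.linearCombination_apply, Finset.smul_sum]
    refine Finset.sum_congr rfl fun j _ => ?_
    rw [LinearMap.baseChange_tmul, TensorProduct.smul_tmul', LinearMap.lTensor_tmul,
      TensorProduct.rid_tmul]
    erw [zeroEquiv_contr_toK]
    simp [mul_comm]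
  | add x y hx hy => simp only [map_add, hx, hy]

theorem firstMap_eq_zero_iff (y : (F.termF 2).carrier) :
    F.firstMap y = 0 ↔ koszulDy R n 0 (F.toCyclesB y) = 0 := by
  rw [firstMap_eq, LinearEquiv.map_eq_zero_iff]
  refine ((LinearEquiv.lTensor (PolyB R n)
    (exteriorPower.zeroEquiv R (Fin n → R))).map_eq_zero_iff)

end QuotRes

end LowDegrees

/-! ### Presentation of `Sym(I)` by the linear forms of the syzygies -/

section SymPresentation

variable {R : Type u} [CommRing R] {n : ℕ}

theorem symAug_surjective (f : Fin n → R) : Function.Surjective (symAug f) := by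
  change Function.Surjective (toSym f)
  intro y
  induction y using SymmetricAlgebra.induction with
  | algebraMap r => exact ⟨algebraMap R _ r, AlgHom.commutes _ r⟩
  | mul a b ha hb =>
    obtain ⟨⟨a, rfl⟩, b, rfl⟩ := ha, hb
    exact ⟨a * b, map_mul _ _ _⟩
  | add a b ha hb =>
    obtain ⟨⟨a, rfl⟩, b, rfl⟩ := ha, hb
    exact ⟨a + b, map_add _ _ _⟩
  | ι x =>
    obtain ⟨x, hx⟩ := x
    obtain ⟨v, rfl⟩ := (Submodule.mem_span_range_iff_exists_fun R).1 hx
    refine ⟨∑ j, v j • MvPolynomial.X j, ?_⟩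
    rw [map_sum, show (⟨∑ j, v j • f j, hx⟩ : Ideal.span (Set.range f)) =
      ∑ j, v j • ⟨f j, Ideal.subset_span (Set.mem_range_self j)⟩ from Subtype.ext (by simp), map_sum]
    refine Finset.sum_congr rfl fun j _ => ?_
    rw [map_smul, map_smul, toSym, MvPolynomial.aeval_X]

namespace QuotRes

variable {f : Fin n → R} (F : QuotRes f)

theorem firstMap_tmul (p : PolyB R n) (x : F.F 2) :
    F.firstMap (p ⊗ₜ[R] x) =
      p * Fintype.linearCombination R (fun j => (MvPolynomial.X j : PolyB R n))
        (F.e₁ (F.d 1 x)) := by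
  rw [firstMap, LinearMap.liftBaseChange_tmul, smul_eq_mul]
  rfl

/-- Let `J` be the image of `F.firstMap`. The map `Rⁿ → B ⧸ J`, `e_j ↦ y_j`, kills the syzygies, so
it factors through `I` and extends to an algebra map `Sym(I) → B ⧸ J`. Composed with `B → Sym(I)`
this is the quotient map, so the kernel lies in `J`. -/
theorem exact_firstMap_symAug : Function.Exact F.firstMap (symAug f) := by
  have hker : ∀ v : Fin n → R, ∑ j, v j * f j = 0 ↔ ∃ x, F.e₁ (F.d 1 x) = v := by
    intro v
    obtain ⟨w, rfl⟩ := F.e₁.surjective v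
    rw [← F.e₀_d, LinearEquiv.map_eq_zero_iff, F.exact 0 w]
    exact ⟨fun ⟨x, h⟩ => ⟨x, congrArg _ h⟩, fun ⟨x, h⟩ => ⟨x, F.e₁.injective h⟩⟩
  set l := Fintype.linearCombination R (fun j => (MvPolynomial.X j : PolyB R n)) with hl
  have hsym : ∀ v : Fin n → R, toSym f (l v) = SymmetricAlgebra.ι R (Ideal.span (Set.range f))
      (∑ j, v j • ⟨f j, Ideal.subset_span (Set.mem_range_self j)⟩) := by
    intro v
    rw [hl, Fintype.linearCombination_apply, map_sum, map_sum]
    refine Finset.sum_congr rfl fun j _ => ?_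
    rw [map_smul, map_smul, toSym, MvPolynomial.aeval_X]
  intro b
  constructor
  · intro hb
    let J : Ideal (PolyB R n) := LinearMap.range F.firstMap
    let q : (Fin n → R) →ₗ[R] Ideal.span (Set.range f) := Fintype.linearCombination R
      (fun j => (⟨f j, Ideal.subset_span (Set.mem_range_self j)⟩ : Ideal.span (Set.range f)))
    have hqv : ∀ v, (q v : R) = ∑ j, v j * f j := fun v => by
      simp [q, Fintype.linearCombination_apply]
    have hq : Function.Surjective q := by
      rintro ⟨x, hx⟩
      obtain ⟨v, rfl⟩ := (Submodule.mem_span_range_iff_exists_fun R).1 hx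
      exact ⟨v, Subtype.ext (by simp [hqv])⟩
    let π : (Fin n → R) →ₗ[R] PolyB R n ⧸ J := (Ideal.Quotient.mkₐ R J).toLinearMap ∘ₗ l
    have hπ : LinearMap.ker q ≤ LinearMap.ker π := by
      intro v hv
      obtain ⟨x, rfl⟩ := (hker v).1 (by rw [← hqv, LinearMap.mem_ker.1 hv]; rfl)
      refine LinearMap.mem_ker.2 (Ideal.Quotient.eq_zero_iff_mem.2 ⟨1 ⊗ₜ x, ?_⟩)
      rw [firstMap_tmul, one_mul]
    let γ : Ideal.span (Set.range f) →ₗ[R] PolyB R n ⧸ J :=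
      (LinearMap.ker q).liftQ π hπ ∘ₗ (q.quotKerEquivOfSurjective hq).symm.toLinearMap
    have hγ : ∀ v, γ (q v) = π v := by
      intro v
      have h1 : (q.quotKerEquivOfSurjective hq).symm (q v) = Submodule.Quotient.mk v := by
        rw [LinearEquiv.symm_apply_eq]
        rfl
      change (LinearMap.ker q).liftQ π hπ ((q.quotKerEquivOfSurjective hq).symm (q v)) = _
      rw [h1, Submodule.liftQ_apply]
    have hcomp : (SymmetricAlgebra.lift γ).comp (toSym f) = Ideal.Quotient.mkₐ R J := by
      refine MvPolynomial.algHom_ext fun j => ?_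
      rw [AlgHom.comp_apply, toSym, MvPolynomial.aeval_X, SymmetricAlgebra.lift_ι_apply]
      have h1 := hγ (Pi.single j 1)
      have h2 : q (Pi.single j 1) = ⟨f j, Ideal.subset_span (Set.mem_range_self j)⟩ := by
        simp [q]
      rw [h2] at h1
      rw [h1]
      simp [π, hl]
    have h1 : Ideal.Quotient.mkₐ R J b = 0 := by
      rw [← hcomp, AlgHom.comp_apply]
      exact (congrArg _ hb).trans (map_zero _)
    exact Ideal.Quotient.eq_zero_iff_mem.1 h1
  · rintro ⟨x, rfl⟩
    induction x using TensorProduct.induction_on with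
    | zero => rw [map_zero, map_zero]
    | tmul p x =>
      rw [firstMap_tmul]
      change toSym f (p * l _) = 0
      rw [map_mul, hsym]
      have h1 : ∑ j, F.e₁ (F.d 1 x) j •
          (⟨f j, Ideal.subset_span (Set.mem_range_self j)⟩ : Ideal.span (Set.range f)) = 0 :=
        Subtype.ext (by simpa using (hker _).2 ⟨x, rfl⟩)
      rw [h1, map_zero, mul_zero]
    | add x y hx hy => rw [map_add, map_add, hx, hy, add_zero]

end QuotRes

end SymPresentation

/-! ### The cone over `F_•` and the case of deviation one -/

section Assembly

variable {R : Type u} [CommRing R] {n : ℕ} {f : Fin n → R}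

open GrMod

namespace QuotRes

variable (F : QuotRes f)

/-- The differential of `F_• ⊗ B(-1)`, starting in degree `2`. -/
noncomputable def dB (i : ℕ) : (F.termF (i + 3)).carrier →ₗ[PolyB R n] (F.termF (i + 2)).carrier :=
  (F.d (i + 2)).baseChange (PolyB R n)

theorem dB_exact (i : ℕ) : Function.Exact (F.dB (i + 1)) (F.dB i) :=
  baseChange_exact (F.exact (i + 2))

theorem isHomog_dB (i : ℕ) : IsHomog (X := F.termF (i + 3)) (Y := F.termF (i + 2)) (F.dB i) :=
  isHomog_baseChange _ _

theorem exact_dB_toCyclesB : Function.Exact (F.dB 0) F.toCyclesB :=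
  baseChange_exact F.exact_d_toCycles

theorem exact_toCyclesB : Function.Exact F.toCyclesB (koszulDf f 0) :=
  baseChange_exact F.exact_toCycles

theorem isHomog_firstMap : IsHomog (X := F.termF 2) (Y := GrMod.base R n) F.firstMap := by
  refine (isHomog_twist_iff n _).2 fun j p m hp => ?_
  rw [firstMap_tmul]
  refine hp.mul ?_
  rw [Fintype.linearCombination_apply]
  exact Submodule.sum_mem (MvPolynomial.homogeneousSubmodule (Fin n) R 1) fun k _ =>
    Submodule.smul_mem _ _ (MvPolynomial.isHomogeneous_X R k)

/-- A resolution `E_•` of the cycles of `∂_y` on `Z₁ ⊗ B` gives rise to a cone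
resolving `Sym(I)`. -/
theorem exists_cone {E : ℕ → GrMod R n}
    {dE : ∀ i, (E (i + 1)).carrier →ₗ[PolyB R n] (E i).carrier}
    (hdE : ∀ i, IsHomog (dE i)) (hE : ∀ i, (E i).IsProjective)
    (hex : ∀ i, Function.Exact (dE (i + 1)) (dE i))
    (η : (E 0).carrier →ₗ[PolyB R n] PolyB R n ⊗[R] (⋀[R]^1 (Fin n → R)))
    (hη : IsHomog (Y := twist n (⋀[R]^1 (Fin n → R)) 1) η)
    (hηex : Function.Exact (dE 0) η) (hηf : ∀ x, koszulDf f 0 (η x) = 0)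
    (hηy : ∀ x, koszulDy R n 0 (η x) = 0)
    (hsurj : ∀ z, koszulDf f 0 z = 0 → koszulDy R n 0 z = 0 → ∃ x, η x = z) :
    ∃ c : ∀ i, (E i).carrier →ₗ[PolyB R n] (F.termF (i + 2)).carrier,
      (∀ i, IsHomog (Y := F.termF (i + 2)) (c i)) ∧
      Function.Exact ((c 0).coprod (F.dB 0)) F.firstMap ∧
      Function.Exact (coneMap (E := fun i => (E i).carrier)
        (Y := fun i => (F.termF (i + 2)).carrier) dE F.dB c 0) ((c 0).coprod (F.dB 0)) ∧
      ∀ i, Function.Exact (coneMap (E := fun i => (E i).carrier)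
        (Y := fun i => (F.termF (i + 2)).carrier) dE F.dB c (i + 1))
        (coneMap (E := fun i => (E i).carrier)
        (Y := fun i => (F.termF (i + 2)).carrier) dE F.dB c i) := by
  have hdd : ∀ i x, dE i (dE (i + 1) x) = 0 := fun i => (hex i).apply_apply_eq_zero
  have := F.free
  -- `η` takes values in `Z₁ ⊗ B`, which is the image of `F₂ ⊗ B`; projectivity gives a homogeneous
  -- lift of `η` to `F₂ ⊗ B(-1)`.
  obtain ⟨c₀, hc₀, hc₀'⟩ := hE 0 (F.termF 2) (twist n (⋀[R]^1 (Fin n → R)) 1)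
    (isGraded_twist _ _ _) (isGraded_twist _ _ _) F.toCyclesB η (isHomog_baseChange _ _) hη
    (fun x => (F.exact_toCyclesB _).1 (hηf x))
  obtain ⟨c, rfl, hc, hcd⟩ := exists_anticomm (Y := fun i => F.termF (i + 2)) (dY := F.dB) hdE
    F.isHomog_dB hE (fun _ => isGraded_twist _ _ _) hdd F.dB_exact c₀ hc₀
    (fun x => (F.exact_dB_toCyclesB _).1 (by rw [hc₀', hηex.apply_apply_eq_zero]))
  refine ⟨c, hc, ?_, ?_, ?_⟩
  · intro y
    rw [firstMap_eq_zero_iff]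
    constructor
    · intro hy
      -- The image of `y` in `Z₁ ⊗ B` is a `∂_y`-cycle, hence comes from `E 0`; the remaining
      -- difference lies in the kernel of `F₂ ⊗ B → Z₁ ⊗ B`, that is, in the image of `F₃ ⊗ B`.
      obtain ⟨x, hx⟩ := hsurj _ (F.exact_toCyclesB.apply_apply_eq_zero y) hy
      obtain ⟨y', hy'⟩ := (F.exact_dB_toCyclesB (y - c 0 x)).1 (by
        rw [map_sub, hc₀', hx, sub_self])
      exact ⟨(x, y'), by rw [LinearMap.coprod_apply, hy', add_sub_cancel]⟩
    · rintro ⟨⟨x, y'⟩, rfl⟩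
      rw [LinearMap.coprod_apply, map_add, hc₀', F.exact_dB_toCyclesB.apply_apply_eq_zero,
        add_zero, hηy]
  · refine coneMap_exact_one (E := fun i => (E i).carrier)
      (Y := fun i => (F.termF (i + 2)).carrier) hcd F.dB_exact fun e y h => (hηex e).1 ?_
    rw [← hc₀', h, F.exact_dB_toCyclesB.apply_apply_eq_zero]
  · exact coneMap_exact (E := fun i => (E i).carrier)
      (Y := fun i => (F.termF (i + 2)).carrier) hcd hex F.dB_exact

theorem isHomog_coneMap {E Y : ℕ → GrMod R n}
    {dE : ∀ i, (E (i + 1)).carrier →ₗ[PolyB R n] (E i).carrier}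
    {dY : ∀ i, (Y (i + 1)).carrier →ₗ[PolyB R n] (Y i).carrier}
    (hdE : ∀ i, IsHomog (dE i)) (hdY : ∀ i, IsHomog (dY i))
    {c : ∀ i, (E i).carrier →ₗ[PolyB R n] (Y i).carrier} (hc : ∀ i, IsHomog (c i)) (i : ℕ) :
    IsHomog (X := (E (i + 1)).prod (Y (i + 2))) (Y := (E i).prod (Y (i + 1)))
      (coneMap (E := fun i => (E i).carrier) (Y := fun i => (Y i).carrier) dE dY c i) :=
  fun k _ hx => ⟨hdE i k _ hx.1, add_mem (hc (i + 1) k _ hx.1) (hdY (i + 1) k _ hx.2)⟩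

/-- The resolution of `Sym(I)` when the Koszul homology vanishes in degrees at least `2`. -/
theorem exists_resOne (hZ : ApproxAcyclic f)
    (hK : ∀ i, 1 ≤ i → Function.Exact (koszulD f (i + 1)) (koszulD f i)) :
    ∃ δ : (i : ℕ) → (F.resOne (i + 1)).carrier →ₗ[PolyB R n] (F.resOne i).carrier,
      IsGradedFreeResolution F.resOne δ (symAug f) ∧ F.IsConeOne δ := by
  let E : ℕ → GrMod R n := fun i => totMod R n 1 (i + 1)
  let dE : ∀ i, (E (i + 1)).carrier →ₗ[PolyB R n] (E i).carrier := fun i => totD f 1 (i + 1)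
  have hdE : ∀ i, IsHomog (dE i) := fun i => isHomog_totD f 1 (i + 1)
  let η : (E 0).carrier →ₗ[PolyB R n] PolyB R n ⊗[R] (⋀[R]^1 (Fin n → R)) :=
    -- The augmentation `∂_y ∂_f : K₃ ⊗ B(-2) → K₁ ⊗ B(-1)` of `T_•`. Its image is all of the cycles
    -- of `∂_y` on `Z₁ ⊗ B`, since `Z₂ = ∂_f K₃`.
    koszulDy R n 1 ∘ₗ koszulDf f 2 ∘ₗ LinearMap.proj 0
  have hη : IsHomog (Y := twist n (⋀[R]^1 (Fin n → R)) 1) η := fun k x hx =>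
    isHomog_koszulDy 1 1 k _ (isHomog_koszulDf f 2 2 k _ (hx 0 trivial))
  obtain ⟨c, hc, h0, h1, h2⟩ := F.exists_cone (E := E) (dE := dE) hdE
    (fun i => isProjective_totMod 1 (i + 1)) (totD_exact hZ hK) η hη
    (by
      intro t
      constructor
      · intro ht
        obtain ⟨w, hw, hw'⟩ := hZ.exists_cycle 1 (koszulDf f 2 (t 0)) (koszulDf_koszulDf f 1 _) ht
        exact mem_range_totD_one hK t w hw hw'
      · rintro ⟨s, rfl⟩
        change koszulDy R n 1 (koszulDf f 2 (koszulDf f 3 (s 0) + koszulDy R n 3 (s 1))) = 0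
        rw [map_add, koszulDf_koszulDf, zero_add, koszulDf_koszulDy, map_neg, koszulDy_koszulDy,
          neg_zero])
    (fun x => by
      change koszulDf f 0 (koszulDy R n 1 (koszulDf f 2 (x 0))) = 0
      rw [koszulDf_koszulDy, koszulDf_koszulDf, map_zero, neg_zero])
    (fun x => koszulDy_koszulDy 0 _)
    (fun z hz hz' => by
      obtain ⟨w, hw, rfl⟩ := hZ.exists_cycle 0 z hz hz'
      obtain ⟨s, rfl⟩ := (koszulDf_exact (hK 1 le_rfl) w).1 hw
      exact ⟨fun _ => s, rfl⟩)
  let δ : (i : ℕ) → (F.resOne (i + 1)).carrier →ₗ[PolyB R n] (F.resOne i).carrier := fun i =>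
    match i with
    | 0 => F.firstMap
    | 1 => (c 0).coprod (F.dB 0)
    | i + 2 => coneMap (E := fun i => (E i).carrier)
        (Y := fun i => (F.termF (i + 2)).carrier) dE F.dB c i
  have := F.free
  refine ⟨δ, ⟨?_, ?_, ?_, F.exact_firstMap_symAug, symAug_surjective f⟩, ⟨?_, ?_, ?_⟩⟩
  · rintro (_ | _ | i)
    · exact inferInstanceAs (Module.Free (PolyB R n) (PolyB R n))
    · exact inferInstanceAs (Module.Free (PolyB R n) (PolyB R n ⊗[R] F.F 2))
    · exact inferInstanceAs (Module.Free (PolyB R n)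
        ((Fin (i + 1) → PolyB R n ⊗[R] (⋀[R]^(2 + (i + 1)) (Fin n → R))) ×
          PolyB R n ⊗[R] F.F (i + 3)))
  · rintro (_ | _ | i)
    · exact F.isHomog_firstMap
    · exact IsHomog.coprod (hc 0) (F.isHomog_dB 0)
    · exact isHomog_coneMap (E := E) (Y := fun i => F.termF (i + 2)) hdE F.isHomog_dB hc i
  · rintro (_ | _ | i)
    · exact h0
    · exact h1
    · exact h2 i
  · exact fun x => rfl
  · rintro (_ | i) x
    · exact (congrArg (· + F.dB 0 x) (map_zero (c 0))).trans (zero_add _)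
    · exact Prod.ext (map_zero (dE i))
        ((congrArg (· + F.dB (i + 1) x) (map_zero (c (i + 1)))).trans (zero_add _))
  · exact fun i x => rfl

end QuotRes

end Assembly

/-! ### Grade and height over Cohen-Macaulay local rings -/

section Depth

open RingTheory.Sequence IsLocalRing CategoryTheory Abelian Pointwise

theorem exists_nat_eq_of_withBot {a : WithBot ℕ∞} (h0 : 0 ≤ a) {m : ℕ} (h : a ≤ m) :
    ∃ k : ℕ, a = k := by
  induction a with
  | bot => exact absurd h0 (by simp)
  | coe a =>
    induction a with
    | top => exact absurd (WithBot.coe_le_coe.1 h) (by simp)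
    | coe k => exact ⟨k, rfl⟩

theorem height_add_ringKrullDim_quotient_le {R : Type*} [CommRing R] (P : Ideal R) [P.IsPrime] :
    (P.height : WithBot ℕ∞) + ringKrullDim (R ⧸ P) ≤ ringKrullDim R := by
  let p : PrimeSpectrum R := ⟨P, inferInstance⟩
  have h1 : ringKrullDim (R ⧸ P) = (Order.coheight p : ℕ∞) := by
    rw [ringKrullDim_quotient, Order.coheight_eq_krullDim_Ici]
    rfl
  have h2 : P.height = Order.height p := p.height_eq_orderHeight
  have : Nonempty (PrimeSpectrum R) := ⟨p⟩
  rw [h1, h2, ringKrullDim, Order.krullDim_eq_iSup_height_add_coheight_of_nonempty,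
    ← WithBot.coe_add]
  exact WithBot.coe_le_coe.2 (le_iSup (fun a : PrimeSpectrum R => Order.height a + Order.coheight a) p)

variable {R : Type u} [CommRing R] [IsLocalRing R] [IsNoetherianRing R]

/-- With `N` the submodule killed by `P`, some `y ∈ N` lies outside `xM`. The class of `y` in `M ⧸
xM` is nonzero and killed by `P` and `x`, so an associated prime of the quotient contains both. -/
theorem exists_isAssociatedPrime_quotSMulTop {M : Type*} [AddCommGroup M] [Module R M]
    [Module.Finite R M] {x : R} (hx : x ∈ maximalIdeal R) (hreg : IsSMulRegular M x) {P : Ideal R}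
    (hP : IsAssociatedPrime P M) :
    x ∉ P ∧ ∃ Q, IsAssociatedPrime Q (QuotSMulTop x M) ∧ P ≤ Q ∧ x ∈ Q := by
  obtain ⟨hprime, m, hm⟩ := isAssociatedPrime_iff.1 hP
  have hmem : ∀ r, r ∈ P ↔ r • m = 0 := fun r => by
    rw [hm, Submodule.mem_colon_singleton, Submodule.mem_bot]
  have hm0 : m ≠ 0 := fun h => hprime.ne_top ((Ideal.eq_top_iff_one _).2 ((hmem 1).2 (by simp [h])))
  refine ⟨fun h => hm0 (hreg.right_eq_zero_of_smul ((hmem x).1 h)), ?_⟩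
  let N : Submodule R M := Submodule.torsionBySet R M P
  have hN : ∀ y, y ∈ N ↔ ∀ r ∈ P, r • y = 0 := fun y => by
    simp [N, Submodule.mem_torsionBySet_iff]
  have hex : ∃ y ∈ N, y ∉ (x • ⊤ : Submodule R M) := by
    by_contra! h
    -- If `N ⊆ xM`, then regularity of `x` puts the quotients by `x` back into `N`, so `N = xN`, and
    -- Nakayama's lemma gives `N = 0`.
    have h1 : N ≤ maximalIdeal R • N := by
      intro y hy
      obtain ⟨z, -, rfl⟩ := (Submodule.mem_smul_pointwise_iff_exists _ _ _).1 (h y hy)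
      refine Submodule.smul_mem_smul hx ((hN z).2 fun r hr => hreg.right_eq_zero_of_smul ?_)
      rw [smul_comm]
      exact (hN _).1 hy r hr
    have h2 := Submodule.eq_bot_of_le_smul_of_le_jacobson_bot (maximalIdeal R) N
      (IsNoetherian.noetherian N) h1 (maximalIdeal_le_jacobson _)
    have h3 : m ∈ N := (hN m).2 fun r hr => (hmem r).1 hr
    rw [h2, Submodule.mem_bot] at h3
    exact hm0 h3
  obtain ⟨y, hy, hy'⟩ := hex
  obtain ⟨Q, hQ, hle⟩ := exists_le_isAssociatedPrime_of_isNoetherianRing R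
    (Submodule.Quotient.mk y : QuotSMulTop x M) (fun h => hy' ((Submodule.Quotient.mk_eq_zero _).1 h))
  refine ⟨Q, hQ, fun r hr => hle ?_, hle ?_⟩
  · rw [Submodule.mem_colon_singleton, Submodule.mem_bot, ← Submodule.Quotient.mk_smul,
      (hN y).1 hy r hr, Submodule.Quotient.mk_zero]
  · rw [Submodule.mem_colon_singleton, Submodule.mem_bot, ← Submodule.Quotient.mk_smul,
      Submodule.Quotient.mk_eq_zero]
    exact Submodule.smul_mem_pointwise_smul y x ⊤ trivial

/-- The classical bound of depth by `dim R ⧸ P` for associated primes `P`. Each regular element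
forces a passage to a strictly larger associated prime, which lowers the dimension by at least one.
-/
theorem length_le_ringKrullDim_quotient_of_isWeaklyRegular (rs : List R) {M : Type*}
    [AddCommGroup M] [Module R M] [Module.Finite R M] (hreg : IsWeaklyRegular M rs)
    (hrs : ∀ r ∈ rs, r ∈ maximalIdeal R) {P : Ideal R} (hP : IsAssociatedPrime P M) :
    (rs.length : WithBot ℕ∞) ≤ ringKrullDim (R ⧸ P) := by
  induction rs generalizing M P with
  | nil =>
    have := hP.isPrime
    exact ringKrullDim_nonneg_of_nontrivial
  | cons x rs ih =>
    rw [isWeaklyRegular_cons_iff] at hreg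
    obtain ⟨hxP, Q, hQ, hPQ, hxQ⟩ :=
      exists_isAssociatedPrime_quotSMulTop (hrs x List.mem_cons_self) hreg.1 hP
    have h1 := ih hreg.2 (fun r hr => hrs r (List.mem_cons_of_mem _ hr)) hQ
    have := hP.isPrime
    have h2 := ringKrullDim_succ_le_of_surjective (Ideal.Quotient.factor hPQ)
      (Ideal.Quotient.factor_surjective hPQ) (r := Ideal.Quotient.mk P x)
      (mem_nonZeroDivisors_of_ne_zero (fun h => hxP (Ideal.Quotient.eq_zero_iff_mem.1 h)))
      (Ideal.Quotient.eq_zero_iff_mem.2 hxQ)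
    rw [List.length_cons, Nat.cast_succ]
    exact (add_le_add_left h1 1).trans h2

/-- Depth drops by at most one modulo a regular element: the groups `Ext^i(k, M)` from the residue
field `k` vanish for `i ≤ d`, so the long exact sequence kills `Ext^i(k, M ⧸ xM)` for `i < d`. Thus
`x` need not belong to `rs`. -/
theorem exists_isRegular_quotSMulTop {M : Type u} [AddCommGroup M] [Module R M]
    [Module.Finite R M] [Nontrivial M] {x : R} (hx : x ∈ maximalIdeal R) (hreg : IsSMulRegular M x)
    {rs : List R} (hrs : IsRegular M rs) (hmem : ∀ r ∈ rs, r ∈ maximalIdeal R) {d : ℕ}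
    (hd : rs.length = d + 1) :
    ∃ rs' : List R, rs'.length = d ∧ (∀ r ∈ rs', r ∈ maximalIdeal R) ∧
      IsRegular (QuotSMulTop x M) rs' := by
  have htop : ∀ (L : Type u) [AddCommGroup L] [Module R L] [Module.Finite R L] [Nontrivial L],
      maximalIdeal R • (⊤ : Submodule R L) < ⊤ := fun L _ _ _ _ =>
    (Submodule.top_ne_ideal_smul_of_le_jacobson_annihilator (maximalIdeal_le_jacobson _)).symm.lt_top
  have hsupp : Module.support R (R ⧸ maximalIdeal R) =
      PrimeSpectrum.zeroLocus (maximalIdeal R : Set R) := by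
    rw [Module.support_eq_zeroLocus, Ideal.annihilator_quotient]
  have hnt := nontrivial_quotSMulTop_of_mem_maximalIdeal M hx
  have hext := ModuleCat.subsingleton_ext_of_exists_isRegular (maximalIdeal R)
    (ModuleCat.of R (R ⧸ maximalIdeal R)) hsupp.subset (ModuleCat.of R M) (htop M) rs hmem hrs
  refine ModuleCat.exists_isRegular_of_exists_subsingleton_ext (maximalIdeal R) d
    (ModuleCat.of R (QuotSMulTop x M)) (htop _) (ModuleCat.of R (R ⧸ maximalIdeal R)) hsupp ?_
  intro i hi
  have zero1 := AddCommGrpCat.isZero_of_iff_subsingleton.mpr (hext i (by omega))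
  have zero2 := AddCommGrpCat.isZero_of_iff_subsingleton.mpr (hext (i + 1) (by omega))
  have hreg' : IsSMulRegular (ModuleCat.of R M) x := hreg
  exact AddCommGrpCat.subsingleton_of_isZero <| ShortComplex.Exact.isZero_of_both_zeros
    ((Ext.covariant_sequence_exact₃' _ hreg'.smulShortComplex_shortExact) i (i + 1) rfl)
    (zero1.eq_zero_of_src _) (zero2.eq_zero_of_tgt _)

/-- The hypothesis `hdim` is arranged to survive the passage to `M ⧸ xM`, where `g` and the length
of the available regular sequence both drop by one while the primes over `I` stay the same. -/
theorem exists_isWeaklyRegular_of_ringKrullDim_quotient_le (g : ℕ) {M : Type u} [AddCommGroup M]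
    [Module R M] [Module.Finite R M] [Nontrivial M] {rs : List R} (hrs : IsRegular M rs)
    (hmem : ∀ r ∈ rs, r ∈ maximalIdeal R) {I : Ideal R} (hI : I ≤ maximalIdeal R)
    (hdim : ∀ P : Ideal R, P.IsPrime → I ≤ P →
      ringKrullDim (R ⧸ P) + (g : WithBot ℕ∞) ≤ (rs.length : WithBot ℕ∞)) :
    ∃ xs : List R, xs.length = g ∧ (∀ x ∈ xs, x ∈ I) ∧ IsWeaklyRegular M xs := by
  induction g generalizing M rs with
  | zero => exact ⟨[], rfl, by simp, IsWeaklyRegular.nil R M⟩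
  | succ g ih =>
    have hcast : ∀ P : Ideal R, P.IsPrime → I ≤ P → ∃ k : ℕ, ringKrullDim (R ⧸ P) = k ∧
        k + (g + 1) ≤ rs.length := by
      intro P hP hIP
      have h1 := hdim P hP hIP
      have h0 : 0 ≤ ringKrullDim (R ⧸ P) := ringKrullDim_nonneg_of_nontrivial
      obtain ⟨k, hk⟩ := exists_nat_eq_of_withBot h0
        ((le_add_of_nonneg_right (by positivity)).trans h1)
      rw [hk] at h1
      exact ⟨k, hk, by exact_mod_cast h1⟩
    have hx : ∃ x ∈ I, IsSMulRegular M x := by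
      by_contra! h
      -- If `I` has no regular element, prime avoidance puts it into an associated prime `P`. Then
      -- the depth is at most `dim R ⧸ P`, against `hdim` with `g + 1 > 0`.
      obtain ⟨P, hP, hIP⟩ : ∃ P ∈ associatedPrimes R M, I ≤ P := by
        refine (Ideal.subset_union_prime_finite (f := id) (associatedPrimes.finite R M) ⊤ ⊤
          (fun P hP _ _ => IsAssociatedPrime.isPrime hP)).1 fun x hx => ?_
        have h1 : x ∈ ⋃ p ∈ associatedPrimes R M, (p : Set R) := by
          rw [biUnion_associatedPrimes_eq_compl_regular R M]
          exact h x hx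
        exact h1
      have h1 := length_le_ringKrullDim_quotient_of_isWeaklyRegular rs hrs.1 hmem hP
      obtain ⟨k, hk, hk'⟩ := hcast P hP.isPrime hIP
      rw [hk] at h1
      have h2 : rs.length ≤ k := by exact_mod_cast h1
      omega
    obtain ⟨x, hxI, hx⟩ := hx
    obtain ⟨d, hd⟩ : ∃ d, rs.length = d + 1 := by
      obtain ⟨k, -, hk⟩ := hcast (maximalIdeal R) inferInstance hI
      exact ⟨rs.length - 1, by omega⟩
    obtain ⟨rs', hlen, hmem', hrs'⟩ := exists_isRegular_quotSMulTop (hI hxI) hx hrs hmem hd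
    have := nontrivial_quotSMulTop_of_mem_maximalIdeal M (hI hxI)
    obtain ⟨xs, hxs, hxs', hxs''⟩ := ih hrs' hmem' (fun P hP hIP => by
      obtain ⟨k, hk, hk'⟩ := hcast P hP hIP
      rw [hk, hlen]
      exact_mod_cast (by omega : k + g ≤ d))
    refine ⟨x :: xs, by simp [hxs], ?_, (isWeaklyRegular_cons_iff M x xs).2 ⟨hx, hxs''⟩⟩
    simpa [hxI] using hxs'

/-- For a prime `P ⊇ I` one has `ht I + dim R ⧸ P ≤ ht P + dim R ⧸ P ≤ dim R`, and `dim R` is the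
depth. -/
theorem IsCohenMacaulayLocal.exists_isWeaklyRegular {R : Type u} [CommRing R]
    [IsLocalRing R] (hR : IsCohenMacaulayLocal R)
    {I : Ideal R} {g : ℕ} (hg : I.height = g) :
    ∃ xs : List R, xs.length = g ∧ (∀ x ∈ xs, x ∈ I) ∧ IsWeaklyRegular R xs := by
  obtain ⟨hN, hdim⟩ := hR
  have hI : I ≤ maximalIdeal R := le_maximalIdeal fun h => by
    rw [h, Ideal.height_top] at hg
    exact ENat.natCast_ne_top g hg.symm
  obtain ⟨d, hd⟩ : ∃ d : ℕ, ringKrullDim R = d := by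
    have h0 : 0 ≤ ringKrullDim R := ringKrullDim_nonneg_of_nontrivial
    have h1 : ringKrullDim R < ⊤ := ringKrullDim_lt_top
    generalize ringKrullDim R = a at h0 h1
    induction a with
    | bot => exact absurd h0 (by simp)
    | coe a =>
      induction a with
      | top => exact absurd h1 (lt_irrefl _)
      | coe k => exact ⟨k, rfl⟩
  -- The finite supremum defining the depth is attained: otherwise all lengths are at most `d - 1`,
  -- and for `d = 0` the empty sequence already suffices.
  obtain ⟨rs, hrs, hmem, hlen⟩ : ∃ rs : List R, IsRegular R rs ∧ (∀ r ∈ rs, r ∈ maximalIdeal R) ∧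
      d ≤ rs.length := by
    by_contra! h
    rw [hd] at hdim
    have h1 : idealGrade (maximalIdeal R) = d := by exact_mod_cast hdim
    rcases Nat.eq_zero_or_pos d with rfl | hpos
    · exact absurd (h [] (IsRegular.nil R R) (by simp)) (by simp)
    · have h2 : idealGrade (maximalIdeal R) ≤ ((d - 1 : ℕ) : ℕ∞) := iSup_le fun rs => by
        have := h rs.1 rs.2.1 rs.2.2
        exact_mod_cast (by omega : rs.1.length ≤ d - 1)
      rw [h1] at h2
      have h3 : d ≤ d - 1 := by exact_mod_cast h2
      omega
  refine exists_isWeaklyRegular_of_ringKrullDim_quotient_le g hrs hmem hI fun P hP hIP => ?_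
  have h1 := height_add_ringKrullDim_quotient_le P
  have h2 : (g : WithBot ℕ∞) ≤ (P.height : WithBot ℕ∞) := by
    have := Ideal.height_mono hIP
    rw [hg] at this
    exact WithBot.coe_le_coe.2 this
  calc ringKrullDim (R ⧸ P) + (g : WithBot ℕ∞) ≤ ringKrullDim (R ⧸ P) + P.height := by gcongr
    _ ≤ d := by rw [add_comm, ← hd]; exact h1
    _ ≤ rs.length := by exact_mod_cast hlen

end Depth

/-! ### Vanishing of the cohomology of `Hom(C, M)` -/

section HomComplex

open Pointwise RingTheory.Sequence

variable {R : Type u} [CommRing R]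

theorem exists_lift_of_range_le {P N M : Type*} [AddCommGroup P] [Module R P]
    [Module.Projective R P] [AddCommGroup N] [Module R N] [AddCommGroup M] [Module R M]
    (φ : N →ₗ[R] M) (ψ : P →ₗ[R] M) (h : ∀ x, ∃ y, φ y = ψ x) :
    ∃ χ : P →ₗ[R] N, ∀ x, φ (χ x) = ψ x := by
  obtain ⟨χ, hχ⟩ := Module.projective_lifting_property φ.rangeRestrict
    (ψ.codRestrict (LinearMap.range φ) h) φ.surjective_rangeRestrict
  exact ⟨χ, fun x => congrArg Subtype.val (LinearMap.congr_fun hχ x)⟩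

variable {C : ℕ → Type u} [∀ j, AddCommGroup (C j)] [∀ j, Module R (C j)]
  (d : ∀ j, C (j + 1) →ₗ[R] C j)

/-- The coboundaries in `Hom(C_j, M)`. -/
def IsCobound {M : Type u} [AddCommGroup M] [Module R M] : ∀ j, (C j →ₗ[R] M) → Prop
  | 0, φ => φ = 0
  | j + 1, φ => ∃ ψ : C j →ₗ[R] M, φ = ψ ∘ₗ d j

/-- The complex `Hom(C, M)` is exact in degree `j`. -/
def HomExactAt (M : Type u) [AddCommGroup M] [Module R M] (j : ℕ) : Prop :=
  ∀ φ : C j →ₗ[R] M, φ ∘ₗ d j = 0 → IsCobound d j φ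

/-- Multiplication by `r` on the complex `C` is homotopic to zero. -/
def IsNullHomotopic (r : R) : Prop :=
  ∃ h : ∀ j, C j →ₗ[R] C (j + 1), (∀ y, d 0 (h 0 y) = r • y) ∧
    ∀ j y, d (j + 1) (h (j + 1) y) + h j (d j y) = r • y

variable {d}

theorem IsNullHomotopic.mul {r : R} (h : IsNullHomotopic d r) (s : R) :
    IsNullHomotopic d (s * r) := by
  obtain ⟨h, h0, h1⟩ := h
  refine ⟨fun j => s • h j, fun y => ?_, fun j y => ?_⟩
  · rw [LinearMap.smul_apply, map_smul, h0, mul_smul]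
  · rw [LinearMap.smul_apply, LinearMap.smul_apply, map_smul, ← smul_add, h1, mul_smul]

theorem IsNullHomotopic.isCobound {r : R} (h : IsNullHomotopic d r) {M : Type u} [AddCommGroup M]
    [Module R M] (j : ℕ) (φ : C j →ₗ[R] M) (hφ : φ ∘ₗ d j = 0) : IsCobound d j (r • φ) := by
  obtain ⟨h, h0, h1⟩ := h
  have hφ' : ∀ y, φ (d j y) = 0 := LinearMap.congr_fun hφ
  cases j with
  | zero =>
    refine LinearMap.ext fun y => ?_
    rw [LinearMap.smul_apply, ← map_smul, ← h0, hφ', LinearMap.zero_apply]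
  | succ j =>
    refine ⟨φ ∘ₗ h j, LinearMap.ext fun y => ?_⟩
    rw [LinearMap.smul_apply, ← map_smul, ← h1, map_add, hφ', zero_add]
    rfl

/-- From `0 → M → M → M ⧸ xM → 0`: if the cohomology of `Hom(C, M ⧸ xM)` vanishes in degree `j`,
then `x` is injective on that of `Hom(C, M)` in degree `j + 1`. Concretely, `ψ` is corrected by a
lifted coboundary `χ` until it is divisible by `x`. -/
theorem isCobound_of_smul [∀ j, Module.Projective R (C j)] (hdd : ∀ j x, d j (d (j + 1) x) = 0)
    {M : Type u} [AddCommGroup M] [Module R M] {x : R} (hx : IsSMulRegular M x) {j : ℕ}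
    (hM : HomExactAt d (QuotSMulTop x M) j) (φ : C (j + 1) →ₗ[R] M)
    (hφ : IsCobound d (j + 1) (x • φ)) : IsCobound d (j + 1) φ := by
  obtain ⟨ψ, hψ⟩ := hφ
  have hψ' : ∀ y, x • φ y = ψ (d j y) := LinearMap.congr_fun hψ
  have hmem : ∀ m : M, (Submodule.Quotient.mk m : QuotSMulTop x M) = 0 → ∃ m', x • m' = m := by
    intro m hm
    obtain ⟨m', -, h⟩ := (Submodule.mem_smul_pointwise_iff_exists _ _ _).1
      ((Submodule.Quotient.mk_eq_zero _).1 hm)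
    exact ⟨m', h⟩
  have hcob := hM ((Submodule.mkQ _) ∘ₗ ψ) (LinearMap.ext fun y => by
    change Submodule.Quotient.mk (ψ (d j y)) = 0
    rw [← hψ', Submodule.Quotient.mk_eq_zero]
    exact Submodule.smul_mem_pointwise_smul _ _ _ trivial)
  suffices H : ∃ χ : C j →ₗ[R] M, (∀ y, χ (d j y) = 0) ∧
      ∀ y, (Submodule.Quotient.mk (ψ y - χ y) : QuotSMulTop x M) = 0 by
    obtain ⟨χ, hχ, hχ'⟩ := H
    obtain ⟨ψ', hψ''⟩ := exists_lift_of_range_le (LinearMap.lsmul R M x) (ψ - χ)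
      (fun y => hmem _ (hχ' y))
    refine ⟨ψ', LinearMap.ext fun y => hx ?_⟩
    have := hψ'' (d j y)
    rw [LinearMap.lsmul_apply, LinearMap.sub_apply, hχ, sub_zero, ← hψ'] at this
    exact this.symm
  cases j with
  | zero =>
    refine ⟨0, fun y => rfl, fun y => ?_⟩
    rw [LinearMap.zero_apply, sub_zero]
    exact LinearMap.congr_fun hcob y
  | succ j =>
    obtain ⟨χ, hχ⟩ := hcob
    obtain ⟨χ', hχ'⟩ := exists_lift_of_range_le (Submodule.mkQ (x • ⊤ : Submodule R M)) χ
      (fun y => Submodule.mkQ_surjective _ _)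
    refine ⟨χ' ∘ₗ d j, fun y => ?_, fun y => ?_⟩
    · rw [LinearMap.comp_apply, hdd, map_zero]
    · have h1 := LinearMap.congr_fun hχ y
      have h2 := hχ' (d j y)
      rw [Submodule.Quotient.mk_sub, sub_eq_zero]
      exact h1.trans h2.symm

/-- Exactness of `Hom(C, M)` below degree `s` for all `M` extends to the range below `s + k` if
there is a weakly `M`-regular sequence of length `k` of elements with null-homotopic squares. -/
theorem homExactAt_of_isWeaklyRegular [∀ j, Module.Projective R (C j)]
    (hdd : ∀ j x, d j (d (j + 1) x) = 0) {s : ℕ}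
    (hs : ∀ (M : Type u) [AddCommGroup M] [Module R M], ∀ j < s, HomExactAt d M j) (rs : List R)
    (hrs : ∀ r ∈ rs, IsNullHomotopic d (r * r)) (M : Type u) [AddCommGroup M] [Module R M]
    (hreg : IsWeaklyRegular M rs) : ∀ j < s + rs.length, HomExactAt d M j := by
  induction rs generalizing M with
  | nil => exact hs M
  | cons x rs ih =>
    rw [isWeaklyRegular_cons_iff] at hreg
    have h1 := ih (fun r hr => hrs r (List.mem_cons_of_mem _ hr)) _ hreg.2
    intro j hj φ hφ
    have h2 := (hrs x List.mem_cons_self).isCobound j φ hφ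
    rw [mul_smul] at h2
    cases j with
    | zero =>
      refine LinearMap.ext fun y => hreg.1 (hreg.1 ?_)
      simpa using LinearMap.congr_fun h2 y
    | succ j =>
      rw [List.length_cons] at hj
      have h3 := h1 j (by omega)
      -- The square of `x` kills the class of `φ`, and multiplication by `x` is injective on
      -- classes, so it is cancelled twice.
      exact isCobound_of_smul hdd hreg.1 h3 φ (isCobound_of_smul hdd hreg.1 h3 _ h2)

/-! ### Resolutions: homotopies and comparison maps -/

/-- On a projective resolution, a scalar that vanishes on `H₀` is null-homotopic. -/
theorem isNullHomotopic_of_exact [∀ j, Module.Projective R (C j)]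
    (hex : ∀ j, Function.Exact (d (j + 1)) (d j)) {r : R} (hr : ∀ y, ∃ x, d 0 x = r • y) :
    IsNullHomotopic d r := by
  obtain ⟨h₀, hh₀⟩ := exists_lift_of_range_le (d 0) (LinearMap.lsmul R (C 0) r) hr
  -- The invariant `d h d = r d` says that `r - h d` takes values in the cycles, so exactness
  -- permits the next lift.
  obtain ⟨s, hs0, hs⟩ := exists_seq_of_forall_exists
    (α := fun j => {h : C j →ₗ[R] C (j + 1) // ∀ y, d j (h (d j y)) = r • d j y})
    (fun j h h' => ∀ y, d (j + 1) (h'.1 y) + h.1 (d j y) = r • y)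
    ⟨h₀, fun y => hh₀ _⟩ (by
      rintro j ⟨h, hh⟩
      obtain ⟨h', hh'⟩ := exists_lift_of_range_le (d (j + 1))
        (LinearMap.lsmul R (C (j + 1)) r - h ∘ₗ d j) (fun y => (hex j _).1 (by
          rw [LinearMap.sub_apply, map_sub, LinearMap.lsmul_apply, map_smul, LinearMap.comp_apply,
            hh, sub_self]))
      have hh'' : ∀ y, d (j + 1) (h' y) + h (d j y) = r • y := fun y => by
        rw [hh', LinearMap.sub_apply, LinearMap.comp_apply, sub_add_cancel, LinearMap.lsmul_apply]
      refine ⟨⟨h', fun y => ?_⟩, hh''⟩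
      have := hh'' (d (j + 1) y)
      rwa [(hex j).apply_apply_eq_zero, map_zero, add_zero] at this)
  exact ⟨fun j => (s j).1, fun y => by beta_reduce; rw [hs0]; exact hh₀ y, hs⟩

theorem exists_comparison {K : ℕ → Type u} [∀ j, AddCommGroup (K j)] [∀ j, Module R (K j)]
    [∀ j, Module.Projective R (K j)] {dK : ∀ j, K (j + 1) →ₗ[R] K j}
    (hK : ∀ j x, dK j (dK (j + 1) x) = 0) (hex : ∀ j, Function.Exact (d (j + 1)) (d j))
    (c₀ : K 0 →ₗ[R] C 0) (h₀ : ∀ x, ∃ y, d 0 y = c₀ (dK 0 x)) :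
    ∃ c : ∀ j, K j →ₗ[R] C j, c 0 = c₀ ∧ ∀ j x, d j (c (j + 1) x) = c j (dK j x) := by
  obtain ⟨s, hs0, hs⟩ := exists_seq_of_forall_exists
    (α := fun j => {c : K j →ₗ[R] C j // ∀ x, ∃ y, d j y = c (dK j x)})
    (fun j c c' => ∀ x, d j (c'.1 x) = c.1 (dK j x)) ⟨c₀, h₀⟩ (by
      rintro j ⟨c, hc⟩
      obtain ⟨c', hc'⟩ := exists_lift_of_range_le (d j) (c ∘ₗ dK j) hc
      refine ⟨⟨c', fun x => (hex j _).1 ?_⟩, hc'⟩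
      rw [hc', LinearMap.comp_apply, hK, map_zero])
  exact ⟨fun j => (s j).1, congrArg Subtype.val hs0, hs⟩

end HomComplex

/-! ### Null-homotopies on a mapping cone -/

section MappingCone

variable {R : Type u} [CommRing R] {C K : ℕ → Type u} [∀ j, AddCommGroup (C j)]
  [∀ j, Module R (C j)] [∀ j, AddCommGroup (K j)] [∀ j, Module R (K j)]
  (d : ∀ j, C (j + 1) →ₗ[R] C j) (dK : ∀ j, K (j + 1) →ₗ[R] K j) (c : ∀ j, K (j + 1) →ₗ[R] C j)

/-- The differential `(a, b) ↦ (d a + c b, - d b)` of a mapping cone; here `K` is the source of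
the chain map, shifted by one. -/
def mappingConeD (j : ℕ) : C (j + 1) × K (j + 1) →ₗ[R] C j × K j :=
  ((d j).coprod (c j)).prod (-(dK j ∘ₗ LinearMap.snd R _ _))

variable {d dK c}

theorem mappingConeD_apply (j : ℕ) (x : C (j + 1) × K (j + 1)) :
    mappingConeD d dK c j x = (d j x.1 + c j x.2, - dK j x.2) := rfl

theorem mappingConeD_mappingConeD (hd : ∀ j x, d j (d (j + 1) x) = 0)
    (hK : ∀ j x, dK j (dK (j + 1) x) = 0) (hc : ∀ j x, d j (c (j + 1) x) = c j (dK (j + 1) x))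
    (j : ℕ) (x : C (j + 2) × K (j + 2)) :
    mappingConeD d dK c j (mappingConeD d dK c (j + 1) x) = 0 := by
  simp [mappingConeD_apply, hd, hK, hc]

/-- The homotopies `h` on `C` and `k` on `K` need not be compatible with `c`; the defect `w = h c -
c k` anticommutes with the differentials. After one more multiplication by `r` it is removed by the
homotopy `h w`. This is why `r * r` appears in place of `r`. -/
theorem isNullHomotopic_mappingConeD [Subsingleton (K 0)] {r : R}
    (hc : ∀ j x, d j (c (j + 1) x) = c j (dK (j + 1) x)) (hC : IsNullHomotopic d r)
    (hK : IsNullHomotopic dK r) :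
    IsNullHomotopic (C := fun j => C j × K j) (mappingConeD d dK c) (r * r) := by
  obtain ⟨h, h0, h1⟩ := hC
  obtain ⟨k, k0, k1⟩ := hK
  -- the defect `h c - c k`, as a map `K_{j+1} → C_{j+1}`
  let w : ∀ j, K (j + 1) →ₗ[R] C (j + 1) := fun j => h j ∘ₗ c j - c (j + 1) ∘ₗ k (j + 1)
  have hw : ∀ j x, w j x = h j (c j x) - c (j + 1) (k (j + 1) x) := fun _ _ => rfl
  have hw0 : ∀ x, d 0 (w 0 x) = 0 := fun x => by
    have := k1 0 x
    rw [Subsingleton.elim (dK 0 x) 0, map_zero, add_zero] at this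
    rw [hw, map_sub, h0, hc, this, map_smul, sub_self]
  have hw1 : ∀ j x, d (j + 1) (w (j + 1) x) = - w j (dK (j + 1) x) := fun j x => by
    have e1 := h1 j (c (j + 1) x)
    have e2 := congrArg (c (j + 1)) (k1 (j + 1) x)
    rw [hc] at e1
    rw [map_add, map_smul] at e2
    rw [hw, hw, map_sub, hc, eq_sub_of_add_eq e1, eq_sub_of_add_eq e2]
    abel
  let H : ∀ j, C j × K j →ₗ[R] C (j + 1) × K (j + 1)
    | 0 => ((r • h 0) ∘ₗ LinearMap.fst R _ _).prod 0
    | j + 1 => ((r • h (j + 1)).coprod (-(h (j + 1) ∘ₗ w j))).prod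
      (-((r • k (j + 1)) ∘ₗ LinearMap.snd R _ _))
  have hH0 : ∀ x, H 0 x = (r • h 0 x.1, 0) := fun _ => rfl
  have hHs : ∀ j x, H (j + 1) x =
      (r • h (j + 1) x.1 + -(h (j + 1) (w j x.2)), -(r • k (j + 1) x.2)) := fun _ _ => rfl
  refine ⟨H, fun y => Prod.ext ?_ (Subsingleton.elim _ _), ?_⟩
  · simp only [hH0, mappingConeD_apply, map_smul, map_zero, h0, add_zero, Prod.smul_fst, mul_smul]
  · rintro (_ | j) ⟨a, b⟩
    · have e1 := h1 0 a
      have e2 := k1 0 b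
      have e3 := h1 0 (w 0 b)
      rw [hw0, map_zero, add_zero] at e3
      rw [Subsingleton.elim (dK 0 b) 0, map_zero, add_zero] at e2
      refine Prod.ext ?_ ?_
      · simp only [hH0, hHs, mappingConeD_apply, map_add, map_smul, map_neg, Prod.fst_add,
          Prod.smul_fst, e3, mul_smul, ← e1, smul_add]
        rw [hw, smul_sub]
        abel
      · simp only [hH0, hHs, mappingConeD_apply, map_smul, map_neg, Prod.snd_add, Prod.smul_snd,
          mul_smul, ← e2, neg_neg, add_zero]
    · have e1 := h1 (j + 1) a
      have e2 := k1 (j + 1) b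
      have e3 := h1 (j + 1) (w (j + 1) b)
      rw [hw1, map_neg, ← eq_sub_iff_add_eq, sub_neg_eq_add] at e3
      refine Prod.ext ?_ ?_
      · simp only [hHs, mappingConeD_apply, map_add, map_smul, map_neg, Prod.fst_add,
          Prod.smul_fst, e3, mul_smul, ← e1, smul_add]
        rw [hw (j + 1), smul_sub]
        abel
      · simp only [hHs, mappingConeD_apply, map_smul, map_neg, Prod.snd_add, Prod.smul_snd,
          mul_smul, ← e2, smul_add, neg_neg, smul_neg]

end MappingCone

/-! ### Self-duality of the Koszul complex -/

section KoszulDuality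

variable {R : Type u} [CommRing R] {n : ℕ}

/-- The graded Leibniz rule, by splitting off one vector of `x` at a time. -/
theorem contractLeft_mul_of_mem (θ : Module.Dual R (Fin n → R)) (a : ℕ)
    (x y : ExteriorAlgebra R (Fin n → R)) (hx : x ∈ ⋀[R]^a (Fin n → R)) :
    CliffordAlgebra.contractLeft (Q := (0 : QuadraticForm R (Fin n → R))) θ (x * y) =
      CliffordAlgebra.contractLeft (Q := (0 : QuadraticForm R (Fin n → R))) θ x * y +
        (-1 : R) ^ a •
          (x * CliffordAlgebra.contractLeft (Q := (0 : QuadraticForm R (Fin n → R))) θ y) := by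
  induction a generalizing x with
  | zero =>
    rw [ExteriorAlgebra.exteriorPower, pow_zero, Submodule.mem_one] at hx
    obtain ⟨r, rfl⟩ := hx
    have h1 := CliffordAlgebra.contractLeft_algebraMap_mul
      (Q := (0 : QuadraticForm R (Fin n → R))) θ r y
    have h2 := CliffordAlgebra.contractLeft_algebraMap
      (Q := (0 : QuadraticForm R (Fin n → R))) θ r
    refine h1.trans ?_
    erw [h2]
    rw [zero_mul, zero_add, pow_zero, one_smul]
  | succ a ih =>
    rw [ExteriorAlgebra.exteriorPower, pow_succ'] at hx
    induction hx using Submodule.mul_induction_on' with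
    | mem_mul_mem u hu b hb =>
      obtain ⟨v, rfl⟩ := hu
      have h1 := CliffordAlgebra.contractLeft_ι_mul (Q := (0 : QuadraticForm R (Fin n → R))) θ v
      have h2 := ih b hb
      rw [mul_assoc]
      refine (h1 (b * y)).trans ?_
      refine Eq.trans ?_ (congrArg (fun z => z * y + _) (h1 b).symm)
      refine (congrArg (fun z => _ - CliffordAlgebra.ι 0 v * z) h2).trans ?_
      rw [sub_mul, mul_add, smul_mul_assoc, mul_smul_comm, pow_succ, mul_neg, mul_one, neg_smul]
      rw [← mul_assoc, ← mul_assoc, sub_add_eq_sub_sub]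
      exact sub_eq_add_neg _ _
    | add u _ v _ hu hv =>
      rw [add_mul, map_add, map_add, hu, hv, add_mul, add_mul, smul_add]
      abel

/-- The linear form on the exterior algebra picking the coefficient of `e₁ ∧ ⋯ ∧ eₙ`. -/
noncomputable def volForm (R : Type u) [CommRing R] (n : ℕ) :
    ExteriorAlgebra R (Fin n → R) →ₗ[R] R :=
  (Pi.basisFun R (Fin n)).ExteriorAlgebra.coord Finset.univ

/-- The pairing `(x, y) ↦ vol (x ∧ y)`. -/
noncomputable def wedgePairing (R : Type u) [CommRing R] (n a b : ℕ) :
    (⋀[R]^a (Fin n → R)) →ₗ[R] Module.Dual R (⋀[R]^b (Fin n → R)) :=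
  ((LinearMap.mul R (ExteriorAlgebra R (Fin n → R))).compr₂ (volForm R n)).domRestrict₁₂ _ _

theorem wedgePairing_apply (a b : ℕ) (x : ⋀[R]^a (Fin n → R)) (y : ⋀[R]^b (Fin n → R)) :
    wedgePairing R n a b x y = volForm R n (x.1 * y.1) := rfl

theorem subsingleton_exteriorPower {m : ℕ} (h : n < m) : Subsingleton (⋀[R]^m (Fin n → R)) := by
  have : IsEmpty (Set.powersetCard (Fin n) m) := ⟨fun s => by
    have h1 := Finset.card_le_univ s.1
    rw [s.2, Fintype.card_fin] at h1
    omega⟩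
  exact ((Pi.basisFun R (Fin n)).exteriorPower m).repr.toEquiv.subsingleton

/-- The product `x ∧ y` has degree `n + 1`, so it vanishes, and the Leibniz rule becomes adjointness
up to sign. -/
theorem wedgePairing_contr (θ : Module.Dual R (Fin n → R)) (a b : ℕ) (h : a + 1 + b = n)
    (x : ⋀[R]^(a + 1) (Fin n → R)) (y : ⋀[R]^(b + 1) (Fin n → R)) :
    wedgePairing R n a (b + 1) (contr θ a x) y =
      (-1 : R) ^ a * wedgePairing R n (a + 1) b x (contr θ b y) := by
  have h1 := contractLeft_mul_of_mem θ (a + 1) x.1 y.1 x.2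
  have h2 : x.1 * y.1 = 0 := by
    have h3 : x.1 * y.1 ∈ ⋀[R]^(a + 1 + (b + 1)) (Fin n → R) := by
      rw [ExteriorAlgebra.exteriorPower, pow_add]
      exact Submodule.mul_mem_mul x.2 y.2
    have := subsingleton_exteriorPower (R := R) (show n < a + 1 + (b + 1) by omega)
    exact congrArg Subtype.val (Subsingleton.elim (⟨_, h3⟩ : ⋀[R]^(a + 1 + (b + 1)) (Fin n → R)) 0)
  rw [h2, map_zero] at h1
  have h4 := congrArg (volForm R n) h1
  rw [map_zero, map_add, map_smul, pow_succ, mul_neg, mul_one, neg_smul, ← sub_eq_add_neg] at h4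
  exact (sub_eq_zero.1 h4.symm)

/-- On standard bases, `e_S ∧ e_T` is `± e₁ ∧ ⋯ ∧ eₙ` if `T` is the complement of `S`, and has no
such component otherwise. The pairing thus carries a basis to the dual basis, up to reindexing and
signs. -/
theorem wedgePairing_bijective (a b : ℕ) (h : a + b = n) :
    Function.Bijective (wedgePairing R n a b) := by
  let v := Pi.basisFun R (Fin n)
  let vA := v.exteriorPower a
  let vB := v.exteriorPower b
  have hc : b + a = Fintype.card (Fin n) := by rw [Fintype.card_fin, ← h, add_comm]
  have key : ∀ S, ∃ ε : Rˣ, wedgePairing R n a b (vA S) =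
      ε • vB.coord (Set.powersetCard.compl hc S) := by
    intro S
    have hd : Disjoint S.1 (Set.powersetCard.compl hc S).1 := by
      rw [Set.powersetCard.coe_compl]
      exact disjoint_compl_right
    refine ⟨Units.map (Int.castRingHom R : ℤ →* R) (Set.powersetCard.permOfDisjoint hd).sign,
      vB.ext fun T => ?_⟩
    rw [wedgePairing_apply, ← ExteriorAlgebra.basis_eq_coe_basis,
      ← ExteriorAlgebra.basis_eq_coe_basis, LinearMap.smul_apply, Module.Basis.coord_apply,
      Module.Basis.repr_self]
    by_cases hT : T = Set.powersetCard.compl hc S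
    · subst hT
      have hu : ((Set.powersetCard.disjUnion hd : Set.powersetCard (Fin n) (a + b)) :
          Finset (Fin n)) = Finset.univ := by
        rw [Set.powersetCard.coe_disjUnion]
        refine Finset.eq_univ_of_card _ ?_
        rw [Finset.card_disjUnion, S.2, (Set.powersetCard.compl hc S).2, Fintype.card_fin, h]
      rw [ExteriorAlgebra.basis_mul_of_disjoint _ _ _ hd, hu, Finsupp.single_eq_same, volForm,
        Units.smul_def, Units.smul_def, map_zsmul, Module.Basis.coord_apply,
        Module.Basis.repr_self, Finsupp.single_eq_same]
      simp
    · have hd' : ¬ Disjoint S.1 T.1 := by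
        intro hST
        refine hT (Subtype.ext (Finset.eq_of_subset_of_card_le ?_ ?_))
        · rw [Set.powersetCard.coe_compl]
          exact fun x hx => Finset.mem_compl.2 fun hx' => Finset.disjoint_left.1 hST hx' hx
        · rw [T.2, (Set.powersetCard.compl hc S).2]
      rw [ExteriorAlgebra.basis_mul_of_not_disjoint _ _ _ hd', map_zero,
        Finsupp.single_eq_of_ne (Ne.symm hT), smul_zero]
  choose ε hε using key
  let w := (vB.dualBasis.reindex (Set.powersetCard.compl hc).symm).unitsSMul ε
  have hw : wedgePairing R n a b = (vA.equiv w (Equiv.refl _)).toLinearMap := by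
    refine vA.ext fun S => ?_
    rw [hε, LinearEquiv.coe_coe, Module.Basis.equiv_apply]
    simp [w, Module.Basis.unitsSMul_apply]
  rw [hw]
  exact (vA.equiv w (Equiv.refl _)).bijective

/-- The signs that make the Koszul complex isomorphic to its dual. -/
def dualSign : ℕ → ℤˣ
  | 0 => 1
  | a + 1 => - (-1) ^ a * dualSign a

/-- The isomorphism `⋀ᵃ Rⁿ ≃ (⋀ᵇ Rⁿ)*` for `a + b = n`. -/
noncomputable def wedgeDual (R : Type u) [CommRing R] {n : ℕ} (a b : ℕ) (h : a + b = n) :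
    (⋀[R]^a (Fin n → R)) ≃ₗ[R] Module.Dual R (⋀[R]^b (Fin n → R)) :=
  LinearEquiv.ofBijective (wedgePairing R n a b) (wedgePairing_bijective a b h) ≪≫ₗ
    LinearEquiv.smulOfUnit (Units.map (Int.castRingHom R : ℤ →* R) (dualSign a))

theorem wedgeDual_apply (a b : ℕ) (h : a + b = n) (x : ⋀[R]^a (Fin n → R))
    (y : ⋀[R]^b (Fin n → R)) :
    wedgeDual R a b h x y = ((dualSign a : ℤ) : R) * wedgePairing R n a b x y := rfl

theorem wedgeDual_koszulD (f : Fin n → R) (a b : ℕ) (h : a + 1 + b = n)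
    (h' : a + (b + 1) = n) (x : ⋀[R]^(a + 1) (Fin n → R)) (y : ⋀[R]^(b + 1) (Fin n → R)) :
    wedgeDual R a (b + 1) h' (koszulD f a x) y =
      - wedgeDual R (a + 1) b h x (koszulD f b y) := by
  rw [wedgeDual_apply, wedgeDual_apply, koszulD, wedgePairing_contr _ a b h, dualSign]
  push_cast
  rw [koszulD]
  ring

/-- Left multiplication by a vector, as a map `⋀ʲ Rⁿ → ⋀ʲ⁺¹ Rⁿ`. -/
noncomputable def wedgeLeft (v : Fin n → R) (j : ℕ) :
    (⋀[R]^j (Fin n → R)) →ₗ[R] ⋀[R]^(j + 1) (Fin n → R) :=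
  (LinearMap.mulLeft R (ExteriorAlgebra.ι R v)).restrict fun x hx => by
    rw [ExteriorAlgebra.exteriorPower, pow_succ']
    exact Submodule.mul_mem_mul ⟨v, rfl⟩ hx

theorem contr_wedgeLeft_zero (θ : Module.Dual R (Fin n → R)) (v : Fin n → R)
    (x : ⋀[R]^0 (Fin n → R)) : contr θ 0 (wedgeLeft v 0 x) = θ v • x := by
  refine Subtype.ext ?_
  have h1 := CliffordAlgebra.contractLeft_ι_mul (Q := (0 : QuadraticForm R (Fin n → R))) θ v x.1
  obtain ⟨x, hx⟩ := x
  rw [ExteriorAlgebra.exteriorPower, pow_zero, Submodule.mem_one] at hx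
  obtain ⟨r, rfl⟩ := hx
  have h2 := CliffordAlgebra.contractLeft_algebraMap (Q := (0 : QuadraticForm R (Fin n → R))) θ r
  refine (h1.trans (congrArg (fun z => _ - CliffordAlgebra.ι 0 v * z) h2)).trans ?_
  rw [mul_zero, sub_zero]
  rfl

theorem contr_wedgeLeft (θ : Module.Dual R (Fin n → R)) (v : Fin n → R) (j : ℕ)
    (x : ⋀[R]^(j + 1) (Fin n → R)) :
    contr θ (j + 1) (wedgeLeft v (j + 1) x) + wedgeLeft v j (contr θ j x) = θ v • x := by
  refine Subtype.ext ?_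
  have h1 := CliffordAlgebra.contractLeft_ι_mul (Q := (0 : QuadraticForm R (Fin n → R))) θ v x.1
  exact eq_sub_iff_add_eq.1 h1

/-- For `r = ∑ vᵢ fᵢ`, left multiplication by the vector `v` is a homotopy between `r` and zero. -/
theorem isNullHomotopic_koszulD (f : Fin n → R) {r : R} (hr : r ∈ Ideal.span (Set.range f)) :
    IsNullHomotopic (C := fun j => ⋀[R]^j (Fin n → R)) (koszulD f) r := by
  obtain ⟨v, rfl⟩ := (Ideal.mem_span_range_iff_exists_fun).1 hr
  have hv : seqForm f v = ∑ i, v i * f i := by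
    simp [seqForm, mul_comm]
  refine ⟨wedgeLeft v, fun y => ?_, fun j y => ?_⟩
  · rw [koszulD, contr_wedgeLeft_zero, hv]
  · rw [koszulD, koszulD, contr_wedgeLeft, hv]

/-- The Koszul complex is exact in degrees above `n - g` if the ideal contains a weakly regular
sequence of length `g`. -/
theorem koszulD_exact_of_isWeaklyRegular (f : Fin n → R) {e : ℕ} {rs : List R}
    (hn : n = rs.length + e) (hrs : ∀ r ∈ rs, r ∈ Ideal.span (Set.range f))
    (hreg : RingTheory.Sequence.IsWeaklyRegular R rs) (i : ℕ) (hi : e ≤ i) :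
    Function.Exact (koszulD f (i + 1)) (koszulD f i) := by
  intro z
  refine ⟨fun hz => ?_, ?_⟩
  swap
  · rintro ⟨w, rfl⟩
    exact koszulD_koszulD f i w
  by_cases hin : n < i + 1
  · have := subsingleton_exteriorPower (R := R) hin
    exact ⟨0, Subsingleton.elim _ _⟩
  obtain ⟨b, hb⟩ : ∃ b, i + 1 + b = n := ⟨n - (i + 1), by omega⟩
  -- Self-duality turns the cycle `z ∈ K_{i+1}` into a cocycle of `Hom(K, R)` in degree `b = n - i -
  -- 1`, which is below the length of `rs` because `e ≤ i`.
  have key := homExactAt_of_isWeaklyRegular (C := fun j => ⋀[R]^j (Fin n → R))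
    (d := koszulD f) (koszulD_koszulD f) (s := 0) (fun _ _ _ _ h => absurd h (by omega)) rs
    (fun r hr => (isNullHomotopic_koszulD f (hrs r hr)).mul r) R hreg b (by omega)
    (wedgeDual R (i + 1) b hb z) (LinearMap.ext fun y => by
      have := wedgeDual_koszulD f i b hb (by omega) z y
      rw [hz, map_zero, LinearMap.zero_apply] at this
      exact neg_eq_zero.1 this.symm)
  cases b with
  | zero =>
    have h0 : wedgeDual R (i + 1) 0 hb z = 0 := key
    rw [LinearEquiv.map_eq_zero_iff] at h0
    exact ⟨0, by rw [map_zero, h0]⟩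
  | succ b =>
    obtain ⟨ψ, hψ⟩ := key
    refine ⟨-(wedgeDual R (i + 2) b (by omega)).symm ψ, ?_⟩
    apply (wedgeDual R (i + 1) (b + 1) hb).injective
    refine LinearMap.ext fun y => ?_
    rw [map_neg, map_neg, LinearMap.neg_apply, wedgeDual_koszulD f (i + 1) b (by omega),
      LinearEquiv.apply_symm_apply, neg_neg, hψ]
    rfl

end KoszulDuality

/-! ### Extension of linear forms along mapping cones -/

section MappingConeExtension

variable {R : Type u} [CommRing R] {C K : ℕ → Type u} [∀ j, AddCommGroup (C j)]
  [∀ j, Module R (C j)] [∀ j, AddCommGroup (K j)] [∀ j, Module R (K j)]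
  {d : ∀ j, C (j + 1) →ₗ[R] C j} {dK : ∀ j, K (j + 1) →ₗ[R] K j}
  {c : ∀ j, K (j + 1) →ₗ[R] C j}

/-- The condition on `β` forces `ψ = β c₀⁻¹`. Every `x` differs from some `c₁ y` by a boundary, on
which `α` vanishes, and on `c₁ y` the required identity is `hαβ`. -/
theorem exists_extension_zero (hex : ∀ j, Function.Exact (d (j + 1)) (d j))
    (hc : ∀ j x, d j (c (j + 1) x) = c j (dK (j + 1) x)) (hc₀ : Function.Bijective (c 0))
    (hr : ∀ x, ∃ y, c 0 (dK 1 y) = d 0 x) {M : Type u} [AddCommGroup M] [Module R M]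
    (α : C 1 →ₗ[R] M) (β : K 1 →ₗ[R] M) (hα : ∀ x, α (d 1 x) = 0)
    (hαβ : ∀ x, α (c 1 x) = β (dK 1 x)) :
    ∃ ψ : C 0 →ₗ[R] M, (∀ x, α x = ψ (d 0 x)) ∧ ∀ x, β x = ψ (c 0 x) := by
  let e := LinearEquiv.ofBijective (c 0) hc₀
  have he : ∀ x, e.symm (c 0 x) = x := fun x => e.symm_apply_apply x
  refine ⟨β ∘ₗ e.symm.toLinearMap, fun x => ?_, fun x => congrArg β (he x).symm⟩
  obtain ⟨y, hy⟩ := hr x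
  obtain ⟨z, hz⟩ := (hex 0 (x - c 1 y)).1 (by rw [map_sub, hc, hy, sub_self])
  have h1 := hα z
  rw [hz, map_sub, sub_eq_zero, hαβ] at h1
  rw [h1, ← hy]
  exact congrArg β (he _).symm

/-- The pair `(α, β)` is a cocycle of degree `j + 2` on the mapping cone. In degrees `0` and `1`
cocycles are coboundaries for every coefficient module, so the range `2 + rs.length` is reached. The
minus sign before `β'` is that of the cone differential. -/
theorem exists_extension_succ [∀ j, Module.Projective R (C j)] [∀ j, Module.Projective R (K j)]
    [Subsingleton (K 0)]
    (hex : ∀ j, Function.Exact (d (j + 1)) (d j)) (hK : ∀ j x, dK j (dK (j + 1) x) = 0)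
    (hc : ∀ j x, d j (c (j + 1) x) = c j (dK (j + 1) x)) (hc₀ : Function.Bijective (c 0))
    (hr : ∀ x, ∃ y, c 0 (dK 1 y) = d 0 x) {rs : List R} (hrs : ∀ r ∈ rs, IsNullHomotopic d r)
    (hrs' : ∀ r ∈ rs, IsNullHomotopic dK r) {M : Type u} [AddCommGroup M] [Module R M]
    (hreg : RingTheory.Sequence.IsWeaklyRegular M rs) {j : ℕ} (hj : j < rs.length)
    (α : C (j + 2) →ₗ[R] M) (β : K (j + 2) →ₗ[R] M) (hα : ∀ x, α (d (j + 2) x) = 0)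
    (hαβ : ∀ x, α (c (j + 2) x) = β (dK (j + 2) x)) :
    ∃ (α' : C (j + 1) →ₗ[R] M) (β' : K (j + 1) →ₗ[R] M), (∀ x, α x = α' (d (j + 1) x)) ∧
      ∀ x, β x = α' (c (j + 1) x) - β' (dK (j + 1) x) := by
  have hd : ∀ j x, d j (d (j + 1) x) = 0 := fun j => (hex j).apply_apply_eq_zero
  have hinl : ∀ j x, mappingConeD d dK c j (x, 0) = (d j x, 0) := by simp [mappingConeD_apply]
  have hinr : ∀ j x, mappingConeD d dK c j (0, x) = (c j x, - dK j x) := by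
    simp [mappingConeD_apply]
  have hsplit : ∀ {j} (L : Type u) [AddCommGroup L] [Module R L] (φ : C j × K j →ₗ[R] L) x y,
      φ (x, y) = φ (x, 0) + φ (0, y) := fun L _ _ φ x y => by
    rw [← map_add, Prod.mk_add_mk, add_zero, zero_add]
  have hneg : ∀ {j} (L : Type u) [AddCommGroup L] [Module R L] (φ : C j × K j →ₗ[R] L) y,
      φ (0, - y) = - φ (0, y) := fun L _ _ φ y => by
    rw [← map_neg, Prod.neg_mk, neg_zero]
  obtain ⟨ψ, hψ⟩ := homExactAt_of_isWeaklyRegular (C := fun j => C j × K j)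
    (d := mappingConeD d dK c) (s := 2) (mappingConeD_mappingConeD hd hK hc) (by
      intro M _ _ j hj φ hφ
      have hφ' : ∀ x, φ (mappingConeD d dK c j x) = 0 := LinearMap.congr_fun hφ
      match j, hj with
      | 0, _ =>
        refine LinearMap.ext fun ⟨x, y⟩ => ?_
        obtain ⟨z, rfl⟩ := hc₀.surjective x
        have h1 := hφ' (0, z)
        rw [hinr, Subsingleton.elim (- dK 0 z) y] at h1
        exact h1
      | 1, _ =>
        obtain ⟨ψ, hψ, hψ'⟩ := exists_extension_zero hex hc hc₀ hr
          (φ ∘ₗ LinearMap.inl R (C 1) (K 1)) (φ ∘ₗ LinearMap.inr R (C 1) (K 1))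
          (fun x => by
            have h1 := hφ' (x, 0)
            rw [hinl] at h1
            exact h1)
          (fun x => by
            have h1 := hφ' (0, x)
            rw [hinr, hsplit, hneg, ← sub_eq_add_neg, sub_eq_zero] at h1
            exact h1)
        refine ⟨ψ ∘ₗ LinearMap.fst R _ _, LinearMap.ext fun ⟨x, y⟩ => ?_⟩
        rw [hsplit]
        refine (congrArg₂ (· + ·) (hψ x) (hψ' y)).trans ?_
        rw [← map_add]
        rfl)
    rs (fun r hr => isNullHomotopic_mappingConeD hc (hrs r hr) (hrs' r hr)) M hreg (j + 2)
    (by omega) (α.coprod β) (LinearMap.ext fun ⟨x, y⟩ => by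
      rw [LinearMap.comp_apply, mappingConeD_apply, LinearMap.coprod_apply, map_add, hα, zero_add,
        map_neg, LinearMap.zero_apply, ← sub_eq_add_neg, sub_eq_zero]
      exact hαβ y)
  have hψ' := LinearMap.congr_fun hψ
  refine ⟨ψ ∘ₗ LinearMap.inl R (C (j + 1)) (K (j + 1)),
    ψ ∘ₗ LinearMap.inr R (C (j + 1)) (K (j + 1)), fun x => ?_, fun x => ?_⟩
  · have h1 := hψ' (x, 0)
    rw [LinearMap.coprod_apply, LinearMap.comp_apply, hinl, map_zero, add_zero] at h1
    exact h1
  · have h1 := hψ' (0, x)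
    rw [LinearMap.coprod_apply, LinearMap.comp_apply, hinr, map_zero, zero_add, hsplit, hneg,
      ← sub_eq_add_neg] at h1
    exact h1

end MappingConeExtension

/-! ### Comparing the Koszul complex with a resolution -/

section ShiftedKoszul

variable {R : Type u} [CommRing R] {n : ℕ}

variable (R n) in
/-- The sequence of modules `0, K₀, K₁, …`. -/
def ShiftedK : ℕ → Type u
  | 0 => PUnit
  | j + 1 => ⋀[R]^j (Fin n → R)

instance : ∀ j, AddCommGroup (ShiftedK R n j)
  | 0 => inferInstanceAs (AddCommGroup PUnit.{u + 1})
  | j + 1 => inferInstanceAs (AddCommGroup (⋀[R]^j (Fin n → R)))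

instance : ∀ j, Module R (ShiftedK R n j)
  | 0 => inferInstanceAs (Module R PUnit.{u + 1})
  | j + 1 => inferInstanceAs (Module R (⋀[R]^j (Fin n → R)))

instance : ∀ j, Module.Projective R (ShiftedK R n j)
  | 0 => inferInstanceAs (Module.Projective R PUnit.{u + 1})
  | j + 1 => inferInstanceAs (Module.Projective R (⋀[R]^j (Fin n → R)))

instance : Subsingleton (ShiftedK R n 0) := inferInstanceAs (Subsingleton PUnit.{u + 1})

/-- The differential of the shifted Koszul complex. -/
noncomputable def shiftedKoszulD (f : Fin n → R) :
    ∀ j, ShiftedK R n (j + 1) →ₗ[R] ShiftedK R n j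
  | 0 => 0
  | j + 1 => koszulD f j

theorem shiftedKoszulD_shiftedKoszulD (f : Fin n → R) :
    ∀ j x, shiftedKoszulD f j (shiftedKoszulD f (j + 1) x) = 0
  | 0, _ => rfl
  | j + 1, x => koszulD_koszulD f j x

theorem isNullHomotopic_shiftedKoszulD (f : Fin n → R) {r : R}
    (hr : r ∈ Ideal.span (Set.range f)) : IsNullHomotopic (shiftedKoszulD f) r := by
  obtain ⟨h, h0, h1⟩ := isNullHomotopic_koszulD f hr
  refine ⟨fun | 0 => 0 | j + 1 => h j, fun y => Subsingleton.elim _ _, ?_⟩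
  rintro (_ | j) y
  · exact (congrArg (· + (0 : ShiftedK R n 1)) (h0 y)).trans (add_zero _)
  · exact h1 j y

namespace QuotRes

variable {f : Fin n → R} (F : QuotRes f)

theorem isNullHomotopic_d {r : R} (hr : r ∈ Ideal.span (Set.range f)) :
    IsNullHomotopic F.d r := by
  have := F.free
  refine isNullHomotopic_of_exact F.exact fun y => ?_
  obtain ⟨v, rfl⟩ := (Ideal.mem_span_range_iff_exists_fun).1 hr
  refine ⟨F.e₁.symm (F.e₀ y • v), F.e₀.injective ?_⟩
  rw [F.e₀_d, LinearEquiv.apply_symm_apply, map_smul, smul_eq_mul, Finset.sum_mul]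
  refine Finset.sum_congr rfl fun j _ => ?_
  rw [Pi.smul_apply, smul_eq_mul]
  ring

/-- A chain map from the Koszul complex to `F_•` that is bijective in degree `0`. -/
structure KoszulComparison where
  c : ∀ j, (⋀[R]^j (Fin n → R)) →ₗ[R] F.F j
  bijective_zero : Function.Bijective (c 0)
  exists_eq_d : ∀ x, ∃ y, c 0 (koszulD f 0 y) = F.d 0 x
  comm : ∀ j x, F.d j (c (j + 1) x) = c j (koszulD f j x)

theorem nonempty_koszulComparison : Nonempty F.KoszulComparison := by
  let e := exteriorPower.zeroEquiv R (Fin n → R) ≪≫ₗ F.e₀.symm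
  have he : ∀ x, e (koszulD f 0 (F.toK x)) = F.d 0 x := fun x => by
    rw [LinearEquiv.trans_apply, zeroEquiv_koszulD_toK, LinearEquiv.symm_apply_apply]
  obtain ⟨c, hc₀, hc⟩ := exists_comparison (K := fun j => ⋀[R]^j (Fin n → R)) (dK := koszulD f)
    (koszulD_koszulD f) F.exact e.toLinearMap (fun x => by
      obtain ⟨y, rfl⟩ := F.toK.surjective x
      exact ⟨y, (he y).symm⟩)
  refine ⟨c, ?_, fun x => ⟨F.toK x, ?_⟩, hc⟩
  · rw [hc₀]
    exact e.bijective
  · rw [hc₀]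
    exact he x

namespace KoszulComparison

variable {F} (κ : F.KoszulComparison)

theorem exists_extension_zero (α : F.F 1 →ₗ[R] R)
    (β : (⋀[R]^0 (Fin n → R)) →ₗ[R] R) (hα : ∀ x, α (F.d 1 x) = 0)
    (hαβ : ∀ x, α (κ.c 1 x) = β (koszulD f 0 x)) :
    ∃ ψ : F.F 0 →ₗ[R] R, (∀ x, α x = ψ (F.d 0 x)) ∧ ∀ x, β x = ψ (κ.c 0 x) :=
  _root_.exists_extension_zero (K := ShiftedK R n) (dK := shiftedKoszulD f) F.exact κ.comm
    κ.bijective_zero κ.exists_eq_d α β hα hαβ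

theorem exists_extension_succ {rs : List R} (hrs : ∀ r ∈ rs, r ∈ Ideal.span (Set.range f))
    (hreg : RingTheory.Sequence.IsWeaklyRegular R rs) {j : ℕ} (hj : j < rs.length)
    (α : F.F (j + 2) →ₗ[R] R) (β : (⋀[R]^(j + 1) (Fin n → R)) →ₗ[R] R)
    (hα : ∀ x, α (F.d (j + 2) x) = 0)
    (hαβ : ∀ x, α (κ.c (j + 2) x) = β (koszulD f (j + 1) x)) :
    ∃ (α' : F.F (j + 1) →ₗ[R] R) (β' : (⋀[R]^j (Fin n → R)) →ₗ[R] R),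
      (∀ x, α x = α' (F.d (j + 1) x)) ∧ ∀ x, β x = α' (κ.c (j + 1) x) - β' (koszulD f j x) := by
  have := F.free
  exact _root_.exists_extension_succ (K := ShiftedK R n) (dK := shiftedKoszulD f) F.exact
    (shiftedKoszulD_shiftedKoszulD f) κ.comm κ.bijective_zero κ.exists_eq_d
    (fun r hr => F.isNullHomotopic_d (hrs r hr))
    (fun r hr => isNullHomotopic_shiftedKoszulD f (hrs r hr)) hreg hj α β hα hαβ

end KoszulComparison

end QuotRes

end ShiftedKoszul

/-! ### Gluing the Koszul complex and the dual of the resolution -/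

section DualCone

variable {R : Type u} [CommRing R] {n : ℕ} {f : Fin n → R}

namespace QuotRes

theorem coD_zero (F : QuotRes f) (g i : ℕ) (φ : F.coF g (i + 1)) (h : 0 + i = g) :
    F.coD g i φ ⟨0, h⟩ = 0 := rfl

theorem coD_succ (F : QuotRes f) (g i m : ℕ) (φ : F.coF g (i + 1)) (h : m + 1 + i = g) :
    F.coD g i φ ⟨m + 1, h⟩ = φ ⟨m, by omega⟩ ∘ₗ F.d m := rfl

theorem coF_ext (F : QuotRes f) {g i m : ℕ} (h : m + i = g) {φ ψ : F.coF g i}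
    (hφ : φ ⟨m, h⟩ = ψ ⟨m, h⟩) : φ = ψ := by
  funext ⟨k, hk⟩
  obtain rfl : k = m := by omega
  exact hφ

/-- The index set has one element, but equal to `m` only propositionally, whence the cast. -/
theorem exists_coF_eq (F : QuotRes f) {g i m : ℕ} (h : m + i = g) (α : F.F m →ₗ[R] R) :
    ∃ φ : F.coF g i, φ ⟨m, h⟩ = α :=
  ⟨fun k => α ∘ₗ (LinearEquiv.cast (R := R) (M := F.F) (show k.1 = m by omega)).toLinearMap,
    LinearMap.ext fun _ => rfl⟩

theorem subsingleton_coF (F : QuotRes f) {g i : ℕ} (h : g < i) : Subsingleton (F.coF g i) := by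
  have : IsEmpty {m : ℕ // m + i = g} := ⟨fun m => by omega⟩
  infer_instance

namespace KoszulComparison

variable {F : QuotRes f} (κ : F.KoszulComparison) {g : ℕ}

/-- The map `F*_{g-i} → K*_{g-i} = K_{i+2}` dual to the comparison map. -/
noncomputable def toKoszul (hn : n = g + 2) (i : ℕ) :
    F.coF g i →ₗ[R] ⋀[R]^(i + 2) (Fin n → R) :=
  if h : i ≤ g then
    (wedgeDual R (i + 2) (g - i) (by omega)).symm.toLinearMap ∘ₗ
      (κ.c (g - i)).dualMap ∘ₗ
      LinearMap.proj (φ := fun m : {m : ℕ // m + i = g} => Module.Dual R (F.F m.1)) ⟨g - i, by omega⟩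
  else 0

theorem wedgeDual_toKoszul (hn : n = g + 2) {i m : ℕ} (h : m + i = g) (h' : i + 2 + m = n) (φ : F.coF g i) :
    wedgeDual R (i + 2) m h' (κ.toKoszul hn i φ) = φ ⟨m, h⟩ ∘ₗ κ.c m := by
  obtain rfl : m = g - i := by omega
  rw [toKoszul, dif_pos (by omega)]
  exact LinearEquiv.apply_symm_apply _ _

/-- The comparison map commutes with the differentials while `wedgeDual` anticommutes with them. The
resulting sign is the one for which `dualConeD` squares to zero without further signs. -/
theorem koszulD_toKoszul (hn : n = g + 2) (i : ℕ) (φ : F.coF g (i + 1)) :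
    koszulD f (i + 2) (κ.toKoszul hn (i + 1) φ) = - κ.toKoszul hn i (F.coD g i φ) := by
  by_cases hi : g < i
  · have := subsingleton_exteriorPower (R := R) (show n < i + 2 by omega)
    exact Subsingleton.elim _ _
  obtain ⟨m, hm⟩ : ∃ m, m + i = g := ⟨g - i, by omega⟩
  apply (wedgeDual R (i + 2) m (by omega)).injective
  rw [map_neg, κ.wedgeDual_toKoszul hn hm]
  cases m with
  | zero =>
    have := subsingleton_exteriorPower (R := R) (show n < i + 1 + 2 by omega)
    rw [Subsingleton.elim (κ.toKoszul hn (i + 1) φ) 0, map_zero, map_zero, coD_zero,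
      LinearMap.zero_comp, neg_zero]
  | succ m =>
    refine LinearMap.ext fun y => ?_
    rw [wedgeDual_koszulD f (i + 2) m (by omega), LinearMap.neg_apply, coD_succ,
      κ.wedgeDual_toKoszul hn (by omega)]
    refine congrArg Neg.neg ?_
    exact congrArg (φ ⟨m, by omega⟩) (κ.comm m y).symm

/-- The differential of the cone of `F*_{g-•} → K_{•+2}`. -/
noncomputable def dualConeD (hn : n = g + 2) (i : ℕ) :
    (⋀[R]^(i + 4) (Fin n → R)) × F.coF g (i + 1) →ₗ[R]
      (⋀[R]^(i + 3) (Fin n → R)) × F.coF g i :=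
  ((koszulD f (i + 3)).coprod (κ.toKoszul hn (i + 1))).prod (F.coD g i ∘ₗ LinearMap.snd R _ _)

/-- The last map of the cone of `F*_{g-•} → K_{•+2}`. -/
noncomputable def dualConeAug (hn : n = g + 2) :
    (⋀[R]^3 (Fin n → R)) × F.coF g 0 →ₗ[R] ⋀[R]^2 (Fin n → R) :=
  (koszulD f 2).coprod (κ.toKoszul hn 0)

theorem coD_coD (F : QuotRes f) (g i : ℕ) (φ : F.coF g (i + 2)) :
    F.coD g i (F.coD g (i + 1) φ) = 0 := by
  funext ⟨m, h⟩
  match m, h with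
  | 0, _ => rfl
  | 1, h =>
    refine LinearMap.ext fun x => ?_
    rw [coD_succ, coD_zero]
    rfl
  | m + 2, h =>
    refine LinearMap.ext fun x => ?_
    rw [coD_succ, coD_succ, LinearMap.comp_apply, LinearMap.comp_apply,
      (F.exact m).apply_apply_eq_zero, map_zero]
    rfl

/-- Under `K_{i+3} = (K_{m-1})*` the pair `(k, φ)` is a cocycle of degree `m = g - i` on the cone of
`K_• → F_•`. Separating the condition `φ ∘ d = 0` lets the same lemma serve at the augmentation. -/
theorem exists_dualConeD_eq (hn : n = g + 2) {rs : List R} (hrs : ∀ r ∈ rs, r ∈ Ideal.span (Set.range f))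
    (hreg : RingTheory.Sequence.IsWeaklyRegular R rs) (hlen : rs.length = g) {i m : ℕ}
    (h : m + i = g) (k : ⋀[R]^(i + 3) (Fin n → R)) (φ : F.coF g i)
    (hφ : ∀ x, φ ⟨m, h⟩ (F.d m x) = 0) (hk : koszulD f (i + 2) k + κ.toKoszul hn i φ = 0) :
    ∃ x, κ.dualConeD hn i x = (k, φ) := by
  have hk' := congrArg (wedgeDual R (i + 2) m (by omega)) hk
  rw [map_add, map_zero, κ.wedgeDual_toKoszul hn h] at hk'
  match m with
  | 0 =>
    -- Here `i = g`, so `K_{i+3} = 0`, and `φ ∘ c₀ = 0` with `c₀` surjective gives `φ = 0`.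
    have := subsingleton_exteriorPower (R := R) (show n < i + 3 by omega)
    refine ⟨0, ?_⟩
    rw [map_zero]
    refine Prod.ext (Subsingleton.elim _ _) (F.coF_ext h (LinearMap.ext fun x => ?_))
    obtain ⟨y, rfl⟩ := κ.bijective_zero.surjective x
    rw [Subsingleton.elim k 0, map_zero, map_zero, zero_add] at hk'
    exact (LinearMap.congr_fun hk' y).symm
  | 1 =>
    -- Here `K_{i+3}` is the top exterior power, dual to `K₀`, and `K_{i+4} = 0`; so the first
    -- component of the witness is zero.
    have hβ : ∀ x, φ ⟨1, h⟩ (κ.c 1 x) = wedgeDual R (i + 3) 0 (by omega) k (koszulD f 0 x) := by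
      intro x
      have h1 := LinearMap.congr_fun hk' x
      rw [LinearMap.add_apply, wedgeDual_koszulD f (i + 2) 0 (by omega)] at h1
      exact (neg_add_eq_zero.1 h1).symm
    obtain ⟨ψ, hψ, hψ'⟩ := κ.exists_extension_zero _ _ hφ hβ
    obtain ⟨φ', hφ'⟩ := F.exists_coF_eq (show 0 + (i + 1) = g by omega) ψ
    refine ⟨(0, φ'), Prod.ext ?_ (F.coF_ext h ?_)⟩
    · apply (wedgeDual R (i + 3) 0 (by omega)).injective
      refine LinearMap.ext fun x => ?_
      rw [hψ' x, dualConeD, LinearMap.prod_apply]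
      change wedgeDual R (i + 3) 0 _ (koszulD f (i + 3) 0 + κ.toKoszul hn (i + 1) φ') x = _
      rw [map_zero, zero_add, κ.wedgeDual_toKoszul hn (show 0 + (i + 1) = g by omega), hφ']
      rfl
    · refine LinearMap.ext fun x => ?_
      change F.coD g i φ' ⟨0 + 1, h⟩ x = _
      rw [coD_succ, hφ']
      exact (hψ x).symm
  | m + 2 =>
    have hβ : ∀ x, φ ⟨m + 2, h⟩ (κ.c (m + 2) x) =
        wedgeDual R (i + 3) (m + 1) (by omega) k (koszulD f (m + 1) x) := by
      intro x
      have h1 := LinearMap.congr_fun hk' x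
      rw [LinearMap.add_apply, wedgeDual_koszulD f (i + 2) (m + 1) (by omega)] at h1
      exact (neg_add_eq_zero.1 h1).symm
    obtain ⟨α', β', hα', hβ'⟩ := κ.exists_extension_succ hrs hreg (by omega) _ _ hφ hβ
    obtain ⟨φ', hφ'⟩ := F.exists_coF_eq (show m + 1 + (i + 1) = g by omega) α'
    refine ⟨((wedgeDual R (i + 4) m (by omega)).symm β', φ'), Prod.ext ?_ (F.coF_ext h ?_)⟩
    · apply (wedgeDual R (i + 3) (m + 1) (by omega)).injective
      refine LinearMap.ext fun x => ?_
      rw [hβ' x, dualConeD, LinearMap.prod_apply]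
      change wedgeDual R (i + 3) (m + 1) _ (koszulD f (i + 3)
        ((wedgeDual R (i + 4) m (by omega)).symm β') + κ.toKoszul hn (i + 1) φ') x = _
      rw [map_add, LinearMap.add_apply, wedgeDual_koszulD f (i + 3) m (by omega),
        LinearEquiv.apply_symm_apply, κ.wedgeDual_toKoszul hn (show m + 1 + (i + 1) = g by omega),
        hφ', neg_add_eq_sub]
      rfl
    · refine LinearMap.ext fun x => ?_
      change F.coD g i φ' ⟨m + 1 + 1, h⟩ x = _
      rw [coD_succ, hφ']
      exact (hα' x).symm

theorem dualConeD_exact (hn : n = g + 2) {rs : List R} (hrs : ∀ r ∈ rs, r ∈ Ideal.span (Set.range f))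
    (hreg : RingTheory.Sequence.IsWeaklyRegular R rs) (hlen : rs.length = g) (i : ℕ) :
    Function.Exact (κ.dualConeD hn (i + 1)) (κ.dualConeD hn i) := by
  rintro ⟨k, φ⟩
  constructor
  · intro hx
    obtain ⟨h1, h2⟩ := Prod.mk_eq_zero.1 hx
    by_cases hi : g < i + 1
    · have := subsingleton_exteriorPower (R := R) (show n < i + 4 by omega)
      have := F.subsingleton_coF hi
      exact ⟨0, Subsingleton.elim _ _⟩
    · obtain ⟨m, hm⟩ : ∃ m, m + (i + 1) = g := ⟨g - (i + 1), by omega⟩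
      refine κ.exists_dualConeD_eq hn hrs hreg hlen hm k φ (fun x => ?_) h1
      have h3 := congrFun h2 ⟨m + 1, by omega⟩
      exact LinearMap.congr_fun h3 x
  · rintro ⟨⟨k', φ'⟩, h⟩
    obtain ⟨rfl, rfl⟩ := Prod.mk.injEq _ _ _ _ ▸ h
    refine Prod.ext ?_ (coD_coD F g i φ')
    change koszulD f (i + 3) (koszulD f (i + 4) k' + κ.toKoszul hn (i + 2) φ') +
      κ.toKoszul hn (i + 1) (F.coD g (i + 1) φ') = 0
    rw [map_add, koszulD_koszulD, zero_add, koszulD_toKoszul, neg_add_cancel]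

/-- This is degree `g` on the dual cone, where the cocycle condition on `φ` is automatic because
`F_{g+1} = 0`. -/
theorem dualConeD_exact_aug (hn : n = g + 2) (hF : ∀ i, g < i → Subsingleton (F.F i)) {rs : List R}
    (hrs : ∀ r ∈ rs, r ∈ Ideal.span (Set.range f))
    (hreg : RingTheory.Sequence.IsWeaklyRegular R rs) (hlen : rs.length = g) :
    Function.Exact (κ.dualConeD hn 0) (κ.dualConeAug hn) := by
  rintro ⟨k, φ⟩
  constructor
  · intro hx
    have := hF (g + 1) (by omega)
    refine κ.exists_dualConeD_eq hn hrs hreg hlen (add_zero g) k φ (fun x => ?_) hx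
    rw [Subsingleton.elim x 0, map_zero, map_zero]
  · rintro ⟨⟨k', φ'⟩, h⟩
    obtain ⟨rfl, rfl⟩ := Prod.mk.injEq _ _ _ _ ▸ h
    change koszulD f 2 (koszulD f 3 k' + κ.toKoszul hn 1 φ') +
      κ.toKoszul hn 0 (F.coD g 0 φ') = 0
    rw [map_add, koszulD_koszulD, koszulD_toKoszul]
    exact (congrArg (· + _) (zero_add _)).trans (neg_add_cancel _)

/-- This is degree `g + 1`, the last one in the range below `g + 2`: there `F_{g+1} = 0`, and a
cocycle is just a cycle of `K₂`. -/
theorem dualConeAug_exact (hn : n = g + 2) (hF : ∀ i, g < i → Subsingleton (F.F i)) (hg : 1 ≤ g) {rs : List R}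
    (hrs : ∀ r ∈ rs, r ∈ Ideal.span (Set.range f))
    (hreg : RingTheory.Sequence.IsWeaklyRegular R rs) (hlen : rs.length = g) :
    Function.Exact (κ.dualConeAug hn) (koszulD f 1) := by
  obtain ⟨m, rfl⟩ : ∃ m, g = m + 1 := ⟨g - 1, by omega⟩
  have := hF (m + 2) (by omega)
  intro z
  constructor
  · intro hz
    obtain ⟨α', β', hα', hβ'⟩ := κ.exists_extension_succ hrs hreg (show m < rs.length by omega) 0
      (wedgeDual R 2 (m + 1) (by omega) z) (fun _ => rfl) (fun x => by
        have h1 := wedgeDual_koszulD f 1 (m + 1) (by omega) (by omega) z x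
        rw [hz, map_zero, LinearMap.zero_apply] at h1
        exact (neg_eq_zero.1 h1.symm).symm)
    obtain ⟨φ', hφ'⟩ := F.exists_coF_eq (add_zero (m + 1)) α'
    refine ⟨((wedgeDual R 3 m (by omega)).symm β', φ'), ?_⟩
    apply (wedgeDual R 2 (m + 1) (by omega)).injective
    refine LinearMap.ext fun x => ?_
    rw [hβ' x]
    change wedgeDual R 2 (m + 1) _ (koszulD f 2 ((wedgeDual R 3 m (by omega)).symm β') +
      κ.toKoszul hn 0 φ') x = _
    rw [map_add, LinearMap.add_apply, wedgeDual_koszulD f 2 m (by omega),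
      LinearEquiv.apply_symm_apply, κ.wedgeDual_toKoszul hn (add_zero (m + 1)), hφ',
      neg_add_eq_sub]
    rfl
  · rintro ⟨⟨k, φ⟩, rfl⟩
    change koszulD f 1 (koszulD f 2 k + κ.toKoszul hn 0 φ) = 0
    rw [map_add, koszulD_koszulD, zero_add]
    apply (wedgeDual R 1 (m + 2) (by omega)).injective
    refine LinearMap.ext fun x => ?_
    rw [wedgeDual_koszulD f 1 (m + 1) (by omega), κ.wedgeDual_toKoszul hn (add_zero (m + 1)),
      map_zero, LinearMap.comp_apply, ← κ.comm, Subsingleton.elim (κ.c (m + 1 + 1) x) 0, map_zero,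
      map_zero, neg_zero]
    rfl

end KoszulComparison

end QuotRes

end DualCone

/-! ### The resolution of `Z₂` tensored with `B` -/

section ResTwo

variable {R : Type u} [CommRing R] {n : ℕ} {f : Fin n → R}

open GrMod

/-- The terms of `resTwo` are products of tensor products, while base change yields tensor products
of products. This and the next two lemmas carry block maps across `prodRight`. -/
theorem baseChange_prodRight {A M N P : Type*} [CommRing A] [Algebra R A] [AddCommGroup M]
    [Module R M] [AddCommGroup N] [Module R N] [AddCommGroup P] [Module R P]
    (φ : M →ₗ[R] P) (ψ : N →ₗ[R] P) (x : A ⊗[R] (M × N)) :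
    (φ.coprod ψ).baseChange A x =
      (φ.baseChange A).coprod (ψ.baseChange A) (TensorProduct.prodRight R A A M N x) := by
  induction x using TensorProduct.induction_on with
  | zero => simp
  | tmul a x => simp [TensorProduct.tmul_add]
  | add x y hx hy => rw [map_add, map_add, map_add, hx, hy]

theorem prodRight_baseChange_prod {A L M N : Type*} [CommRing A] [Algebra R A] [AddCommGroup L]
    [Module R L] [AddCommGroup M] [Module R M] [AddCommGroup N] [Module R N]
    (φ : L →ₗ[R] M) (ψ : L →ₗ[R] N) (x : A ⊗[R] L) :
    TensorProduct.prodRight R A A M N ((φ.prod ψ).baseChange A x) =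
      (φ.baseChange A x, ψ.baseChange A x) := by
  induction x using TensorProduct.induction_on with
  | zero => rw [map_zero, map_zero, map_zero, map_zero, Prod.mk_zero_zero]
  | tmul a x => simp
  | add x y hx hy => rw [map_add, map_add, map_add, map_add, hx, hy, Prod.mk_add_mk]

theorem baseChange_snd {A M N P : Type*} [CommRing A] [Algebra R A] [AddCommGroup M]
    [Module R M] [AddCommGroup N] [Module R N] [AddCommGroup P] [Module R P]
    (ψ : N →ₗ[R] P) (x : A ⊗[R] (M × N)) :
    (ψ ∘ₗ LinearMap.snd R M N).baseChange A x =
      ψ.baseChange A (TensorProduct.prodRight R A A M N x).2 := by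
  induction x using TensorProduct.induction_on with
  | zero => simp
  | tmul a x => simp
  | add x y hx hy => rw [map_add, map_add, Prod.snd_add, map_add, hx, hy]

namespace QuotRes

theorem free_coF (F : QuotRes f) [∀ i, Module.Finite R (F.F i)] (g i : ℕ) :
    Module.Free R (F.coF g i) := by
  have := F.free
  have : Subsingleton {m : ℕ // m + i = g} := ⟨fun a b => Subtype.ext (by omega)⟩
  exact Module.Free.pi R (fun m : {m : ℕ // m + i = g} => Module.Dual R (F.F m.1))

/-- The summands `K_{i+3} ⊗ B(-2)` and `F*_{g-i} ⊗ B(-2)`. -/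
noncomputable abbrev termG (F : QuotRes f) (g i : ℕ) : GrMod R n :=
  (twist n (⋀[R]^(i + 3) (Fin n → R)) 2).prod (twist n (F.coF g i) 2)

namespace KoszulComparison

variable {F : QuotRes f} (κ : F.KoszulComparison) {g : ℕ}

/-- The differential of the cone of `F*_{g-•} → K_{•+2}`, tensored with `B`. -/
noncomputable def dG (hn : n = g + 2) (i : ℕ) :
    (F.termG g (i + 1)).carrier →ₗ[PolyB R n] (F.termG g i).carrier :=
  ((koszulDf f (i + 3)).coprod ((κ.toKoszul hn (i + 1)).baseChange (PolyB R n))).prod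
    ((F.coD g i).baseChange (PolyB R n) ∘ₗ LinearMap.snd (PolyB R n) _ _)

/-- The last map of the cone of `F*_{g-•} → K_{•+2}`, tensored with `B`. -/
noncomputable def augG (hn : n = g + 2) :
    (F.termG g 0).carrier →ₗ[PolyB R n] PolyB R n ⊗[R] (⋀[R]^2 (Fin n → R)) :=
  (koszulDf f 2).coprod ((κ.toKoszul hn 0).baseChange (PolyB R n))

theorem prodRight_dualConeD (hn : n = g + 2) (i : ℕ)
    (x : PolyB R n ⊗[R] ((⋀[R]^(i + 4) (Fin n → R)) × F.coF g (i + 1))) :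
    TensorProduct.prodRight R (PolyB R n) (PolyB R n) (⋀[R]^(i + 3) (Fin n → R)) (F.coF g i)
      ((κ.dualConeD hn i).baseChange (PolyB R n) x) =
    κ.dG hn i (TensorProduct.prodRight R (PolyB R n) (PolyB R n) _ _ x) := by
  rw [dualConeD, prodRight_baseChange_prod, baseChange_prodRight, baseChange_snd]
  rfl

theorem baseChange_dualConeAug (hn : n = g + 2)
    (x : PolyB R n ⊗[R] ((⋀[R]^3 (Fin n → R)) × F.coF g 0)) :
    (κ.dualConeAug hn).baseChange (PolyB R n) x =
      κ.augG hn (TensorProduct.prodRight R (PolyB R n) (PolyB R n) _ _ x) :=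
  baseChange_prodRight _ _ _

theorem dG_exact (hn : n = g + 2) {i : ℕ}
    (h : Function.Exact (κ.dualConeD hn (i + 1)) (κ.dualConeD hn i)) :
    Function.Exact (κ.dG hn (i + 1)) (κ.dG hn i) :=
  Function.Exact.of_ladder_linearEquiv_of_exact
    (e₁ := TensorProduct.prodRight R (PolyB R n) (PolyB R n) _ _)
    (e₂ := TensorProduct.prodRight R (PolyB R n) (PolyB R n) _ _)
    (e₃ := TensorProduct.prodRight R (PolyB R n) (PolyB R n) _ _)
    (LinearMap.ext fun x => (κ.prodRight_dualConeD hn _ x).symm)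
    (LinearMap.ext fun x => (κ.prodRight_dualConeD hn _ x).symm) (baseChange_exact h)

theorem dG_exact_aug (hn : n = g + 2)
    (h : Function.Exact (κ.dualConeD hn 0) (κ.dualConeAug hn)) :
    Function.Exact (κ.dG hn 0) (κ.augG hn) :=
  Function.Exact.of_ladder_linearEquiv_of_exact
    (e₁ := TensorProduct.prodRight R (PolyB R n) (PolyB R n) _ _)
    (e₂ := TensorProduct.prodRight R (PolyB R n) (PolyB R n) _ _)
    (e₃ := LinearEquiv.refl _ _)
    (LinearMap.ext fun x => (κ.prodRight_dualConeD hn _ x).symm)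
    (LinearMap.ext fun x => (κ.baseChange_dualConeAug hn x).symm) (baseChange_exact h)

theorem augG_exact (hn : n = g + 2)
    (h : Function.Exact (κ.dualConeAug hn) (koszulD f 1)) :
    Function.Exact (κ.augG hn) (koszulDf f 1) :=
  Function.Exact.of_ladder_linearEquiv_of_exact
    (e₁ := TensorProduct.prodRight R (PolyB R n) (PolyB R n) _ _)
    (e₂ := LinearEquiv.refl _ _) (e₃ := LinearEquiv.refl _ _)
    (LinearMap.ext fun x => (κ.baseChange_dualConeAug hn x).symm) rfl (baseChange_exact h)

theorem isHomog_dG (hn : n = g + 2) (i : ℕ) :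
    IsHomog (X := F.termG g (i + 1)) (Y := F.termG g i) (κ.dG hn i) :=
  fun k _ hx => ⟨add_mem (isHomog_koszulDf f _ _ k _ hx.1) (isHomog_baseChange _ _ k _ hx.2),
    isHomog_baseChange _ _ k _ hx.2⟩

theorem isHomog_augG (hn : n = g + 2) :
    IsHomog (X := F.termG g 0) (Y := twist n (⋀[R]^2 (Fin n → R)) 2) (κ.augG hn) :=
  fun k _ hx => add_mem (isHomog_koszulDf f _ _ k _ hx.1) (isHomog_baseChange _ _ k _ hx.2)

end KoszulComparison

end QuotRes

end ResTwo

/-! ### The resolution in deviation two -/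

section ResTwoAssembly

variable {R : Type u} [CommRing R] {n : ℕ} {f : Fin n → R}

open GrMod

namespace QuotRes

variable (F : QuotRes f)

/-- The sum of all terms of index `i + 2` of the resolution except for `F_{i+3} ⊗ B(-1)`. -/
noncomputable abbrev termE (g i : ℕ) : GrMod R n := (totMod R n 2 i).prod (F.termG g i)

theorem isGraded_termG (g i : ℕ) : (F.termG g i).IsGraded :=
  (isGraded_twist _ _ _).prod (isGraded_twist _ _ _)

theorem isProjective_termE [∀ i, Module.Finite R (F.F i)] (g i : ℕ) :
    (F.termE g i).IsProjective := by
  have := F.free_coF g i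
  exact (isProjective_totMod 2 i).prod ((isProjective_twist _ _ _).prod (isProjective_twist _ _ _))

/-- The differential `(t, y) ↦ (d t, c t + d y)` of the sum of all summands but `F_• ⊗ B(-1)`. -/
noncomputable def dE {F : QuotRes f} {g : ℕ}
    (dG : ∀ i, (F.termG g (i + 1)).carrier →ₗ[PolyB R n] (F.termG g i).carrier)
    (c : ∀ i, (totMod R n 2 (i + 1)).carrier →ₗ[PolyB R n] (F.termG g i).carrier) (i : ℕ) :
    (F.termE g (i + 1)).carrier →ₗ[PolyB R n] (F.termE g i).carrier :=
  (totD f 2 i ∘ₗ LinearMap.fst (PolyB R n) _ _).prod ((c i).coprod (dG i))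

variable {F} {g : ℕ}

theorem isHomog_dE {dG : ∀ i, (F.termG g (i + 1)).carrier →ₗ[PolyB R n] (F.termG g i).carrier}
    {c : ∀ i, (totMod R n 2 (i + 1)).carrier →ₗ[PolyB R n] (F.termG g i).carrier}
    (hdG : ∀ i, IsHomog (X := F.termG g (i + 1)) (Y := F.termG g i) (dG i))
    (hc : ∀ i, IsHomog (X := totMod R n 2 (i + 1)) (Y := F.termG g i) (c i)) (i : ℕ) :
    IsHomog (X := F.termE g (i + 1)) (Y := F.termE g i) (dE dG c i) :=
  fun k _ hx => ⟨isHomog_totD f 2 i k _ hx.1, add_mem (hc i k _ hx.1) (hdG i k _ hx.2)⟩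

/-- Given a resolution `dG` of the cycles in `K₂ ⊗ B`, the maps `c` from `T_•` to it that turn the
sum into a resolution of the cycles of `∂_y` on `Z₁ ⊗ B`. -/
theorem exists_totMod_hom (hZ : ApproxAcyclic f)
    (hK : ∀ i, 2 ≤ i → Function.Exact (koszulD f (i + 1)) (koszulD f i))
    {dG : ∀ i, (F.termG g (i + 1)).carrier →ₗ[PolyB R n] (F.termG g i).carrier}
    {ε : (F.termG g 0).carrier →ₗ[PolyB R n] PolyB R n ⊗[R] (⋀[R]^2 (Fin n → R))}
    (hdG : ∀ i, IsHomog (X := F.termG g (i + 1)) (Y := F.termG g i) (dG i))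
    (hε : IsHomog (X := F.termG g 0) (Y := twist n (⋀[R]^2 (Fin n → R)) 2) ε)
    (hex : ∀ i, Function.Exact (dG (i + 1)) (dG i)) (hexε : Function.Exact (dG 0) ε)
    (hεex : Function.Exact ε (koszulDf f 1)) :
    ∃ c : ∀ i, (totMod R n 2 (i + 1)).carrier →ₗ[PolyB R n] (F.termG g i).carrier,
      (∀ i, IsHomog (X := totMod R n 2 (i + 1)) (Y := F.termG g i) (c i)) ∧
      (∀ t, ε (c 0 t) = koszulDy R n 2 (koszulDf f 3 (t 0))) ∧
      ∀ i, Function.Exact (dE dG c (i + 1)) (dE dG c i) := by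
  let ψ : (totMod R n 2 1).carrier →ₗ[PolyB R n] PolyB R n ⊗[R] (⋀[R]^2 (Fin n → R)) :=
    koszulDy R n 2 ∘ₗ koszulDf f 3 ∘ₗ LinearMap.proj 0
  have hψ : IsHomog (X := totMod R n 2 1) (Y := twist n (⋀[R]^2 (Fin n → R)) 2) ψ := fun k x hx =>
    isHomog_koszulDy 2 2 k _ (isHomog_koszulDf f 3 3 k _ (hx 0 trivial))
  -- The map `∂_y ∂_f` from `K₄ ⊗ B(-3)` has values in `Z₂ ⊗ B(-2)`, which is the image of `ε`, and
  -- lifts there by projectivity.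
  obtain ⟨c₀, hc₀, hc₀'⟩ := isProjective_totMod 2 1 (F.termG g 0)
    (twist n (⋀[R]^2 (Fin n → R)) 2) (F.isGraded_termG g 0) (isGraded_twist _ _ _) ε ψ hε hψ
    (fun x => (hεex _).1 (by
      change koszulDf f 1 (koszulDy R n 2 (koszulDf f 3 (x 0))) = 0
      rw [koszulDf_koszulDy, koszulDf_koszulDf, map_zero, neg_zero]))
  have hc₀'' : ∀ t, ε (c₀ t) = koszulDy R n 2 (koszulDf f 3 (t 0)) := hc₀'
  obtain ⟨c, rfl, hc, hcd⟩ := exists_anticomm (E := fun i => totMod R n 2 (i + 1))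
    (Y := F.termG g) (dE := fun i => totD f 2 (i + 1)) (dY := dG)
    (fun i => isHomog_totD f 2 (i + 1)) hdG (fun i => isProjective_totMod 2 (i + 1))
    (F.isGraded_termG g) (fun i => totD_totD f 2 (i + 1)) hex c₀ hc₀ (fun x => (hexε _).1 (by
      rw [hc₀'']
      change koszulDy R n 2 (koszulDf f 3 (koszulDf f 4 (x 0) + koszulDy R n 4 (x 1))) = 0
      rw [map_add, koszulDf_koszulDf, zero_add, koszulDf_koszulDy, map_neg, koszulDy_koszulDy,
        neg_zero]))
  refine ⟨c, hc, hc₀'', ?_⟩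
  rintro (_ | i)
  · have h1 := coneMap_exact_one (E := fun i => (totMod R n 2 (i + 1)).carrier)
      (Y := fun i => (F.termG g i).carrier) hcd hex (fun t y h => by
        have h2 := hc₀'' t
        rw [h, hexε.apply_apply_eq_zero] at h2
        obtain ⟨w, hw, hw'⟩ := hZ.exists_cycle 2 (koszulDf f 3 (t 0)) (koszulDf_koszulDf f 2 _)
          h2.symm
        exact mem_range_totD_one hK t w hw hw')
    -- The target of `dE dG c 0` has the additional factor `T_{-1}`, a product over `Fin 0` and
    -- hence zero.
    exact fun x => Iff.trans ⟨fun h => congrArg Prod.snd h,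
      fun h => Prod.ext (funext fun p => p.elim0) h⟩ (h1 x)
  · exact coneMap_exact (E := fun i => (totMod R n 2 (i + 1)).carrier)
      (Y := fun i => (F.termG g i).carrier) hcd (totD_exact hZ hK) hex i

/-- Moving the summand `F_{i+3} ⊗ B(-1)` to the last place. -/
def shuffle (A : Type*) [CommRing A] (T X Y : Type*) [AddCommGroup T] [Module A T]
    [AddCommGroup X] [Module A X] [AddCommGroup Y] [Module A Y] :
    (T × (X × Y)) ≃ₗ[A] ((T × Y) × X) where
  toFun a := ((a.1, a.2.2), a.2.1)
  invFun a := (a.1.1, (a.2, a.1.2))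
  left_inv _ := rfl
  right_inv _ := rfl
  map_add' _ _ := rfl
  map_smul' _ _ := rfl

theorem exact_conj {A M₁ M₂ M₃ N₁ N₂ N₃ : Type*} [CommRing A] [AddCommGroup M₁] [Module A M₁]
    [AddCommGroup M₂] [Module A M₂] [AddCommGroup M₃] [Module A M₃] [AddCommGroup N₁] [Module A N₁]
    [AddCommGroup N₂] [Module A N₂] [AddCommGroup N₃] [Module A N₃] {φ : N₁ →ₗ[A] N₂}
    {ψ : N₂ →ₗ[A] N₃} (h : Function.Exact φ ψ) (e₁ : M₁ ≃ₗ[A] N₁) (e₂ : M₂ ≃ₗ[A] N₂)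
    (e₃ : M₃ ≃ₗ[A] N₃) :
    Function.Exact (e₂.symm.toLinearMap ∘ₗ φ ∘ₗ e₁.toLinearMap)
      (e₃.symm.toLinearMap ∘ₗ ψ ∘ₗ e₂.toLinearMap) := by
  intro x
  change e₃.symm (ψ (e₂ x)) = 0 ↔ _
  rw [LinearEquiv.map_eq_zero_iff, h]
  exact ⟨fun ⟨y, hy⟩ => ⟨e₁.symm y, by simp [hy]⟩, fun ⟨y, hy⟩ => ⟨e₁ y, by simp [← hy]⟩⟩

/-- The resolution of `Sym(I)` for a perfect ideal of deviation two. -/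
theorem exists_resTwo (hZ : ApproxAcyclic f)
    (hK : ∀ i, 2 ≤ i → Function.Exact (koszulD f (i + 1)) (koszulD f i))
    [∀ i, Module.Finite R (F.F i)] (κ : F.KoszulComparison) (hn : n = g + 2)
    (h₁ : ∀ i, Function.Exact (κ.dualConeD hn (i + 1)) (κ.dualConeD hn i))
    (h₂ : Function.Exact (κ.dualConeD hn 0) (κ.dualConeAug hn))
    (h₃ : Function.Exact (κ.dualConeAug hn) (koszulD f 1)) :
    ∃ δ : (i : ℕ) → (F.resTwo g (i + 1)).carrier →ₗ[PolyB R n] (F.resTwo g i).carrier,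
      IsGradedFreeResolution (F.resTwo g) δ (symAug f) ∧ F.IsConeTwo g δ := by
  have hexε := κ.dG_exact_aug hn h₂
  have hεex := κ.augG_exact hn h₃
  obtain ⟨c, hc, hcε, hex⟩ := exists_totMod_hom hZ hK (κ.isHomog_dG hn) (κ.isHomog_augG hn)
    (fun i => κ.dG_exact hn (h₁ i)) hexε hεex
  have hdE := isHomog_dE (κ.isHomog_dG hn) hc
  let η : (F.termE g 0).carrier →ₗ[PolyB R n] PolyB R n ⊗[R] (⋀[R]^1 (Fin n → R)) :=
    koszulDy R n 1 ∘ₗ κ.augG hn ∘ₗ LinearMap.snd (PolyB R n) _ _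
  have hη : IsHomog (X := F.termE g 0) (Y := twist n (⋀[R]^1 (Fin n → R)) 1) η := fun k x hx =>
    isHomog_koszulDy 1 1 k _ (κ.isHomog_augG hn k _ hx.2)
  obtain ⟨b, hb, e₀, e₁, e₂⟩ := F.exists_cone (E := F.termE g) (dE := dE (κ.dG hn) c) hdE
    (F.isProjective_termE g) hex η hη
    (by
      intro x
      constructor
      · intro hx
        -- A `∂_y`-cycle in `Z₂ ⊗ B` is `∂_y w` with `w ∈ Z₃ ⊗ B`, and `w = ∂_f s`. So it equals the
        -- image of `c 0 s`, and the rest of `x` is a boundary of the dual cone.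
        obtain ⟨w, hw, hw'⟩ := hZ.exists_cycle 1 (κ.augG hn x.2) (hεex.apply_apply_eq_zero _) hx
        obtain ⟨s, rfl⟩ := (koszulDf_exact (hK 2 le_rfl) w).1 hw
        obtain ⟨y, hy⟩ := (hexε (x.2 - c 0 (fun _ => s))).1 (by
          rw [map_sub, hcε, hw', sub_self])
        refine ⟨(fun _ => s, y), Prod.ext (funext fun p => p.elim0) ?_⟩
        exact (congrArg (c 0 (fun _ => s) + ·) hy).trans (add_sub_cancel _ _)
      · rintro ⟨y, rfl⟩
        change koszulDy R n 1 (κ.augG hn (c 0 y.1 + κ.dG hn 0 y.2)) = 0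
        rw [map_add, hcε, hexε.apply_apply_eq_zero, add_zero, koszulDy_koszulDy])
    (fun x => by
      change koszulDf f 0 (koszulDy R n 1 (κ.augG hn x.2)) = 0
      rw [koszulDf_koszulDy, hεex.apply_apply_eq_zero, map_zero, neg_zero])
    (fun x => koszulDy_koszulDy 0 _)
    (fun z hz hz' => by
      obtain ⟨w, hw, rfl⟩ := hZ.exists_cycle 0 z hz hz'
      obtain ⟨s, rfl⟩ := (hεex w).1 hw
      exact ⟨(0, s), rfl⟩)
  -- The cone places `F_{i+3} ⊗ B(-1)` last, whereas `resTwo` has it second; `ρ` reconciles the two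
  -- orders.
  let ρ := fun i => shuffle (PolyB R n) (totMod R n 2 i).carrier (F.termF (i + 3)).carrier
    (F.termG g i).carrier
  let D := fun i => coneMap (E := fun i => (F.termE g i).carrier)
    (Y := fun i => (F.termF (i + 2)).carrier) (dE (κ.dG hn) c) F.dB b i
  let δ : (i : ℕ) → (F.resTwo g (i + 1)).carrier →ₗ[PolyB R n] (F.resTwo g i).carrier := fun i =>
    match i with
    | 0 => F.firstMap
    | 1 => (b 0).coprod (F.dB 0) ∘ₗ (ρ 0).toLinearMap
    | i + 2 => (ρ i).symm.toLinearMap ∘ₗ D i ∘ₗ (ρ (i + 1)).toLinearMap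
  have := F.free
  have := F.free_coF g
  refine ⟨δ, ⟨?_, ?_, ?_, F.exact_firstMap_symAug, symAug_surjective f⟩, ⟨?_, ?_, ?_, ?_, ?_⟩⟩
  · rintro (_ | _ | i)
    · exact inferInstanceAs (Module.Free (PolyB R n) (PolyB R n))
    · exact inferInstanceAs (Module.Free (PolyB R n) (PolyB R n ⊗[R] F.F 2))
    · exact inferInstanceAs (Module.Free (PolyB R n)
        ((Fin i → PolyB R n ⊗[R] (⋀[R]^(3 + i) (Fin n → R))) ×
          (PolyB R n ⊗[R] F.F (i + 3) × (PolyB R n ⊗[R] (⋀[R]^(i + 3) (Fin n → R)) ×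
            PolyB R n ⊗[R] F.coF g i))))
  · rintro (_ | _ | i)
    · exact F.isHomog_firstMap
    · exact fun k x hx => add_mem (hb 0 k _ ⟨hx.1, hx.2.2⟩) (F.isHomog_dB 0 k _ hx.2.1)
    · intro k x hx
      have := isHomog_coneMap (E := F.termE g) (Y := fun i => F.termF (i + 2)) hdE F.isHomog_dB hb
        i k (ρ (i + 1) x) ⟨⟨hx.1, hx.2.2⟩, hx.2.1⟩
      exact ⟨this.1.1, this.2, this.1.2⟩
  · rintro (_ | _ | i)
    · intro x
      exact (e₀ x).trans ⟨fun ⟨y, hy⟩ => ⟨(ρ 0).symm y, hy⟩, fun ⟨y, hy⟩ => ⟨ρ 0 y, hy⟩⟩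
    · exact exact_conj e₁ (ρ 1) (ρ 0) (LinearEquiv.refl _ _)
    · exact exact_conj (e₂ i) (ρ (i + 2)) (ρ (i + 1)) (ρ i)
  · exact fun x => rfl
  · rintro (_ | i) x
    · exact (congrArg (· + F.dB 0 x) (map_zero (b 0))).trans (zero_add _)
    · refine Prod.ext (map_zero (totD f 2 i)) (Prod.ext ?_ ?_)
      · exact (congrArg (· + F.dB (i + 1) x) (map_zero (b (i + 1)))).trans (zero_add _)
      · exact map_zero ((c i).coprod (κ.dG hn i))
  · intro i x
    refine ⟨b (i + 1) (0, (x, 0)), Prod.ext ?_ (Prod.ext ?_ (Prod.ext ?_ ?_))⟩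
    · exact (map_zero (totD f 2 i)).trans (add_zero _).symm
    · exact congrArg (b (i + 1) (0, (x, 0)) + ·) (map_zero (F.dB (i + 1)))
    · change (c i 0).1 + (koszulDf f (i + 3) x +
        (κ.toKoszul hn (i + 1)).baseChange (PolyB R n) 0) = 0 + koszulDf f (i + 3) x
      rw [map_zero, map_zero, add_zero, Prod.fst_zero]
    · change (c i 0).2 + (F.coD g i).baseChange (PolyB R n) 0 = 0 + 0
      rw [map_zero, map_zero, Prod.snd_zero]
  · intro i x
    refine ⟨b (i + 1) (0, (0, x)), (κ.toKoszul hn (i + 1)).baseChange (PolyB R n) x,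
      Prod.ext ?_ (Prod.ext ?_ (Prod.ext ?_ ?_))⟩
    · exact (map_zero (totD f 2 i)).trans ((add_zero _).trans (add_zero _)).symm
    · change b (i + 1) (0, (0, x)) + F.dB (i + 1) 0 = b (i + 1) (0, (0, x)) + 0 + 0
      rw [map_zero, add_zero, add_zero]
    · change (c i 0).1 + (koszulDf f (i + 3) 0 +
        (κ.toKoszul hn (i + 1)).baseChange (PolyB R n) x) =
        0 + (κ.toKoszul hn (i + 1)).baseChange (PolyB R n) x + 0
      rw [map_zero, map_zero, Prod.fst_zero, zero_add, add_zero]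
    · change (c i 0).2 + (F.coD g i).baseChange (PolyB R n) x =
        0 + 0 + (F.coD g i).baseChange (PolyB R n) x
      rw [map_zero, Prod.snd_zero, add_zero]
  · exact fun i x => rfl

end QuotRes

end ResTwoAssembly

theorem mainTheorem10 {R : Type u} [CommRing R] [IsLocalRing R] (hR : IsCohenMacaulayLocal R)
    (n g : ℕ) (f : Fin n → R)
    (hn : (Ideal.span (Set.range f)).spanFinrank = n)
    (hg : (Ideal.span (Set.range f)).height = g) (hg1 : 1 ≤ g)
    (hZ : ApproxAcyclic f) (F : QuotRes f) :
    (n = g + 1 →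
      ∃ δ : (i : ℕ) → (F.resOne (i + 1)).carrier →ₗ[PolyB R n] (F.resOne i).carrier,
        IsGradedFreeResolution F.resOne δ (symAug f) ∧ F.IsConeOne δ) ∧
    (n = g + 2 → IsPerfectIdeal (Ideal.span (Set.range f)) →
      F.IsMinimal → (∀ i, g < i → Subsingleton (F.F i)) →
      ∃ δ : (i : ℕ) → (F.resTwo g (i + 1)).carrier →ₗ[PolyB R n] (F.resTwo g i).carrier,
        IsGradedFreeResolution (F.resTwo g) δ (symAug f) ∧ F.IsConeTwo g δ) := by
  -- One weakly regular sequence of length `g` in `I` gives both the Koszul vanishing above `n - g`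
  -- and the exactness of the dual cone.
  obtain ⟨rs, hlen, hrs, hreg⟩ := hR.exists_isWeaklyRegular hg
  refine ⟨fun hn => ?_, fun hn _ hmin hF => ?_⟩
  · exact F.exists_resOne hZ
      (koszulD_exact_of_isWeaklyRegular f (by omega) hrs hreg)
  · have := hmin.1
    obtain ⟨κ⟩ := F.nonempty_koszulComparison
    exact QuotRes.exists_resTwo hZ (koszulD_exact_of_isWeaklyRegular f (by omega) hrs hreg) κ hn
      (κ.dualConeD_exact hn hrs hreg hlen) (κ.dualConeD_exact_aug hn hF hrs hreg hlen)
      (κ.dualConeAug_exact hn hF hg1 hrs hreg hlen)
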